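/- **Conventions.** For a finite index set $I$ and $y\in\mathbb R^I$ let $\|y\|_2^2:=\mathbb E_{i\in I}[y_i^2]$ and $y\cdot y':=\mathbb E_{i\in I}[y_iy'_i]$ (uniform average over $I$). A point $x\in\mathbb R^{4\times m}$ has blocks $x|_1,\dots,x|_4\in\mathbb R^m$; $x_4:=\mathbb E_j[x_{4,j}]$; $\mathbf a$ denotes a constant block; $e:=(\mathbf 0,\mathbf 0,\mathbf 0,\mathbf 1)$. **Data.** $G$ is a loopless digraph on $\{0,1\}^n$ with all in- and out-degrees at most $1$ in which the special vertex $0^n$ has no predecessor; $S(v),P(v)$ are the successor and predecessor of $v$ in $G$ ($\perp$ if there is none). $\mathrm{Enc}:\{0,1\}^n\to\{0,1\}^m$ is a code with $\mathrm{Enc}(0^n)=0^m$ and relative distance at least $\rho>0$. Let $h,\delta>0$. **Brouwer segments.** The first segment goes from $(\mathbf 0,\mathbf 0,\mathbf 0,\mathbf 2)$ to $0$. Each edge $u\to v$ of $G$, with $U=\mathrm{Enc}(u)$, $V=\mathrm{Enc}(v)$, gives the four segments joining consecutively $(U,U,\mathbf 0,\mathbf 0),(U,V,\mathbf 0,\mathbf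 0),(U,V,\mathbf 1,\mathbf 0),(V,V,\mathbf 1,\mathbf 0),(V,V,\mathbf 0,\mathbf 0)$. For a segment $(s\to t)$ let $\tau_{(s\to t)}(x)=\frac{(t-s)\cdot(x-s)}{\|t-s\|_2^2}$, and let its direction be $\frac{t-s}{\|t-s\|_2}$, except that the first segment has direction $-e$. **The function $f$.** For $z\in\mathbb R^{4\times m}$ and a direction $u$, let $\mathrm{pr}_{u,z}(x)$ be $\delta u$, $\delta\frac{z-x}h$, $-\delta u$, $\delta e$ when $\|x-z\|_2$ is $0$, $h$, $2h$, $\ge 3h$ respectively, linearly interpolated in $\|x-z\|_2$ in between. The untruncated displacement $\hat g(x)$ is defined as follows. If $x_4<1/2$: * *(line)* if some segment $(s\to t)$ of direction $u$ has $\tau=\tau_{(s\to t)}(x)\in[\sqrt h,1-\sqrt h]$ and $\|x-z\|_2\le 3h$ for $z=\tau t+(1-\tau)s$, then $\hat g(x)=\mathrm{pr}_{u,z}(x)$; * *(vertex)* if $(s\to y),(y\to t)$ are consecutive segments with directions $u,u'$, if $\Delta=\tau_{(s\to y)}(x)-(1-\sqrt h)\ge0$ and $\Delta'=\sqrt h-\tau_{(y\to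 t)}(x)\ge 0$, and if $\|x-z\|_2\le3h$ for $\psi=\frac{\Delta'}{\Delta+\Delta'}$ and $z=\psi z_{(s\to y)}+(1-\psi)z_{(y\to t)}$, where $z_{(s\to y)}$ and $z_{(y\to t)}$ are the points of the two segments with $\tau_{(s\to y)}=1-\sqrt h$ and $\tau_{(y\to t)}=\sqrt h$, then $\hat g(x)=\mathrm{pr}_{\psi u+(1-\psi)u',\,z}(x)$; * *(ends)* if $(s\to t)$ is the last segment of a path, $\tau\in[1-\sqrt h,1]$ and $\|x-z\|_2\le3h$, with $u,\tau,z$ as in (line), then $\hat g(x)=w\,\mathrm{pr}_{u,z}(x)+(1-w)\delta e$ with $w=(1-\tau)/\sqrt h$; symmetrically, with $\tau\in[0,\sqrt h]$ and $w=\tau/\sqrt h$, for the first segment of a path other than the path starting at $(\mathbf 0,\mathbf 0,\mathbf 0,\mathbf 2)$; * *(default)* $\hat g(x)=\delta e$ otherwise. If $x_4\ge 1/2$: let $z=x_4\cdot e$ and $\tau=\frac{2-x_4}{3/2}$; then $\hat g(x)=\tau\,\mathrm{pr}_{-e,z}(x)+(1-\tau)\,\mathrm{top}(x)$, where $\mathrm{top}(x)$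 is $-\delta e$ for $x=z$ and $\delta\frac{z-x}h$ for $\|x-z\|_2\ge h$, linearly interpolated in $\|x-z\|_2$ in between. Finally $f_i(x)=\max\{-1,\min\{2,x_i+\hat g_i(x)\}\}$. **Random coordinate sets.** Divide $[m]$ into $c$ columns of equal size, and let $T\subseteq[m]$ be the union of the columns in a random set $R\subseteq[c]$ that has density $1/\ell$ and is $k$-wise independent up to relative error $\theta$: $|\Pr[K\subseteq R]-\ell^{-|K|}|\le\theta\,\ell^{-|K|}$ for every $K\subseteq[c]$ with $|K|\le k$. **Lemma.** There is an absolute constant $\kappa$ such that, whenever $h$ is small enough in terms of $\rho$ and $\delta$ is small enough in terms of $\rho,h$, the following holds. There are algorithms, one for each $n,m$ and $\mathrm{Enc}$ (not depending on $G$, $x$ or the law of $T$), whose inputs are * $i\in[4]\times[m]$, $T$, and a real number $\hat x_i$; * for each $r\in\{1,2\}$: $(v_r,S(v_r),P(v_r))$ if $x|_r$ is $8\sqrt h$-close to $\mathrm{Enc}(v_r)$ for some $v_r$; $\perp$ if $x|_r$ is $25\sqrt h$-far from all codewords; and, if the distance to the nearest codeword $\mathrm{Enc}(v_r)$ is in $[8\sqrt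 h,25\sqrt h]$, either $(v_r,S(v_r),P(v_r))$ or $\perp$, arbitrarily; * $\hat x\in[-1,2]^{[4]\times T}$; and whose output, computed from the real inputs by a finite program of field operations, square roots and comparisons selected by the discrete inputs, satisfies the following for every $G$ and every $x\in[-1,2]^{4\times m}$. With probability $1-o(1)$ over $T$, simultaneously for all $i$, all allowed vertex information, all $\varepsilon\ge0$ and all $\hat x_i,\hat x$ with $|\hat x_i-x_i|\le\varepsilon$ and $\|\hat x|_r-x|_{\{r\}\times T}\|_2\le\varepsilon$ for $r=1,\dots,4$, the output is within $\kappa\varepsilon+o(1)$ of $f_i(x)$. In particular ($\varepsilon=0$), from the exact values $x_i$ and $x|_{[4]\times T}$ the algorithm computes $f_i(x)$ up to $o(1)$ with probability $1-o(1)$. Here $o(1)$ means: for fixed $\rho,h,\delta$ it tends to $0$ as $k\to\infty$, $c/\ell\to\infty$ and $\theta\to0$, uniformly in all other data. -/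

import Mathlib

/-! ## Points, normalised norms, codes -/

/-- Vertices of the End-of-Line graph; the special vertex is the all-`false` string. -/
abbrev Vertex (n : ℕ) := Fin n → Bool

/-- Points of `ℝ^{4 × m}`; block number `r` (counted from `0`) is `fun j => x (r, j)`. -/
abbrev Point (m : ℕ) := Fin 4 × Fin m → ℝ

/-- Normalised dot product `E_i [x_i y_i]`. -/
noncomputable def avgDot {ι : Type} [Fintype ι] (x y : ι → ℝ) : ℝ :=
  (∑ i, x i * y i) / Fintype.card ι

/-- Normalised 2-norm `(E_i [x_i ^ 2]) ^ (1/2)`. -/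
noncomputable def rms {ι : Type} [Fintype ι] (x : ι → ℝ) : ℝ :=
  Real.sqrt (avgDot x x)

/-- The `r`-th `m`-tuple of a point. -/
def block {m : ℕ} (x : Point m) (r : Fin 4) : Fin m → ℝ := fun j => x (r, j)

/-- The point with the four given blocks. -/
def blocks {m : ℕ} (a b c d : Fin m → ℝ) : Point m := fun p => ![a, b, c, d] p.1 p.2

/-- A binary code with message length `n` and block length `m` that encodes zero by zero. -/
structure Code (n m : ℕ) where
  enc : Vertex n → Fin m → Bool
  enc_zero : enc (fun _ => false) = fun _ => false

/-- Relative distance at least `ρ`. -/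
def Code.HasRelDist {n m : ℕ} (C : Code n m) (ρ : ℝ) : Prop :=
  ∀ u v, u ≠ v → ρ * m ≤ (hammingDist (C.enc u) (C.enc v) : ℝ)

/-- A codeword as a real `0/1` vector. -/
def Code.word {n m : ℕ} (C : Code n m) (v : Vertex n) : Fin m → ℝ :=
  fun j => if C.enc v j then 1 else 0

/-- An End-of-Line graph: a loopless digraph on `{0,1}^n` with all in- and out-degrees at most one,
given by its successor and predecessor maps (`none` stands for `⊥`, "there is none"), in which the
special vertex `0` has no predecessor. -/
structure EoLGraph (n : ℕ) where
  succ : Vertex n → Option (Vertex n)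
  pred : Vertex n → Option (Vertex n)
  succ_iff_pred : ∀ u v, succ u = some v ↔ pred v = some u
  no_loop : ∀ u, succ u ≠ some u
  pred_zero : pred (fun _ => false) = none

/-! ## Brouwer vertices and line segments -/

/-- The five Brouwer vertices `x^1(u,v), …, x^5(u,v)` of an edge `u → v`. -/
def Code.brouwerVertex {n m : ℕ} (C : Code n m) (u v : Vertex n) : Fin 5 → Point m :=
  ![blocks (C.word u) (C.word u) 0 0,
    blocks (C.word u) (C.word v) 0 0,
    blocks (C.word u) (C.word v) 1 0,
    blocks (C.word v) (C.word v) 1 0,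
    blocks (C.word v) (C.word v) 0 0]

/-- Names of Brouwer line segments: the first one, from `(0,0,0,2)` to `0`, and the four segments
from `x^τ(u,v)` to `x^{τ+1}(u,v)` of a pair `(u,v)`. -/
inductive Segment (n : ℕ) where
  | first : Segment n
  | edge (u v : Vertex n) (τ : Fin 4) : Segment n

/-- The segments that are present: the first one, and those of the edges of `G`. -/
def EoLGraph.IsSegment {n : ℕ} (G : EoLGraph n) : Segment n → Prop
  | .first => True
  | .edge u v _ => G.succ u = some v

/-- Start point of a segment. -/
def Code.src {n m : ℕ} (C : Code n m) : Segment n → Point m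
  | .first => blocks 0 0 0 2
  | .edge u v τ => C.brouwerVertex u v τ.castSucc

/-- End point of a segment. -/
def Code.tgt {n m : ℕ} (C : Code n m) : Segment n → Point m
  | .first => 0
  | .edge u v τ => C.brouwerVertex u v τ.succ

/-- The default direction `(0,0,0,1)`. -/
def up (m : ℕ) : Point m := blocks 0 0 0 1

/-- Direction of a segment `s → t`: `(t - s) / ‖t - s‖`, except that the first segment has
direction `(0,0,0,-1)`. -/
noncomputable def Code.dir {n m : ℕ} (C : Code n m) : Segment n → Point m
  | .first => -up m
  | .edge u v τ =>
      (rms (C.tgt (.edge u v τ) - C.src (.edge u v τ)))⁻¹ •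
        (C.tgt (.edge u v τ) - C.src (.edge u v τ))

/-- `τ_{(s→t)}(x)`: relative position of the projection of `x` to the line through `s` and `t`
(`0` at `s`, `1` at `t`). -/
noncomputable def Code.tau {n m : ℕ} (C : Code n m) (e : Segment n) (x : Point m) : ℝ :=
  avgDot (C.tgt e - C.src e) (x - C.src e) / rms (C.tgt e - C.src e) ^ 2

/-- The point `a t + (1 - a) s` on the line of a segment `s → t`. -/
noncomputable def Code.pointAt {n m : ℕ} (C : Code n m) (e : Segment n) (a : ℝ) : Point m :=
  a • C.tgt e + (1 - a) • C.src e

/-! ## Displacement inside the picture -/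

/-- The displacement at `x` belonging to the nearby point `z` of the path and the direction `u`:
`δ u` at distance `0`, `δ (z - x) / h` at distance `h`, `-δ u` at distance `2h`, the default
displacement from distance `3h` on, linearly interpolated in between. -/
noncomputable def profile {m : ℕ} (h δ : ℝ) (u z x : Point m) : Point m :=
  let d := rms (x - z)
  if d ≤ h then (1 - d / h) • (δ • u) + (d / h) • ((δ / h) • (z - x))
  else if d ≤ 2 * h then (2 - d / h) • ((δ / h) • (z - x)) + (d / h - 1) • (-(δ • u))
  else if d ≤ 3 * h then (3 - d / h) • (-(δ • u)) + (d / h - 2) • (δ • up m)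
  else δ • up m

/-- Displacement near the line of `e`. -/
noncomputable def Code.lineDisp {n m : ℕ} (C : Code n m) (h δ : ℝ) (e : Segment n) (x : Point m) :
    Point m :=
  profile h δ (C.dir e) (C.pointAt e (C.tau e x)) x

/-- `x` is within `3h` of the line of `e`, at relative position in `[a, b]`. -/
def Code.NearLine {n m : ℕ} (C : Code n m) (h a b : ℝ) (e : Segment n) (x : Point m) : Prop :=
  a ≤ C.tau e x ∧ C.tau e x ≤ b ∧ rms (x - C.pointAt e (C.tau e x)) ≤ 3 * h

/-- `Δ_{(s→y)}(x)` for the segment `e = (s→y)` coming into `y`. -/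
noncomputable def Code.deltaIn {n m : ℕ} (C : Code n m) (h : ℝ) (e : Segment n) (x : Point m) : ℝ :=
  C.tau e x - (1 - Real.sqrt h)

/-- `Δ_{(y→t)}(x)` for the segment `e' = (y→t)` going out of `y`. -/
noncomputable def Code.deltaOut {n m : ℕ} (C : Code n m) (h : ℝ) (e' : Segment n) (x : Point m) :
    ℝ :=
  Real.sqrt h - C.tau e' x

/-- The interpolation parameter `ψ_y(x)` at the common vertex `y` of `e = (s→y)`, `e' = (y→t)`. -/
noncomputable def Code.psi {n m : ℕ} (C : Code n m) (h : ℝ) (e e' : Segment n) (x : Point m) : ℝ :=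
  C.deltaOut h e' x / (C.deltaOut h e' x + C.deltaIn h e x)

/-- The point `z = ψ z_{(s→y)} + (1 - ψ) z_{(y→t)}` of the segment that cuts the corner at `y`. -/
noncomputable def Code.cornerPoint {n m : ℕ} (C : Code n m) (h : ℝ) (e e' : Segment n)
    (x : Point m) : Point m :=
  C.psi h e e' x • C.pointAt e (1 - Real.sqrt h) +
    (1 - C.psi h e e' x) • C.pointAt e' (Real.sqrt h)

/-- Displacement near the common vertex of two consecutive segments. -/
noncomputable def Code.cornerDisp {n m : ℕ} (C : Code n m) (h δ : ℝ) (e e' : Segment n)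
    (x : Point m) : Point m :=
  profile h δ (C.psi h e e' x • C.dir e + (1 - C.psi h e e' x) • C.dir e')
    (C.cornerPoint h e e' x) x

/-- `x` is near the corner that the segments `e` and `e'` form. -/
def Code.NearCorner {n m : ℕ} (C : Code n m) (h : ℝ) (e e' : Segment n) (x : Point m) : Prop :=
  0 ≤ C.deltaIn h e x ∧ 0 ≤ C.deltaOut h e' x ∧ rms (x - C.cornerPoint h e e' x) ≤ 3 * h

/-- `e` and `e'` are consecutive segments of the Brouwer path. -/
def Code.Consecutive {n m : ℕ} (C : Code n m) (G : EoLGraph n) (e e' : Segment n) : Prop :=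
  G.IsSegment e ∧ G.IsSegment e' ∧ C.tgt e = C.src e'

/-- `e` is the last segment of a path. -/
def Code.IsFinal {n m : ℕ} (C : Code n m) (G : EoLGraph n) (e : Segment n) : Prop :=
  G.IsSegment e ∧ ∀ e', G.IsSegment e' → C.src e' ≠ C.tgt e

/-- `e` is the first segment of a path other than the one that starts at `(0,0,0,2)`. -/
def Code.IsInitial {n m : ℕ} (C : Code n m) (G : EoLGraph n) (e : Segment n) : Prop :=
  G.IsSegment e ∧ e ≠ .first ∧ ∀ e', G.IsSegment e' → C.tgt e' ≠ C.src e

open Classical in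
/-- Untruncated displacement inside the picture. -/
noncomputable def Code.insideDisp {n m : ℕ} (C : Code n m) (G : EoLGraph n) (h δ : ℝ)
    (x : Point m) : Point m :=
  if H : ∃ e, G.IsSegment e ∧ C.NearLine h (Real.sqrt h) (1 - Real.sqrt h) e x then
    C.lineDisp h δ H.choose x
  else if H : ∃ p : Segment n × Segment n, C.Consecutive G p.1 p.2 ∧ C.NearCorner h p.1 p.2 x then
    C.cornerDisp h δ H.choose.1 H.choose.2 x
  else if H : ∃ e, C.IsFinal G e ∧ C.NearLine h (1 - Real.sqrt h) 1 e x then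
    let w := (1 - C.tau H.choose x) / Real.sqrt h
    w • C.lineDisp h δ H.choose x + (1 - w) • (δ • up m)
  else if H : ∃ e, C.IsInitial G e ∧ C.NearLine h 0 (Real.sqrt h) e x then
    let w := C.tau H.choose x / Real.sqrt h
    w • C.lineDisp h δ H.choose x + (1 - w) • (δ • up m)
  else δ • up m

/-! ## Displacement outside the picture, and the Brouwer function -/

/-- The average of the fourth block. -/
noncomputable def height {m : ℕ} (x : Point m) : ℝ := (∑ j, x (3, j)) / m

/-- The displacement at the top of the cube belonging to the point `z`: `-δ (0,0,0,1)` at distance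
`0`, `δ (z - x) / h` from distance `h` on, linearly interpolated in between. -/
noncomputable def topDisp {m : ℕ} (h δ : ℝ) (z x : Point m) : Point m :=
  let d := rms (x - z)
  if d ≤ h then (1 - d / h) • (-(δ • up m)) + (d / h) • ((δ / h) • (z - x))
  else (δ / h) • (z - x)

/-- Untruncated displacement outside the picture: with `z = (0,0,0,x₄)`, it interpolates between
the displacement on the boundary of the picture and the one at the top. -/
noncomputable def outsideDisp {m : ℕ} (h δ : ℝ) (x : Point m) : Point m :=
  let z : Point m := blocks 0 0 0 (fun _ => height x)
  let τ := (2 - height x) / (3 / 2)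
  τ • profile h δ (-up m) z x + (1 - τ) • topDisp h δ z x

/-- Untruncated displacement `ĝ`. -/
noncomputable def Code.disp {n m : ℕ} (C : Code n m) (G : EoLGraph n) (h δ : ℝ) (x : Point m) :
    Point m :=
  if height x < 1 / 2 then C.insideDisp G h δ x else outsideDisp h δ x

/-- The hard Brouwer function `f : [-1,2]^{4×m} → [-1,2]^{4×m}`: the displaced point, truncated
coordinatewise. -/
noncomputable def Code.brouwer {n m : ℕ} (C : Code n m) (G : EoLGraph n) (h δ : ℝ) (x : Point m) :
    Point m :=
  fun i => max (-1) (min 2 (x i + C.disp G h δ x i))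

/-! ## Local information -/

/-- What an algorithm is told about one vertex: `⊥`, or `(v, S(v), P(v))`. -/
abbrev VertexInfo (n : ℕ) := Option (Vertex n × Option (Vertex n) × Option (Vertex n))

/-- `info` is admissible vertex information for a block `y` of a point: it is `⊥`, which is allowed
unless `y` is closer than `8√h` to some codeword, or it is the triple of a vertex whose codeword is
nearest to `y`, which is allowed unless `y` is farther than `25√h` from all codewords. -/
def Code.Admissible {n m : ℕ} (C : Code n m) (G : EoLGraph n) (h : ℝ) (y : Fin m → ℝ)
    (info : VertexInfo n) : Prop :=
  (info = none ∧ ∀ v, 8 * Real.sqrt h ≤ rms (y - C.word v)) ∨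
  ∃ v, info = some (v, G.succ v, G.pred v) ∧ rms (y - C.word v) ≤ 25 * Real.sqrt h ∧
    ∀ w, rms (y - C.word v) ≤ rms (y - C.word w)

/-- Programs in real arithmetic with inputs indexed by `ι`: field operations, square roots, and
branching on comparisons. -/
inductive RealProgram (ι : Type) where
  | const (a : ℝ) : RealProgram ι
  | input (i : ι) : RealProgram ι
  | add (p q : RealProgram ι) : RealProgram ι
  | sub (p q : RealProgram ι) : RealProgram ι
  | mul (p q : RealProgram ι) : RealProgram ι
  | div (p q : RealProgram ι) : RealProgram ι
  | sqrt (p : RealProgram ι) : RealProgram ι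
  | ifLE (a b p q : RealProgram ι) : RealProgram ι

open Classical in
/-- The output of a program; `ifLE a b p q` runs `p` if `a ≤ b`, and `q` otherwise. -/
noncomputable def RealProgram.run {ι : Type} (y : ι → ℝ) : RealProgram ι → ℝ
  | .const a => a
  | .input i => y i
  | .add p q => p.run y + q.run y
  | .sub p q => p.run y - q.run y
  | .mul p q => p.run y * q.run y
  | .div p q => p.run y / q.run y
  | .sqrt p => Real.sqrt (p.run y)
  | .ifLE a b p q => if a.run y ≤ b.run y then p.run y else q.run y

/-- A local algorithm. Its discrete inputs are the coordinate `i` to be computed, the set `T`, and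
the information on two vertices; they select a program whose real inputs are (an approximation of)
`x_i` (input `none`) and of `x` restricted to `[4] × T` (inputs `some (r, j)`). -/
abbrev LocalAlgorithm (n m : ℕ) :=
  (i : Fin 4 × Fin m) → (T : Finset (Fin m)) → (Fin 2 → VertexInfo n) →
    RealProgram (Option (Fin 4 × T))

/-- The output of a local algorithm. -/
noncomputable def LocalAlgorithm.out {n m : ℕ} (A : LocalAlgorithm n m) (i : Fin 4 × Fin m)
    (T : Finset (Fin m)) (info : Fin 2 → VertexInfo n) (xi : ℝ) (xT : Fin 4 × T → ℝ) : ℝ :=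
  (A i T info).run (fun o => o.elim xi xT)

/-! ## Random coordinate sets -/

/-- The random subset of `Fin c` with law `μ` has density `1/ℓ` and is `k`-wise independent up to
relative error `θ`: any `K` of size at most `k` is contained in it with probability
`(1 ± θ) ℓ^{-|K|}`. Here `θ = 0` means exact `k`-wise independence. -/
def IsKWiseIndep {c : ℕ} (μ : PMF (Finset (Fin c))) (k ℓ : ℕ) (θ : ℝ) : Prop :=
  ∀ K : Finset (Fin c), K.card ≤ k →
    |(μ.toOuterMeasure {S | K ⊆ S}).toReal - (1 / (ℓ : ℝ)) ^ K.card| ≤ θ * (1 / (ℓ : ℝ)) ^ K.card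

/-- The union of the columns in `S`, when `[m]` is divided into columns by `col`. -/
def columnUnion {c m : ℕ} (col : Fin m → Fin c) (S : Finset (Fin c)) : Finset (Fin m) :=
  Finset.univ.filter (fun j => col j ∈ S)

/-!
Why `f` can be computed locally. Up to truncation, `f` moves the point `x` by `δ` times the upward
vector plus a sum of at most five local terms (`disp_apply`): one for the upper half of the cube
together with the beginning of the first segment, and one for each of the four kinds of Brouwer
vertices `(V, V, 0, 0)`, `(V, W, 0, 0)`, `(U, V, 1, 0)`, `(V, V, 1, 0)`. The term of a Brouwer
vertex `y` covers the end of the segment into `y`, the corner at `y`, and the beginning of the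
segment out of `y`; two terms share a segment through the weight `ramp`, which depends on the
relative position along the segment only and changes from `0` to `1` away from its ends. One of the
first two blocks of a point near which the term of a given kind does not vanish is within `8 √h` of
a codeword, and that codeword, with its successor and predecessor, determines the two segments. So
admissible information on the vertices either identifies the term or shows that it is zero
(`exists_region_of_knownValue_ne_zero`). The regions in which the terms live are disjoint, apart
from shared segments, since two segments that come within `2 √h` of the same point coincide or are
consecutive (`Code.Separated.eq_or_linked_of_closeTo`); this uses the distance of the code.

Each local term at coordinate `i` is a function, given by a `Shape`, of `x i`, of the relative
positions `τ`, `τ'` of `x` along two segments, of the distance `d` of `x` from a point `z` of the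
path that is determined by `τ` and `τ'`, and of coordinates of known points. That function is tame
(`IsTame`): computed by a program and locally Lipschitz, hence Lipschitz on the bounded range of its
arguments with a constant that depends on `h` and `ρ` only. The quantities `τ`, `τ'` and `d ^ 2` are
averages over coordinates of bounded functions, so they can be estimated from the coordinates in
`[4] × T`. Chebyshev's inequality, which needs only pairwise near-independence, shows that with high
probability the averages over `T` of the fifteen functions in question are within `η` of the true
ones (`exists_sample_average_close`). When they are, replacing the true averages by those over a
perturbed sample changes each term by `O(ε + √η)` (`Shape.Tame.exists_estimate`); the square root is
due to `d` being the square root of an average. Hence the output is within `ε + δ Λ (ε + √η)` of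
`f_i(x)`, where `Λ` depends on `h` and `ρ` only (`exists_localOutput_close`). For `δ Λ ≤ 1` and `η ≤
γ ^ 2`, this is at most `2 ε + γ`.
-/

/-! ### Normalised norms -/

section Norms

variable {ι : Type} [Fintype ι]

lemma avgDot_add_left (x y z : ι → ℝ) : avgDot (x + y) z = avgDot x z + avgDot y z := by
  simp only [avgDot, Pi.add_apply, add_mul, Finset.sum_add_distrib, add_div]

lemma avgDot_sub_left (x y z : ι → ℝ) : avgDot (x - y) z = avgDot x z - avgDot y z := by
  simp only [avgDot, Pi.sub_apply, sub_mul, Finset.sum_sub_distrib, sub_div]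

lemma avgDot_comm (x y : ι → ℝ) : avgDot x y = avgDot y x := by
  simp only [avgDot, mul_comm]

lemma avgDot_sub_right (x y z : ι → ℝ) : avgDot z (x - y) = avgDot z x - avgDot z y := by
  rw [avgDot_comm, avgDot_sub_left, avgDot_comm x, avgDot_comm y]

lemma avgDot_add_right (x y z : ι → ℝ) : avgDot z (x + y) = avgDot z x + avgDot z y := by
  rw [avgDot_comm, avgDot_add_left, avgDot_comm x, avgDot_comm y]

lemma avgDot_smul_left (a : ℝ) (x y : ι → ℝ) : avgDot (a • x) y = a * avgDot x y := by
  simp only [avgDot, Pi.smul_apply, smul_eq_mul, mul_assoc, ← Finset.mul_sum, mul_div_assoc]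

lemma avgDot_smul_right (a : ℝ) (x y : ι → ℝ) : avgDot x (a • y) = a * avgDot x y := by
  rw [avgDot_comm, avgDot_smul_left, avgDot_comm]

lemma avgDot_self_nonneg (x : ι → ℝ) : 0 ≤ avgDot x x :=
  div_nonneg (Finset.sum_nonneg fun i _ => mul_self_nonneg (x i)) (Nat.cast_nonneg _)

lemma rms_nonneg (x : ι → ℝ) : 0 ≤ rms x := Real.sqrt_nonneg _

lemma rms_sq (x : ι → ℝ) : rms x ^ 2 = avgDot x x := Real.sq_sqrt (avgDot_self_nonneg x)

lemma abs_avgDot_le (x y : ι → ℝ) : |avgDot x y| ≤ rms x * rms y := by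
  apply abs_le_of_sq_le_sq _ (mul_nonneg (rms_nonneg x) (rms_nonneg y))
  rw [mul_pow, rms_sq, rms_sq]
  simp only [avgDot]
  rw [div_pow, div_mul_div_comm, ← pow_two]
  gcongr
  simpa only [pow_two] using Finset.sum_mul_sq_le_sq_mul_sq Finset.univ x y

lemma rms_add_le (x y : ι → ℝ) : rms (x + y) ≤ rms x + rms y := by
  apply le_of_sq_le_sq _ (add_nonneg (rms_nonneg x) (rms_nonneg y))
  have h := (le_abs_self _).trans (abs_avgDot_le x y)
  rw [rms_sq, avgDot_add_left, avgDot_add_right, avgDot_add_right, add_sq, rms_sq, rms_sq,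
    avgDot_comm y x]
  linarith

lemma rms_neg (x : ι → ℝ) : rms (-x) = rms x := by
  simp [rms, avgDot]

lemma rms_sub_comm (x y : ι → ℝ) : rms (x - y) = rms (y - x) := by
  rw [← rms_neg, neg_sub]

lemma rms_sub_le (x y z : ι → ℝ) : rms (x - z) ≤ rms (x - y) + rms (y - z) := by
  simpa using rms_add_le (x - y) (y - z)

lemma abs_rms_sub_rms_le (x y : ι → ℝ) : |rms x - rms y| ≤ rms (x - y) := by
  rw [abs_le]
  have h₁ := rms_add_le (x - y) y
  have h₂ := rms_add_le (y - x) x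
  rw [sub_add_cancel] at h₁ h₂
  rw [rms_sub_comm] at h₂
  constructor <;> linarith

lemma rms_smul (a : ℝ) (x : ι → ℝ) : rms (a • x) = |a| * rms x := by
  rw [← abs_of_nonneg (rms_nonneg x), ← abs_mul, ← sq_eq_sq₀ (rms_nonneg _) (abs_nonneg _),
    sq_abs, mul_pow, rms_sq, rms_sq, avgDot_smul_left, avgDot_smul_right]
  ring

lemma abs_avgDot_le_of_abs_le {B : ℝ} (hB : 0 ≤ B) {x y : ι → ℝ} (h : ∀ i, |x i * y i| ≤ B) :
    |avgDot x y| ≤ B := by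
  rw [avgDot, abs_div, Nat.abs_cast]
  apply div_le_of_le_mul₀ (Nat.cast_nonneg _) hB
  calc |∑ i, x i * y i| ≤ ∑ i, |x i * y i| := Finset.abs_sum_le_sum_abs _ _
    _ ≤ ∑ _i : ι, B := Finset.sum_le_sum fun i _ => h i
    _ = B * Fintype.card ι := by simp [mul_comm]

lemma rms_le_of_abs_le {B : ℝ} (hB : 0 ≤ B) {x : ι → ℝ} (h : ∀ i, |x i| ≤ B) : rms x ≤ B := by
  apply Real.sqrt_le_iff.2 ⟨hB, (le_abs_self _).trans (abs_avgDot_le_of_abs_le (by positivity) _)⟩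
  intro i
  rw [abs_mul, pow_two]
  exact mul_le_mul (h i) (h i) (abs_nonneg _) hB

lemma rms_const [Nonempty ι] (a : ℝ) : rms (fun _ : ι => a) = |a| := by
  have : (Fintype.card ι : ℝ) ≠ 0 := by simp
  rw [rms, avgDot]
  simp only [Finset.sum_const, Finset.card_univ, nsmul_eq_mul]
  rw [mul_div_cancel_left₀ _ this, ← pow_two, Real.sqrt_sq_eq_abs]

lemma rms_zero : rms (0 : ι → ℝ) = 0 := by simp [rms, avgDot]

lemma avgDot_fin_four (x y : Fin 4 × ι → ℝ) :
    avgDot x y = (∑ r, avgDot (fun j => x (r, j)) (fun j => y (r, j))) / 4 := by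
  simp only [avgDot, Fintype.sum_prod_type, Fintype.card_prod, Fintype.card_fin, ← Finset.sum_div]
  push_cast
  rw [div_div, mul_comm (4 : ℝ)]

lemma rms_fin_four_le {x : Fin 4 × ι → ℝ} {ε : ℝ} (hε : 0 ≤ ε)
    (h : ∀ r, rms (fun j => x (r, j)) ≤ ε) : rms x ≤ ε := by
  apply Real.sqrt_le_iff.2 ⟨hε, _⟩
  rw [avgDot_fin_four, Fin.sum_univ_four]
  have h' : ∀ r, avgDot (fun j => x (r, j)) (fun j => x (r, j)) ≤ ε ^ 2 := fun r => by
    rw [← rms_sq]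
    exact pow_le_pow_left₀ (rms_nonneg _) (h r) 2
  linarith [h' 0, h' 1, h' 2, h' 3]

/-- One block carries a quarter of the weight, whence the factor `2 = √4`. -/
lemma rms_fiber_le (x : Fin 4 × ι → ℝ) (r : Fin 4) : rms (fun j => x (r, j)) ≤ 2 * rms x := by
  apply le_of_sq_le_sq _ (mul_nonneg zero_le_two (rms_nonneg x))
  rw [mul_pow, rms_sq, rms_sq, avgDot_fin_four]
  have := Finset.single_le_sum (f := fun r => avgDot (fun j => x (r, j)) (fun j => x (r, j)))
    (fun r _ => avgDot_self_nonneg _) (Finset.mem_univ r)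
  linarith

end Norms

/-! ### Sampling with limited independence -/

section Sampling

variable {c : ℕ}

lemma PMF.sum_toReal {α : Type} [Fintype α] (μ : PMF α) : ∑ a, (μ a).toReal = 1 := by
  rw [← ENNReal.toReal_sum fun a _ => μ.apply_ne_top a]
  have := μ.tsum_coe
  rw [tsum_fintype] at this
  simp [this]

open Classical in
lemma PMF.toReal_toOuterMeasure {α : Type} [Fintype α] (μ : PMF α) (s : Set α) :
    (μ.toOuterMeasure s).toReal = ∑ a, if a ∈ s then (μ a).toReal else 0 := by
  rw [μ.toOuterMeasure_apply_fintype, ENNReal.toReal_sum]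
  · refine Finset.sum_congr rfl fun a _ => ?_
    by_cases h : a ∈ s <;> simp [h]
  · intro a _
    by_cases h : a ∈ s <;> simp [h, μ.apply_ne_top]

/-- The covariance of the indicators of two columns, scaled to mean `1`: of size `O(θ)` for two
different columns, and `O(ℓ)` for a single one. -/
lemma IsKWiseIndep.abs_covariance_le {μ : PMF (Finset (Fin c))} {k ℓ : ℕ} {θ : ℝ}
    (hμ : IsKWiseIndep μ k ℓ θ) (hk : 2 ≤ k) (hℓ : 1 ≤ ℓ) (hθ : θ ≤ 1) (a b : Fin c) :
    |∑ S, (μ S).toReal * ((ℓ * (if a ∈ S then 1 else 0) - 1) * (ℓ * (if b ∈ S then 1 else 0) - 1))|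
      ≤ if a = b then 7 * (ℓ : ℝ) else 3 * θ := by
  have hℓ' : (1 : ℝ) ≤ ℓ := by exact_mod_cast hℓ
  have hℓ0 : (ℓ : ℝ) ≠ 0 := by positivity
  set q : Finset (Fin c) → ℝ := fun K => ∑ S, if K ⊆ S then (μ S).toReal else 0 with hq
  have hqK : ∀ K : Finset (Fin c), K.card ≤ 2 → |ℓ ^ K.card * q K - 1| ≤ θ := by
    intro K hK
    have h := hμ K (hK.trans hk)
    rw [PMF.toReal_toOuterMeasure] at h
    have h' : |q K - (1 / (ℓ : ℝ)) ^ K.card| ≤ θ * (1 / (ℓ : ℝ)) ^ K.card := by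
      convert h using 6
      exact Iff.rfl
    have hp : (0 : ℝ) < ℓ ^ K.card := by positivity
    calc |(ℓ : ℝ) ^ K.card * q K - 1| = ℓ ^ K.card * |q K - (1 / (ℓ : ℝ)) ^ K.card| := by
          rw [← abs_of_pos hp, ← abs_mul, abs_of_pos hp, mul_sub, ← mul_pow, mul_one_div_cancel hℓ0,
            one_pow]
      _ ≤ ℓ ^ K.card * (θ * (1 / (ℓ : ℝ)) ^ K.card) := by gcongr
      _ = θ := by
          rw [mul_left_comm, ← mul_pow, mul_one_div_cancel hℓ0, one_pow, mul_one]
  have hexp : ∑ S, (μ S).toReal *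
      ((ℓ * (if a ∈ S then 1 else 0) - 1) * (ℓ * (if b ∈ S then 1 else 0) - 1))
      = ℓ ^ 2 * q {a, b} - ℓ * q {a} - ℓ * q {b} + ∑ S, (μ S).toReal := by
    rw [hq]
    simp only [Finset.mul_sum, ← Finset.sum_sub_distrib, ← Finset.sum_add_distrib]
    refine Finset.sum_congr rfl fun S _ => ?_
    by_cases ha : a ∈ S <;> by_cases hb : b ∈ S <;>
      simp [ha, hb, Finset.insert_subset_iff] <;> ring
  rw [hexp, μ.sum_toReal]
  have h₁ := hqK {a} (by simp)
  have h₂ := hqK {b} (by simp)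
  rw [Finset.card_singleton, pow_one, abs_le] at h₁ h₂
  split_ifs with hab
  · subst hab
    have hs : ({a, a} : Finset (Fin c)) = {a} := by simp
    rw [hs, abs_le]
    have : 0 ≤ ℓ * ((ℓ : ℝ) * q {a} - (1 - θ)) := by
      apply mul_nonneg <;> linarith
    have : 0 ≤ ℓ * (1 + θ - (ℓ : ℝ) * q {a}) := by
      apply mul_nonneg <;> linarith
    have : (ℓ : ℝ) * θ ≤ ℓ := by nlinarith
    constructor <;> nlinarith
  · have h₃ := hqK {a, b} (by rw [Finset.card_pair hab])
    rw [Finset.card_pair hab, abs_le] at h₃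
    rw [abs_le]
    constructor <;> linarith

lemma IsKWiseIndep.second_moment_le {μ : PMF (Finset (Fin c))} {k ℓ : ℕ} {θ B : ℝ}
    (hμ : IsKWiseIndep μ k ℓ θ) (hk : 2 ≤ k) (hℓ : 1 ≤ ℓ) (hθ₀ : 0 ≤ θ) (hθ : θ ≤ 1)
    (y : Fin c → ℝ) (hy : ∀ a, |y a| ≤ B) :
    ∑ S, (μ S).toReal * (∑ a, y a * (ℓ * (if a ∈ S then 1 else 0) - 1)) ^ 2
      ≤ B ^ 2 * (7 * ℓ * c + 3 * θ * c ^ 2) := by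
  have hexp : ∑ S, (μ S).toReal * (∑ a, y a * (ℓ * (if a ∈ S then 1 else 0) - 1)) ^ 2
      = ∑ a, ∑ b, y a * y b * ∑ S, (μ S).toReal *
        ((ℓ * (if a ∈ S then 1 else 0) - 1) * (ℓ * (if b ∈ S then 1 else 0) - 1)) := by
    simp only [pow_two, Finset.sum_mul_sum]
    simp only [Finset.mul_sum]
    rw [Finset.sum_comm]
    refine Finset.sum_congr rfl fun a _ => ?_
    rw [Finset.sum_comm]
    refine Finset.sum_congr rfl fun b _ => Finset.sum_congr rfl fun S _ => ?_
    ring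
  rw [hexp]
  have hB : 0 ≤ B ^ 2 := sq_nonneg B
  calc _ ≤ ∑ a : Fin c, ∑ b : Fin c, B ^ 2 * (if a = b then 7 * (ℓ : ℝ) else 3 * θ) := by
        refine Finset.sum_le_sum fun a _ => Finset.sum_le_sum fun b _ => ?_
        refine (le_abs_self _).trans ?_
        rw [abs_mul, abs_mul, pow_two]
        exact mul_le_mul (mul_le_mul (hy a) (hy b) (abs_nonneg _) ((abs_nonneg _).trans (hy a)))
          (hμ.abs_covariance_le hk hℓ hθ a b) (abs_nonneg _) (by nlinarith)
    _ ≤ ∑ a : Fin c, ∑ b : Fin c, B ^ 2 * ((if a = b then 7 * (ℓ : ℝ) else 0) + 3 * θ) := by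
        refine Finset.sum_le_sum fun a _ => Finset.sum_le_sum fun b _ => ?_
        gcongr
        split_ifs <;> linarith
    _ = _ := by
        simp only [← Finset.mul_sum, Finset.sum_add_distrib, Finset.sum_ite_eq, Finset.mem_univ,
          if_true, Finset.sum_const, Finset.card_univ, Fintype.card_fin, nsmul_eq_mul]
        ring

/-- Chebyshev's inequality for a random set of columns, simultaneously for several bounded
functions on the columns. -/
lemma IsKWiseIndep.chebyshev {μ : PMF (Finset (Fin c))} {k ℓ M : ℕ} {θ B η : ℝ}
    (hμ : IsKWiseIndep μ k ℓ θ) (hk : 2 ≤ k) (hℓ : 1 ≤ ℓ) (hM : 0 < M) (hMc : M * ℓ ≤ c)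
    (hθ : θ ≤ 1 / M) (hη : 0 < η) {J : Type} [Fintype J]
    (y : J → Fin c → ℝ) (hy : ∀ j a, |y j a| ≤ B) :
    ENNReal.ofReal (1 - Fintype.card J * (10 * B ^ 2 / (M * η ^ 2))) ≤
      μ.toOuterMeasure {S | ∀ j, |ℓ / c * ∑ a ∈ S, y j a - (∑ a, y j a) / c| ≤ η} := by
  classical
  have hM' : (0 : ℝ) < M := by exact_mod_cast hM
  have hM1 : (1 : ℝ) ≤ M := by exact_mod_cast hM
  have hc : (0 : ℝ) < c := by
    have : 0 < c := lt_of_lt_of_le (by positivity) hMc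
    exact_mod_cast this
  have hθ1 : θ ≤ 1 := hθ.trans ((div_le_one hM').2 hM1)
  have hθ₀ : 0 ≤ θ := by
    have := hμ ∅ (by simp)
    simp only [Finset.card_empty, pow_zero, mul_one] at this
    exact (abs_nonneg _).trans this
  set bad : J → Finset (Fin c) → Prop :=
    fun j S => η < |ℓ / c * ∑ a ∈ S, y j a - (∑ a, y j a) / c| with hbad
  have hone : ∀ j, ∑ S, (if bad j S then (μ S).toReal else 0) ≤ 10 * B ^ 2 / (M * η ^ 2) := by
    intro j
    have h := hμ.second_moment_le hk hℓ hθ₀ hθ1 (y j) (hy j)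
    have hX : ∀ S : Finset (Fin c), ∑ a, y j a * (ℓ * (if a ∈ S then 1 else 0) - 1)
        = c * (ℓ / c * ∑ a ∈ S, y j a - (∑ a, y j a) / c) := by
      intro S
      rw [mul_sub, ← mul_assoc, mul_div_cancel₀ _ hc.ne', mul_div_cancel₀ _ hc.ne',
        Finset.mul_sum]
      simp only [mul_sub, mul_one, Finset.sum_sub_distrib, mul_ite, mul_zero, Finset.sum_ite_mem,
        Finset.univ_inter]
      simp only [mul_comm (ℓ : ℝ)]
    calc ∑ S, (if bad j S then (μ S).toReal else 0)
        ≤ ∑ S, (μ S).toReal * (∑ a, y j a * (ℓ * (if a ∈ S then 1 else 0) - 1)) ^ 2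
            / (c * η) ^ 2 := by
          refine Finset.sum_le_sum fun S _ => ?_
          split_ifs with hS
          · rw [hX, mul_pow, ← sq_abs ((ℓ : ℝ) / c * _ - _), mul_pow, le_div_iff₀ (by positivity)]
            gcongr
          · positivity
      _ ≤ B ^ 2 * (7 * ℓ * c + 3 * θ * c ^ 2) / (c * η) ^ 2 := by
          rw [← Finset.sum_div]
          gcongr
      _ ≤ B ^ 2 * (10 * c ^ 2 / M) / (c * η) ^ 2 := by
          have hMc' : (M : ℝ) * ℓ ≤ c := by exact_mod_cast hMc
          rw [le_div_iff₀ hM'] at hθ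
          gcongr
          rw [le_div_iff₀ hM']
          nlinarith [mul_le_mul_of_nonneg_right hMc' hc.le,
            mul_le_mul_of_nonneg_right hθ (sq_nonneg (c : ℝ))]
      _ = 10 * B ^ 2 / (M * η ^ 2) := by
          field_simp
  rw [ENNReal.ofReal_le_iff_le_toReal, PMF.toReal_toOuterMeasure]
  · have hsum : ∑ j, ∑ S, (if bad j S then (μ S).toReal else 0)
        ≤ Fintype.card J * (10 * B ^ 2 / (M * η ^ 2)) := by
      calc _ ≤ ∑ _j : J, 10 * B ^ 2 / (M * η ^ 2) := Finset.sum_le_sum fun j _ => hone j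
        _ = _ := by simp
    rw [Finset.sum_comm] at hsum
    have : 1 ≤ ∑ S, ((if ∀ j, ¬ bad j S then (μ S).toReal else 0) +
        ∑ j, if bad j S then (μ S).toReal else 0) := by
      rw [← μ.sum_toReal]
      refine Finset.sum_le_sum fun S _ => ?_
      have hnn : ∀ j ∈ Finset.univ, 0 ≤ if bad j S then (μ S).toReal else 0 := fun j _ => by
        split_ifs <;> simp
      by_cases hS : ∀ j, ¬ bad j S
      · rw [if_pos hS]
        exact le_add_of_nonneg_right (Finset.sum_nonneg hnn)
      · push Not at hS
        obtain ⟨j, hj⟩ := hS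
        have := Finset.single_le_sum hnn (Finset.mem_univ j)
        rw [if_pos hj] at this
        refine this.trans (le_add_of_nonneg_left ?_)
        split_ifs <;> simp
    rw [Finset.sum_add_distrib] at this
    refine le_trans (b := ∑ S, if ∀ j, ¬ bad j S then (μ S).toReal else 0) (by linarith)
      (Finset.sum_le_sum fun S _ => ?_)
    by_cases hS : ∀ j, ¬ bad j S
    · rw [if_pos hS, if_pos]
      exact fun j => not_lt.1 (hS j)
    · rw [if_neg hS]
      split_ifs <;> simp
  · refine ne_top_of_le_ne_top ENNReal.one_ne_top ?_
    rw [← μ.tsum_coe, μ.toOuterMeasure_apply]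
    exact ENNReal.tsum_le_tsum fun S => Set.indicator_le_self _ _ S

/-- With high probability the averages over the sampled coordinates of boundedly many functions,
all bounded by `B`, are close to the averages over all coordinates. The number of sampled columns
is itself controlled by applying Chebyshev's inequality to the constant function `1`. -/
lemma exists_sample_average_close (N : ℕ) {B γ η : ℝ} (hB : 1 ≤ B) (hγ : 0 < γ) (hη : 0 < η) :
    ∃ M : ℕ, 0 < M ∧ ∀ (m c k ℓ : ℕ) (θ : ℝ) (col : Fin m → Fin c) (μ : PMF (Finset (Fin c))),
      0 < m → 1 ≤ ℓ → M ≤ k → M * ℓ ≤ c → θ ≤ 1 / M →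
      (∀ a a' : Fin c, (Finset.univ.filter (fun j => col j = a)).card =
        (Finset.univ.filter (fun j => col j = a')).card) →
      IsKWiseIndep μ k ℓ θ →
      ∀ (J : Type) [Fintype J], Fintype.card J ≤ N →
      ∀ y : J → Fin m → ℝ, (∀ j i, |y j i| ≤ B) →
      ENNReal.ofReal (1 - γ) ≤ μ.toOuterMeasure {S | ∀ j,
        |(∑ i ∈ columnUnion col S, y j i) / (columnUnion col S).card - (∑ i, y j i) / m| ≤ η} := by
  set ξ : ℝ := min (1 / 2) (η / (2 * (1 + B))) with hξ
  have hξ0 : 0 < ξ := by positivity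
  obtain ⟨M, hM⟩ := exists_nat_ge (max 2 ((N + 1) * (10 * B ^ 2 / (γ * ξ ^ 2))))
  have hM2 : (2 : ℝ) ≤ M := (le_max_left _ _).trans hM
  have hM0 : 0 < M := by
    have : (0 : ℝ) < M := by linarith
    exact_mod_cast this
  refine ⟨M, hM0, fun m c k ℓ θ col μ hm hℓ hk hMc hθ hcol hμ J _ hJ y hy => ?_⟩
  have hk2 : 2 ≤ k := le_trans (by exact_mod_cast hM2) hk
  have hc : 0 < c := lt_of_lt_of_le (by positivity) hMc
  set w : ℕ := (Finset.univ.filter (fun j => col j = ⟨0, hc⟩)).card with hw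
  have hcw : ∀ a, (Finset.univ.filter (fun j => col j = a)).card = w := fun a => hcol _ _
  have hm_eq : m = c * w := by
    have h := Finset.card_eq_sum_card_fiberwise (f := col) (s := Finset.univ) (t := Finset.univ)
      (by simp [Set.MapsTo])
    simpa [hcw] using h
  have hw0 : 0 < w := by
    rcases Nat.eq_zero_or_pos w with h | h
    · simp [h] at hm_eq; omega
    · exact h
  have hw' : (0 : ℝ) < w := by exact_mod_cast hw0
  have hc' : (0 : ℝ) < c := by exact_mod_cast hc
  have hmem : ∀ (S : Finset (Fin c)) (g : Fin m → ℝ), ∑ i ∈ columnUnion col S, g i =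
      ∑ a ∈ S, ∑ i with col i = a, g i := by
    intro S g
    rw [← Finset.sum_fiberwise_of_maps_to (s := columnUnion col S) (t := S) (g := col)
      (fun i hi => by simpa [columnUnion] using hi)]
    refine Finset.sum_congr rfl fun a ha => Finset.sum_congr ?_ fun _ _ => rfl
    ext i
    simp only [columnUnion, Finset.mem_filter, Finset.mem_univ, true_and, and_iff_right_iff_imp]
    rintro rfl
    exact ha
  set Y : Option J → Fin c → ℝ := fun o a => o.elim 1 fun j => (∑ i with col i = a, y j i) / w
    with hY
  have hYB : ∀ o a, |Y o a| ≤ B := by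
    intro o a
    cases o with
    | none => simpa [hY] using hB
    | some j =>
      simp only [hY, Option.elim_some]
      rw [abs_div, Nat.abs_cast, div_le_iff₀ hw']
      calc |∑ i with col i = a, y j i| ≤ ∑ i with col i = a, |y j i| :=
            Finset.abs_sum_le_sum_abs _ _
        _ ≤ ∑ i with col i = a, B := Finset.sum_le_sum fun i _ => hy j i
        _ = B * w := by rw [Finset.sum_const, hcw, nsmul_eq_mul, mul_comm]
  have hmain := hμ.chebyshev hk2 hℓ hM0 hMc hθ hξ0 Y hYB
  refine (ENNReal.ofReal_le_ofReal ?_).trans (hmain.trans (μ.toOuterMeasure.mono ?_))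
  · have hM' : (N + 1) * (10 * B ^ 2 / (γ * ξ ^ 2)) ≤ M := (le_max_right _ _).trans hM
    have hJ' : ((Fintype.card (Option J) : ℕ) : ℝ) ≤ N + 1 := by
      rw [Fintype.card_option]
      exact_mod_cast Nat.succ_le_succ hJ
    have : (Fintype.card (Option J) : ℝ) * (10 * B ^ 2 / (M * ξ ^ 2)) ≤ γ := by
      calc (Fintype.card (Option J) : ℝ) * (10 * B ^ 2 / (M * ξ ^ 2))
          ≤ (N + 1) * (10 * B ^ 2 / (M * ξ ^ 2)) := by gcongr
        _ = (N + 1) * (10 * B ^ 2 / (γ * ξ ^ 2)) * (γ / M) := by field_simp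
        _ ≤ M * (γ / M) := by gcongr
        _ = γ := by field_simp
    linarith
  · intro S hS
    have h1 := hS none
    simp only [hY, Option.elim_none, Finset.sum_const, Finset.card_univ, Fintype.card_fin,
      nsmul_eq_mul, mul_one, div_self hc'.ne'] at h1
    have hSpos : (0 : ℝ) < S.card := by
      rcases Nat.eq_zero_or_pos S.card with h | h
      · rw [h] at h1
        have := h1.trans (min_le_left _ _)
        norm_num at this
      · exact_mod_cast h
    have hcard : ((columnUnion col S).card : ℝ) = S.card * w := by
      have := hmem S fun _ => 1
      simp only [Finset.sum_const, nsmul_eq_mul, mul_one, hcw] at this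
      exact this
    intro j
    have hj := hS (some j)
    simp only [hY, Option.elim_some, ← Finset.sum_div] at hj
    rw [← hmem] at hj
    have hall : ∑ a, ∑ i with col i = a, y j i = ∑ i, y j i :=
      Finset.sum_fiberwise Finset.univ col (y j)
    rw [hall, div_div, mul_comm (w : ℝ)] at hj
    have hmcw : (m : ℝ) = c * w := by exact_mod_cast hm_eq
    rw [← hmcw] at hj
    rw [hcard]
    set A := (∑ i, y j i) / (m : ℝ) with hA
    set q : ℝ := ℓ / c * S.card with hq
    set p : ℝ := ℓ / c * ((∑ i ∈ columnUnion col S, y j i) / w) with hp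
    have hq0 : 0 < q := by
      have : (0 : ℝ) < ℓ := by exact_mod_cast hℓ
      positivity
    have hℓ' : (0 : ℝ) < ℓ := by exact_mod_cast hℓ
    have hratio : (∑ i ∈ columnUnion col S, y j i) / (S.card * w) = p / q := by
      rw [hp, hq]
      field_simp
    have hAB : |A| ≤ B := by
      rw [hA, abs_div, Nat.abs_cast, div_le_iff₀ (by exact_mod_cast hm)]
      calc |∑ i, y j i| ≤ ∑ i, |y j i| := Finset.abs_sum_le_sum_abs _ _
        _ ≤ ∑ _i : Fin m, B := Finset.sum_le_sum fun i _ => hy j i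
        _ = B * m := by simp [mul_comm]
    have hq2 : 1 / 2 ≤ q := by
      have := (abs_le.1 (h1.trans (min_le_left _ _))).1
      linarith
    rw [hratio, div_sub' hq0.ne', abs_div, abs_of_pos hq0, div_le_iff₀ hq0]
    have hsplit : p - q * A = (p - A) - (q - 1) * A := by ring
    rw [hsplit]
    calc |(p - A) - (q - 1) * A| ≤ |p - A| + |(q - 1) * A| := abs_sub _ _
      _ ≤ ξ + ξ * B := by
          rw [abs_mul]
          gcongr
      _ = ξ * (1 + B) := by ring
      _ ≤ η / (2 * (1 + B)) * (1 + B) := by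
          gcongr
          exact min_le_right _ _
      _ = η * (1 / 2) := by field_simp
      _ ≤ η * q := by gcongr

end Sampling

/-! ### Functions computed by programs -/

section Programs

variable {ι κ : Type}

/-- `f` is computed by some program. -/
def IsProgrammable (f : (ι → ℝ) → ℝ) : Prop :=
  ∃ p : RealProgram ι, ∀ y, p.run y = f y

namespace IsProgrammable

variable {f g : (ι → ℝ) → ℝ}

lemma const (a : ℝ) : IsProgrammable fun _ : ι → ℝ => a := ⟨.const a, fun _ => rfl⟩

lemma input (i : ι) : IsProgrammable fun y : ι → ℝ => y i := ⟨.input i, fun _ => rfl⟩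

lemma add (hf : IsProgrammable f) (hg : IsProgrammable g) : IsProgrammable fun y => f y + g y :=
  let ⟨p, hp⟩ := hf
  let ⟨q, hq⟩ := hg
  ⟨.add p q, fun y => by rw [RealProgram.run, hp, hq]⟩

lemma sub (hf : IsProgrammable f) (hg : IsProgrammable g) : IsProgrammable fun y => f y - g y :=
  let ⟨p, hp⟩ := hf
  let ⟨q, hq⟩ := hg
  ⟨.sub p q, fun y => by rw [RealProgram.run, hp, hq]⟩

lemma mul (hf : IsProgrammable f) (hg : IsProgrammable g) : IsProgrammable fun y => f y * g y :=
  let ⟨p, hp⟩ := hf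
  let ⟨q, hq⟩ := hg
  ⟨.mul p q, fun y => by rw [RealProgram.run, hp, hq]⟩

lemma div (hf : IsProgrammable f) (hg : IsProgrammable g) : IsProgrammable fun y => f y / g y :=
  let ⟨p, hp⟩ := hf
  let ⟨q, hq⟩ := hg
  ⟨.div p q, fun y => by rw [RealProgram.run, hp, hq]⟩

lemma sqrt (hf : IsProgrammable f) : IsProgrammable fun y => Real.sqrt (f y) :=
  let ⟨p, hp⟩ := hf
  ⟨.sqrt p, fun y => by rw [RealProgram.run, hp]⟩

lemma max (hf : IsProgrammable f) (hg : IsProgrammable g) :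
    IsProgrammable fun y => max (f y) (g y) :=
  let ⟨p, hp⟩ := hf
  let ⟨q, hq⟩ := hg
  ⟨.ifLE p q q p, fun y => by rw [RealProgram.run, hp, hq]; exact (max_def _ _).symm⟩

lemma min (hf : IsProgrammable f) (hg : IsProgrammable g) :
    IsProgrammable fun y => min (f y) (g y) :=
  let ⟨p, hp⟩ := hf
  let ⟨q, hq⟩ := hg
  ⟨.ifLE p q p q, fun y => by rw [RealProgram.run, hp, hq]; exact (min_def _ _).symm⟩

lemma sum {α : Type} (s : Finset α) {f : α → (ι → ℝ) → ℝ} (hf : ∀ a, IsProgrammable (f a)) :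
    IsProgrammable fun y => ∑ a ∈ s, f a y := by
  classical
  induction s using Finset.induction_on with
  | empty => simpa using const 0
  | insert a s ha ih =>
    simp only [Finset.sum_insert ha]
    exact (hf a).add ih

lemma avgDot {α : Type} [Fintype α] {f g : α → (ι → ℝ) → ℝ} (hf : ∀ a, IsProgrammable (f a))
    (hg : ∀ a, IsProgrammable (g a)) :
    IsProgrammable fun y => avgDot (fun a => f a y) (fun a => g a y) :=
  (sum _ fun a => (hf a).mul (hg a)).div (const _)

/-- Programs can be composed. -/
lemma comp {F : (κ → ℝ) → ℝ} (hF : IsProgrammable F) {g : κ → (ι → ℝ) → ℝ}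
    (hg : ∀ k, IsProgrammable (g k)) : IsProgrammable fun y => F fun k => g k y := by
  obtain ⟨p, hp⟩ := hF
  simp only [← hp]
  clear hp
  induction p with
  | const a => exact const a
  | input k => exact hg k
  | add p q hp hq => exact hp.add hq
  | sub p q hp hq => exact hp.sub hq
  | mul p q hp hq => exact hp.mul hq
  | div p q hp hq => exact hp.div hq
  | sqrt p hp => exact hp.sqrt
  | ifLE a b p q ha hb hp hq =>
    obtain ⟨a', ha⟩ := ha
    obtain ⟨b', hb⟩ := hb
    obtain ⟨p', hp⟩ := hp
    obtain ⟨q', hq⟩ := hq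
    exact ⟨.ifLE a' b' p' q', fun y => by simp only [RealProgram.run, ha, hb, hp, hq]⟩

end IsProgrammable

/-! ### Locally Lipschitz functions computed by programs -/

/-- A function of finitely many real variables that is locally Lipschitz and computed by a
program. -/
structure IsTame [Fintype κ] (F : (κ → ℝ) → ℝ) : Prop where
  locallyLipschitz : LocallyLipschitz F
  isProgrammable : IsProgrammable F

namespace IsTame

variable [Fintype κ] {f g : (κ → ℝ) → ℝ}

lemma const (a : ℝ) : IsTame fun _ : κ → ℝ => a := ⟨.const a, .const a⟩

lemma coord (k : κ) : IsTame fun v : κ → ℝ => v k :=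
  ⟨(LipschitzWith.eval k).locallyLipschitz, .input k⟩

lemma comp_contDiff {G : ℝ × ℝ → ℝ} (hG : ContDiff ℝ 1 G) (hf : LocallyLipschitz f)
    (hg : LocallyLipschitz g) : LocallyLipschitz fun v => G (f v, g v) :=
  hG.locallyLipschitz.comp (hf.prodMk hg)

lemma add (hf : IsTame f) (hg : IsTame g) : IsTame fun v => f v + g v :=
  ⟨comp_contDiff (contDiff_fst.add contDiff_snd) hf.1 hg.1, hf.2.add hg.2⟩

lemma sub (hf : IsTame f) (hg : IsTame g) : IsTame fun v => f v - g v :=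
  ⟨comp_contDiff (contDiff_fst.sub contDiff_snd) hf.1 hg.1, hf.2.sub hg.2⟩

lemma mul (hf : IsTame f) (hg : IsTame g) : IsTame fun v => f v * g v :=
  ⟨comp_contDiff (contDiff_fst.mul contDiff_snd) hf.1 hg.1, hf.2.mul hg.2⟩

lemma max (hf : IsTame f) (hg : IsTame g) : IsTame fun v => max (f v) (g v) :=
  ⟨hf.1.max hg.1, hf.2.max hg.2⟩

lemma min (hf : IsTame f) (hg : IsTame g) : IsTame fun v => min (f v) (g v) :=
  ⟨hf.1.min hg.1, hf.2.min hg.2⟩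

lemma div_const (hf : IsTame f) (a : ℝ) : IsTame fun v => f v / a := by
  simpa only [div_eq_mul_inv] using hf.mul (const a⁻¹)

lemma inv (hf : IsTame f) (h : ∀ v, 0 < f v) : IsTame fun v => (f v)⁻¹ := by
  refine ⟨fun v => ?_, by simpa only [one_div] using (IsProgrammable.const 1).div hf.2⟩
  obtain ⟨K, t, ht, hK⟩ := hf.1 v
  have hc : ∀ᶠ w in nhds v, f v / 2 < f w :=
    hf.1.continuous.continuousAt.eventually_const_lt (half_lt_self (h v))
  refine ⟨Real.toNNReal (1 / ((f v / 2) * (f v / 2)) * K),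
    t ∩ {w | f v / 2 < f w}, Filter.inter_mem ht hc,
    LipschitzOnWith.of_dist_le_mul fun w₁ h₁ w₂ h₂ => ?_⟩
  have hv := h v
  have h₁' : f v / 2 < f w₁ := h₁.2
  have h₂' : f v / 2 < f w₂ := h₂.2
  have hw₁ := h w₁
  have hd := hK.dist_le_mul w₁ h₁.1 w₂ h₂.1
  rw [Real.dist_eq] at hd ⊢
  rw [inv_sub_inv (h w₁).ne' (h w₂).ne', abs_div, abs_mul, abs_of_pos (h w₁), abs_of_pos (h w₂),
    abs_sub_comm]
  rw [Real.coe_toNNReal _ (by positivity)]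
  calc |f w₁ - f w₂| / (f w₁ * f w₂)
      ≤ K * dist w₁ w₂ / ((f v / 2) * (f v / 2)) := by gcongr
    _ = _ := by ring

lemma div (hf : IsTame f) (hg : IsTame g) (h : ∀ v, 0 < g v) : IsTame fun v => f v / g v := by
  simpa only [div_eq_mul_inv] using hf.mul (hg.inv h)

/-- On a box a tame function is Lipschitz, by compactness. -/
lemma exists_lipschitz (hf : IsTame f) (R : ℝ) : ∃ Λ : ℝ, 0 ≤ Λ ∧ ∀ v w : κ → ℝ,
    (∀ k, |v k| ≤ R) → (∀ k, |w k| ≤ R) → ∀ β : ℝ, (∀ k, |v k - w k| ≤ β) → 0 ≤ β →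
      |f v - f w| ≤ Λ * β := by
  obtain ⟨K, hK⟩ := LocallyLipschitzOn.exists_lipschitzOnWith_of_compact
    (isCompact_univ_pi fun _ : κ => isCompact_Icc (a := -R) (b := R)) hf.1.locallyLipschitzOn
  refine ⟨K, K.2, fun v w hv hw β hβ hβ0 => ?_⟩
  have h := hK.dist_le_mul v (fun k _ => abs_le.1 (hv k)) w (fun k _ => abs_le.1 (hw k))
  rw [Real.dist_eq] at h
  refine h.trans (mul_le_mul_of_nonneg_left ?_ K.2)
  exact (dist_pi_le_iff hβ0).2 fun k => by rw [Real.dist_eq]; exact hβ k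

end IsTame

end Programs

/-! ### The displacement as a sum of tame local terms -/

/-- The coordinate of `profile h 1 u z x` as a function of `d = rms (x - z)` and the respective
coordinates of `u`, `z`, `x` and `up`, with the interpolation written through hat functions. -/
noncomputable def profileCoord (h d u z x p : ℝ) : ℝ :=
  (max 0 (1 - d / h) - max 0 (min (d / h - 1) (3 - d / h))) * u +
    max 0 (min (d / h) (2 - d / h)) * ((z - x) / h) + max 0 (min 1 (d / h - 2)) * p

/-- The coordinate of `topDisp h 1 z x`, in the same way. -/
noncomputable def topCoord (h d z x p : ℝ) : ℝ :=
  min 1 (d / h) * ((z - x) / h) - max 0 (1 - d / h) * p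

lemma profile_apply {m : ℕ} {h : ℝ} (hh : 0 < h) (δ : ℝ) (u z x : Point m) (i : Fin 4 × Fin m) :
    profile h δ u z x i = δ * profileCoord h (rms (x - z)) (u i) (z i) (x i) (up m i) := by
  have hd : 0 ≤ rms (x - z) / h := div_nonneg (rms_nonneg _) hh.le
  simp only [profile, profileCoord]
  split_ifs with h₁ h₂ h₃
  · rw [← div_le_one hh] at h₁
    rw [max_eq_right (by linarith), min_eq_left (by linarith), max_eq_left (by linarith),
      min_eq_left (by linarith), max_eq_right hd, min_eq_right (by linarith),
      max_eq_left (by linarith)]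
    simp only [Pi.add_apply, Pi.smul_apply, Pi.sub_apply, smul_eq_mul]
    ring
  · rw [← div_le_one hh, not_le] at h₁
    rw [← div_le_iff₀ hh] at h₂
    rw [max_eq_left (by linarith), min_eq_left (by linarith), max_eq_right (by linarith),
      min_eq_right (by linarith), max_eq_right (by linarith), min_eq_right (by linarith),
      max_eq_left (by linarith)]
    simp only [Pi.add_apply, Pi.smul_apply, Pi.sub_apply, smul_eq_mul, Pi.neg_apply]
    ring
  · rw [← div_le_one hh, not_le] at h₁
    rw [← div_le_iff₀ hh, not_le] at h₂
    rw [← div_le_iff₀ hh] at h₃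
    rw [max_eq_left (by linarith), min_eq_right (by linarith), max_eq_right (by linarith),
      min_eq_right (by linarith), max_eq_left (by linarith), min_eq_right (by linarith),
      max_eq_right (by linarith)]
    simp only [Pi.add_apply, Pi.smul_apply, smul_eq_mul, Pi.neg_apply]
    ring
  · rw [← div_le_iff₀ hh, not_le] at h₃
    rw [max_eq_left (by linarith), min_eq_right (by linarith), max_eq_left (by linarith),
      min_eq_right (by linarith), max_eq_left (by linarith), min_eq_left (by linarith),
      max_eq_right (by linarith)]
    simp only [Pi.smul_apply, smul_eq_mul]
    ring

lemma profileCoord_of_le {h d : ℝ} (hh : 0 < h) (hd : 3 * h ≤ d) (u z x p : ℝ) :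
    profileCoord h d u z x p = p := by
  rw [← le_div_iff₀ hh] at hd
  rw [profileCoord, max_eq_left (by linarith), min_eq_right (by linarith), max_eq_left (by linarith),
    min_eq_right (by linarith), max_eq_left (by linarith), min_eq_left (by linarith),
    max_eq_right (by linarith)]
  ring

lemma topDisp_apply {m : ℕ} {h : ℝ} (hh : 0 < h) (δ : ℝ) (z x : Point m) (i : Fin 4 × Fin m) :
    topDisp h δ z x i = δ * topCoord h (rms (x - z)) (z i) (x i) (up m i) := by
  simp only [topDisp, topCoord]
  split_ifs with h₁
  · rw [← div_le_one hh] at h₁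
    rw [max_eq_right (by linarith), min_eq_right (by linarith)]
    simp only [Pi.add_apply, Pi.smul_apply, Pi.sub_apply, smul_eq_mul, Pi.neg_apply]
    ring
  · rw [← div_le_one hh, not_le] at h₁
    rw [max_eq_left (by linarith), min_eq_left (by linarith)]
    simp only [Pi.smul_apply, Pi.sub_apply, smul_eq_mul]
    ring

/-- `t` truncated to `[0, 1]`. -/
noncomputable def unitClamp (t : ℝ) : ℝ := max 0 (min 1 t)

/-- A ramp from `0` at `3/4` to `1` at `7/8`. A segment is shared by the terms of its two end points
with the weights `ramp τ` at the target and `1 - ramp τ` at the source. For the first segment the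
range of the ramp is the slab `1/4 ≤ x₄ ≤ 1/2`, and what takes the place of the source is the
displacement outside the picture. -/
noncomputable def ramp (τ : ℝ) : ℝ := unitClamp (8 * τ - 6)

lemma unitClamp_of_mem {t : ℝ} (h₀ : 0 ≤ t) (h₁ : t ≤ 1) : unitClamp t = t := by
  rw [unitClamp, min_eq_right h₁, max_eq_right h₀]

lemma unitClamp_of_nonpos {t : ℝ} (h : t ≤ 0) : unitClamp t = 0 :=
  max_eq_left ((min_le_right _ _).trans h)

lemma unitClamp_of_one_le {t : ℝ} (h : 1 ≤ t) : unitClamp t = 1 := by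
  rw [unitClamp, min_eq_left h, max_eq_right zero_le_one]

lemma ramp_of_le {τ : ℝ} (h : τ ≤ 3 / 4) : ramp τ = 0 := unitClamp_of_nonpos (by linarith)

lemma ramp_of_ge {τ : ℝ} (h : 7 / 8 ≤ τ) : ramp τ = 1 := unitClamp_of_one_le (by linarith)

/-- The functions of the relative positions `τ`, `τ'` with respect to two segments `e`, `e'` that
determine a local term: its point `z` of the path is `mix • z_e + (1 - mix) • z_{e'}`, where `z_e`
and `z_{e'}` are the points of the two segments at `pos` and `pos'`; its direction is the
combination of the directions with the same coefficients; and `near`, `top` are the weights of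
the profile around `z` and of the displacement at the top. -/
structure Shape where
  near : ℝ → ℝ → ℝ
  top : ℝ → ℝ → ℝ
  mix : ℝ → ℝ → ℝ
  pos : ℝ → ℝ → ℝ
  pos' : ℝ → ℝ → ℝ

/-- A function of two variables that preserves tameness when composed. -/
def IsTame₂ (F : ℝ → ℝ → ℝ) : Prop :=
  ∀ ⦃κ : Type⦄ [Fintype κ] ⦃f g : (κ → ℝ) → ℝ⦄, IsTame f → IsTame g → IsTame fun v => F (f v) (g v)

/-- All functions of the shape are tame, so that the term depends tamely on its arguments. -/
structure Shape.Tame (σ : Shape) : Prop where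
  near : IsTame₂ σ.near
  top : IsTame₂ σ.top
  mix : IsTame₂ σ.mix
  pos : IsTame₂ σ.pos
  pos' : IsTame₂ σ.pos'

/-- The term of an interior vertex of the path, with an incoming and an outgoing segment. Where
one of the two excesses `τ - (1 - s)`, `s - τ'` is nonpositive, `mix` is `0` or `1`, so that the
term also describes the two segments themselves. The sum of the excesses is at least `s / 2`
wherever the term does not vanish, so that the denominator is the sum there. -/
noncomputable def cornerShape (s : ℝ) : Shape where
  near τ τ' := ramp τ * (1 - ramp τ')
  top _ _ := 0
  mix τ τ' := max 0 (s - τ') / max (max 0 (s - τ') + max 0 (τ - (1 - s))) (s / 2)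
  pos τ _ := max 0 (min (1 - s) τ)
  pos' _ τ' := max s (min 1 τ')

/-- The term of the last vertex of a path. -/
noncomputable def finalShape (s : ℝ) : Shape where
  near τ _ := ramp τ * unitClamp ((1 - τ) / s)
  top _ _ := 0
  mix _ _ := 1
  pos τ _ := unitClamp τ
  pos' _ _ := 0

/-- The term of the first vertex of a path. -/
noncomputable def initialShape (s : ℝ) : Shape where
  near _ τ' := (1 - ramp τ') * unitClamp (τ' / s)
  top _ _ := 0
  mix _ _ := 0
  pos _ _ := 0
  pos' _ τ' := unitClamp τ'

/-- The term of the upper half of the cube; `2 * (1 - τ)` is the height. -/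
noncomputable def topShape : Shape where
  near τ _ := (1 - ramp τ) * unitClamp (4 / 3 * τ)
  top τ _ := (1 - ramp τ) * (1 - unitClamp (4 / 3 * τ))
  mix _ _ := 1
  pos τ _ := τ
  pos' _ _ := 0

lemma IsTame.unitClamp {κ : Type} [Fintype κ] {f : (κ → ℝ) → ℝ} (hf : IsTame f) :
    IsTame fun v => unitClamp (f v) := (const 0).max ((const 1).min hf)

lemma IsTame.ramp {κ : Type} [Fintype κ] {f : (κ → ℝ) → ℝ} (hf : IsTame f) :
    IsTame fun v => ramp (f v) := (((const 8).mul hf).sub (const 6)).unitClamp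

lemma cornerShape_tame {s : ℝ} (hs : 0 < s) : (cornerShape s).Tame where
  near _ _ _ _ hf hg := hf.ramp.mul ((IsTame.const 1).sub hg.ramp)
  top _ _ _ _ _ _ := .const 0
  mix _ _ _ _ hf hg :=
    have hB := (IsTame.const 0).max ((IsTame.const s).sub hg)
    hB.div ((hB.add ((IsTame.const 0).max (hf.sub (.const (1 - s))))).max (.const (s / 2)))
      fun _ => lt_max_of_lt_right (half_pos hs)
  pos _ _ _ _ hf _ := (IsTame.const 0).max ((IsTame.const (1 - s)).min hf)
  pos' _ _ _ _ _ hg := (IsTame.const s).max ((IsTame.const 1).min hg)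

lemma finalShape_tame (s : ℝ) : (finalShape s).Tame where
  near _ _ _ _ hf _ := hf.ramp.mul (((IsTame.const 1).sub hf).div_const s).unitClamp
  top _ _ _ _ _ _ := .const 0
  mix _ _ _ _ _ _ := .const 1
  pos _ _ _ _ hf _ := hf.unitClamp
  pos' _ _ _ _ _ _ := .const 0

lemma initialShape_tame (s : ℝ) : (initialShape s).Tame where
  near _ _ _ _ _ hg := ((IsTame.const 1).sub hg.ramp).mul (hg.div_const s).unitClamp
  top _ _ _ _ _ _ := .const 0
  mix _ _ _ _ _ _ := .const 0
  pos _ _ _ _ _ _ := .const 0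
  pos' _ _ _ _ _ hg := hg.unitClamp

lemma topShape_tame : topShape.Tame where
  near _ _ _ _ hf _ := ((IsTame.const 1).sub hf.ramp).mul ((IsTame.const (4 / 3)).mul hf).unitClamp
  top _ _ _ _ hf _ := ((IsTame.const 1).sub hf.ramp).mul
    ((IsTame.const 1).sub ((IsTame.const (4 / 3)).mul hf).unitClamp)
  mix _ _ _ _ _ _ := .const 1
  pos _ _ _ _ hf _ := hf
  pos' _ _ _ _ _ _ := .const 0

/-- The combination of two segments `s → t`, `s' → t'` in one coordinate. -/
noncomputable def Shape.center (σ : Shape) (τ τ' s t s' t' : ℝ) : ℝ :=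
  σ.mix τ τ' * (σ.pos τ τ' * t + (1 - σ.pos τ τ') * s) +
    (1 - σ.mix τ τ') * (σ.pos' τ τ' * t' + (1 - σ.pos' τ τ') * s')

/-- The term of shape `σ` in one coordinate, as a function of the scalars it depends on: the
relative positions `τ`, `τ'`, the distance `d` from `z`, and the respective coordinates of `x`,
of `up`, and of the sources, targets and directions `s`, `t`, `u` of the two segments. -/
noncomputable def Shape.value (h : ℝ) (σ : Shape) (τ τ' d x p s t u s' t' u' : ℝ) : ℝ :=
  σ.near τ τ' * (profileCoord h d (σ.mix τ τ' * u + (1 - σ.mix τ τ') * u')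
      (σ.center τ τ' s t s' t') x p - p) +
    σ.top τ τ' * (topCoord h d (σ.center τ τ' s t s' t') x p - p)

section TameValue

variable {κ : Type} [Fintype κ] {σ : Shape}

lemma Shape.Tame.center (hσ : σ.Tame) {τ τ' s t s' t' : (κ → ℝ) → ℝ} (hτ : IsTame τ)
    (hτ' : IsTame τ') (hs : IsTame s) (ht : IsTame t) (hs' : IsTame s') (ht' : IsTame t') :
    IsTame fun v => σ.center (τ v) (τ' v) (s v) (t v) (s' v) (t' v) :=
  have hm := hσ.mix hτ hτ'
  have ha := hσ.pos hτ hτ'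
  have hb := hσ.pos' hτ hτ'
  (hm.mul ((ha.mul ht).add (((IsTame.const 1).sub ha).mul hs))).add
    (((IsTame.const 1).sub hm).mul ((hb.mul ht').add (((IsTame.const 1).sub hb).mul hs')))

lemma IsTame.profileCoord (h : ℝ) {d u z x p : (κ → ℝ) → ℝ} (hd : IsTame d) (hu : IsTame u)
    (hz : IsTame z) (hx : IsTame x) (hp : IsTame p) :
    IsTame fun v => profileCoord h (d v) (u v) (z v) (x v) (p v) :=
  have hd := hd.div_const h
  (((((const 0).max ((const 1).sub hd)).sub
    ((const 0).max ((hd.sub (const 1)).min ((const 3).sub hd)))).mul hu).add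
    (((const 0).max (hd.min ((const 2).sub hd))).mul ((hz.sub hx).div_const h))).add
    (((const 0).max ((const 1).min (hd.sub (const 2)))).mul hp)

lemma IsTame.topCoord (h : ℝ) {d z x p : (κ → ℝ) → ℝ} (hd : IsTame d)
    (hz : IsTame z) (hx : IsTame x) (hp : IsTame p) :
    IsTame fun v => topCoord h (d v) (z v) (x v) (p v) :=
  have hd := hd.div_const h
  (((const 1).min hd).mul ((hz.sub hx).div_const h)).sub
    (((const 0).max ((const 1).sub hd)).mul hp)

lemma Shape.Tame.value (hσ : σ.Tame) (h : ℝ) {τ τ' d x p s t u s' t' u' : (κ → ℝ) → ℝ}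
    (hτ : IsTame τ) (hτ' : IsTame τ') (hd : IsTame d) (hx : IsTame x) (hp : IsTame p)
    (hs : IsTame s) (ht : IsTame t) (hu : IsTame u)
    (hs' : IsTame s') (ht' : IsTame t') (hu' : IsTame u') :
    IsTame fun v => σ.value h (τ v) (τ' v) (d v) (x v) (p v) (s v) (t v) (u v) (s' v) (t' v)
      (u' v) :=
  have hm := hσ.mix hτ hτ'
  have hz := hσ.center hτ hτ' hs ht hs' ht'
  ((hσ.near hτ hτ').mul ((IsTame.profileCoord h hd
    ((hm.mul hu).add (((IsTame.const 1).sub hm).mul hu')) hz hx hp).sub hp)).add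
    ((hσ.top hτ hτ').mul ((IsTame.topCoord h hd hz hx hp).sub hp))

/-- Among bounded arguments, the center depends on the relative positions in a Lipschitz way. -/
lemma Shape.Tame.exists_center_lipschitz (hσ : σ.Tame) (R : ℝ) : ∃ Λ : ℝ, 0 ≤ Λ ∧
    ∀ τ₁ τ₁' τ₂ τ₂' s t s' t' β : ℝ, |τ₁| ≤ R → |τ₁'| ≤ R → |τ₂| ≤ R → |τ₂'| ≤ R →
      |s| ≤ R → |t| ≤ R → |s'| ≤ R → |t'| ≤ R → |τ₁ - τ₂| ≤ β → |τ₁' - τ₂'| ≤ β →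
      |σ.center τ₁ τ₁' s t s' t' - σ.center τ₂ τ₂' s t s' t'| ≤ Λ * β := by
  obtain ⟨Λ, hΛ0, hΛ⟩ := (hσ.center (.coord (0 : Fin 6)) (.coord 1) (.coord 2) (.coord 3)
    (.coord 4) (.coord 5)).exists_lipschitz R
  refine ⟨Λ, hΛ0, fun τ₁ τ₁' τ₂ τ₂' s t s' t' β h₁ h₁' h₂ h₂' hs ht hs' ht' h h' => ?_⟩
  have hβ := (abs_nonneg _).trans h
  refine hΛ ![τ₁, τ₁', s, t, s', t'] ![τ₂, τ₂', s, t, s', t'] ?_ ?_ β ?_ hβ <;>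
    intro k <;> fin_cases k <;> simp [*]

/-- Among bounded arguments, the value depends in a Lipschitz way on the statistics of `x`. -/
lemma Shape.Tame.exists_value_lipschitz (hσ : σ.Tame) (h R : ℝ) : ∃ Λ : ℝ, 0 ≤ Λ ∧
    ∀ τ₁ τ₁' d₁ x₁ τ₂ τ₂' d₂ x₂ p s t u s' t' u' β : ℝ, |τ₁| ≤ R → |τ₁'| ≤ R → |d₁| ≤ R →
      |x₁| ≤ R → |τ₂| ≤ R → |τ₂'| ≤ R → |d₂| ≤ R → |x₂| ≤ R → |p| ≤ R →
      |s| ≤ R → |t| ≤ R → |u| ≤ R → |s'| ≤ R → |t'| ≤ R → |u'| ≤ R →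
      |τ₁ - τ₂| ≤ β → |τ₁' - τ₂'| ≤ β → |d₁ - d₂| ≤ β → |x₁ - x₂| ≤ β →
      |σ.value h τ₁ τ₁' d₁ x₁ p s t u s' t' u' - σ.value h τ₂ τ₂' d₂ x₂ p s t u s' t' u'|
        ≤ Λ * β := by
  obtain ⟨Λ, hΛ0, hΛ⟩ := (hσ.value h (.coord (0 : Fin 11)) (.coord 1) (.coord 2) (.coord 3)
    (.coord 4) (.coord 5) (.coord 6) (.coord 7) (.coord 8) (.coord 9)
    (.coord 10)).exists_lipschitz R
  refine ⟨Λ, hΛ0, fun τ₁ τ₁' d₁ x₁ τ₂ τ₂' d₂ x₂ p s t u s' t' u' β => ?_⟩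
  intros
  have hβ := (abs_nonneg _).trans ‹|τ₁ - τ₂| ≤ β›
  refine hΛ ![τ₁, τ₁', d₁, x₁, p, s, t, u, s', t', u'] ![τ₂, τ₂', d₂, x₂, p, s, t, u, s', t', u']
    ?_ ?_ β ?_ hβ <;> intro k <;> fin_cases k <;> simp [*]

end TameValue

/-! ### Estimating local terms from sampled coordinates -/

section Entries

variable {n m : ℕ} (C : Code n m)

lemma Code.word_mem (v : Vertex n) (j : Fin m) : C.word v j = 0 ∨ C.word v j = 1 := by
  unfold Code.word
  split_ifs <;> simp

lemma Code.word_mem_Icc (v : Vertex n) (j : Fin m) : C.word v j ∈ Set.Icc (0 : ℝ) 2 := by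
  rcases C.word_mem v j with h | h <;> rw [h] <;> norm_num

lemma blocks_mem_Icc {a b c d : Fin m → ℝ} (ha : ∀ j, a j ∈ Set.Icc (0 : ℝ) 2)
    (hb : ∀ j, b j ∈ Set.Icc (0 : ℝ) 2) (hc : ∀ j, c j ∈ Set.Icc (0 : ℝ) 2)
    (hd : ∀ j, d j ∈ Set.Icc (0 : ℝ) 2) (i : Fin 4 × Fin m) :
    blocks a b c d i ∈ Set.Icc (0 : ℝ) 2 := by
  obtain ⟨r, j⟩ := i
  fin_cases r
  exacts [ha j, hb j, hc j, hd j]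

lemma Code.brouwerVertex_mem_Icc (u v : Vertex n) (k : Fin 5) (i : Fin 4 × Fin m) :
    C.brouwerVertex u v k i ∈ Set.Icc (0 : ℝ) 2 := by
  have h0 : ∀ j, (0 : Fin m → ℝ) j ∈ Set.Icc (0 : ℝ) 2 := fun j => by simp
  have h1 : ∀ j, (1 : Fin m → ℝ) j ∈ Set.Icc (0 : ℝ) 2 := fun j => by norm_num
  have hu := C.word_mem_Icc u
  have hv := C.word_mem_Icc v
  fin_cases k
  exacts [blocks_mem_Icc hu hu h0 h0 i, blocks_mem_Icc hu hv h0 h0 i, blocks_mem_Icc hu hv h1 h0 i,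
    blocks_mem_Icc hv hv h1 h0 i, blocks_mem_Icc hv hv h0 h0 i]

lemma Code.src_mem_Icc (e : Segment n) (i : Fin 4 × Fin m) : C.src e i ∈ Set.Icc (0 : ℝ) 2 := by
  cases e with
  | first =>
    exact blocks_mem_Icc (fun j => by simp) (fun j => by simp) (fun j => by simp)
      (fun j => by simp) i
  | edge u v τ => exact C.brouwerVertex_mem_Icc u v _ i

lemma Code.tgt_mem_Icc (e : Segment n) (i : Fin 4 × Fin m) : C.tgt e i ∈ Set.Icc (0 : ℝ) 2 := by
  cases e with
  | first => simp [Code.tgt]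
  | edge u v τ => exact C.brouwerVertex_mem_Icc u v _ i

lemma Code.abs_tgt_sub_src_le (e : Segment n) (i : Fin 4 × Fin m) :
    |(C.tgt e - C.src e) i| ≤ 2 := by
  have h₁ := C.tgt_mem_Icc e i
  have h₂ := C.src_mem_Icc e i
  rw [Pi.sub_apply, abs_le]
  constructor <;> linarith [h₁.1, h₁.2, h₂.1, h₂.2]

lemma abs_up_le (i : Fin 4 × Fin m) : |up m i| ≤ 1 := by
  obtain ⟨r, j⟩ := i
  fin_cases r <;> simp [up, blocks]

lemma Code.abs_dir_le {r : ℝ} (hr : 0 < r) (hr1 : r ≤ 1) {e : Segment n}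
    (he : r / 4 ≤ rms (C.tgt e - C.src e) ^ 2) (i : Fin 4 × Fin m) : |C.dir e i| ≤ 4 / r := by
  cases e with
  | first =>
    rw [Code.dir, Pi.neg_apply, abs_neg]
    exact (abs_up_le i).trans (by rw [le_div_iff₀ hr]; linarith)
  | edge u v τ =>
    set L := rms (C.tgt (.edge u v τ) - C.src (.edge u v τ)) with hL
    have hLr : r / 2 ≤ L := by
      apply le_of_sq_le_sq _ (rms_nonneg _)
      nlinarith
    have hL0 : 0 < L := by linarith
    rw [Code.dir, Pi.smul_apply, smul_eq_mul, abs_mul, abs_of_pos (by positivity)]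
    calc L⁻¹ * |(C.tgt (.edge u v τ) - C.src (.edge u v τ)) i| ≤ (r / 2)⁻¹ * 2 := by
          gcongr
          exact C.abs_tgt_sub_src_le _ i
      _ = 4 / r := by field_simp; norm_num

end Entries

/-- A local term: a shape and the two segments it refers to. -/
structure Piece (n : ℕ) where
  shape : Shape
  e : Segment n
  e' : Segment n

section Statistics

variable {n m : ℕ} (C : Code n m) {ι : Type} [Fintype ι]

/-- The relative position with respect to `e`, estimated from the coordinates selected by `φ`. -/
noncomputable def Code.tauOn (φ : ι → Fin 4 × Fin m) (e : Segment n) (y : ι → ℝ) : ℝ :=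
  avgDot ((C.tgt e - C.src e) ∘ φ) (y - C.src e ∘ φ) / rms (C.tgt e - C.src e) ^ 2

/-- The point `z` of a local term at given relative positions. -/
noncomputable def Piece.center (p : Piece n) (τ τ' : ℝ) : Point m := fun i =>
  p.shape.center τ τ' (C.src p.e i) (C.tgt p.e i) (C.src p.e' i) (C.tgt p.e' i)

/-- The distance from `z`, estimated from the coordinates selected by `φ`. -/
noncomputable def Piece.distOn (φ : ι → Fin 4 × Fin m) (p : Piece n) (y : ι → ℝ) : ℝ :=
  rms (y - p.center C (C.tauOn φ p.e y) (C.tauOn φ p.e' y) ∘ φ)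

/-- The `i`-th coordinate of a local term, estimated from the coordinates selected by `φ` and from
the coordinate `xi`. -/
noncomputable def Piece.valueOn (h : ℝ) (φ : ι → Fin 4 × Fin m) (p : Piece n) (i : Fin 4 × Fin m)
    (y : ι → ℝ) (xi : ℝ) : ℝ :=
  p.shape.value h (C.tauOn φ p.e y) (C.tauOn φ p.e' y) (p.distOn C φ y) xi (up m i)
    (C.src p.e i) (C.tgt p.e i) (C.dir p.e i) (C.src p.e' i) (C.tgt p.e' i) (C.dir p.e' i)

/-- The `i`-th coordinate of a local term. -/
noncomputable def Piece.value (h : ℝ) (p : Piece n) (x : Point m) (i : Fin 4 × Fin m) : ℝ :=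
  p.valueOn C h id i x (x i)

lemma Code.isProgrammable_tauOn {κ : Type} (φ : ι → Fin 4 × Fin m) (e : Segment n)
    {y : ι → (κ → ℝ) → ℝ} (hy : ∀ a, IsProgrammable (y a)) :
    IsProgrammable fun w => C.tauOn φ e fun a => y a w :=
  (IsProgrammable.avgDot (fun _ => .const _) fun a => (hy a).sub (.const _)).div (.const _)

lemma Piece.isProgrammable_valueOn {κ : Type} {h : ℝ} {φ : ι → Fin 4 × Fin m} {p : Piece n}
    (hp : p.shape.Tame) (i : Fin 4 × Fin m) {y : ι → (κ → ℝ) → ℝ} {xi : (κ → ℝ) → ℝ}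
    (hy : ∀ a, IsProgrammable (y a)) (hxi : IsProgrammable xi) :
    IsProgrammable fun w => p.valueOn C h φ i (fun a => y a w) (xi w) := by
  have hτ := C.isProgrammable_tauOn φ p.e hy
  have hτ' := C.isProgrammable_tauOn φ p.e' hy
  have hc : ∀ a, IsProgrammable fun w => p.center C (C.tauOn φ p.e fun a => y a w)
      (C.tauOn φ p.e' fun a => y a w) (φ a) := fun a => by
    have := (hp.center (.coord (0 : Fin 2)) (.coord 1) (.const (C.src p.e (φ a)))
      (.const (C.tgt p.e (φ a))) (.const (C.src p.e' (φ a))) (.const (C.tgt p.e' (φ a)))).2.comp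
      (g := ![_, _]) (fun k => by fin_cases k; exacts [hτ, hτ'])
    exact this
  have hd : IsProgrammable fun w => p.distOn C φ fun a => y a w :=
    (IsProgrammable.avgDot (fun a => (hy a).sub (hc a)) fun a => (hy a).sub (hc a)).sqrt
  have := (hp.value h (.coord (0 : Fin 4)) (.coord 1) (.coord 2) (.coord 3) (.const (up m i))
    (.const (C.src p.e i)) (.const (C.tgt p.e i)) (.const (C.dir p.e i))
    (.const (C.src p.e' i)) (.const (C.tgt p.e' i)) (.const (C.dir p.e' i))).2.comp
    (g := ![_, _, _, _]) (fun k => by fin_cases k; exacts [hτ, hτ', hd, hxi])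
  exact this

end Statistics

section Estimate

variable {n m : ℕ} {ι : Type} [Fintype ι]

/-- The average of `g * g'` over the coordinates selected by `φ` is `η`-close to that over all
coordinates. -/
def AvgClose (φ : ι → Fin 4 × Fin m) (η : ℝ) (g g' : Point m) : Prop :=
  |avgDot (g ∘ φ) (g' ∘ φ) - avgDot g g'| ≤ η

/-- The three averages that a local term depends on are estimated up to `η`. -/
structure Piece.WellSampled (C : Code n m) (φ : ι → Fin 4 × Fin m) (η : ℝ) (p : Piece n)
    (x : Point m) : Prop where
  e : AvgClose φ η (C.tgt p.e - C.src p.e) (x - C.src p.e)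
  e' : AvgClose φ η (C.tgt p.e' - C.src p.e') (x - C.src p.e')
  dist : AvgClose φ η (x - p.center C (C.tau p.e x) (C.tau p.e' x))
    (x - p.center C (C.tau p.e x) (C.tau p.e' x))

lemma abs_sqrt_sub_sqrt_le {a b : ℝ} (ha : 0 ≤ a) (hb : 0 ≤ b) :
    |√a - √b| ≤ √|a - b| := by
  apply Real.le_sqrt_of_sq_le
  have h : |a - b| = |√a - √b| * (√a + √b) := by
    rw [← abs_of_nonneg (add_nonneg (Real.sqrt_nonneg a) (Real.sqrt_nonneg b)), ← abs_mul]
    congr 1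
    nlinarith [Real.sq_sqrt ha, Real.sq_sqrt hb]
  rw [h, pow_two]
  gcongr
  rw [abs_le]
  constructor <;> linarith [Real.sqrt_nonneg a, Real.sqrt_nonneg b]

lemma Code.abs_mul_le (C : Code n m) (e : Segment n) (i : Fin 4 × Fin m) {y : ℝ}
    (hy : y ∈ Set.Icc (-1 : ℝ) 2) : |(C.tgt e - C.src e) i * (y - C.src e i)| ≤ 6 := by
  have h₂ := C.src_mem_Icc e i
  have h₃ : |y - C.src e i| ≤ 3 := by
    rw [abs_le]
    constructor <;> linarith [h₂.1, h₂.2, hy.1, hy.2]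
  rw [abs_mul]
  calc _ ≤ (2 : ℝ) * 3 := mul_le_mul (C.abs_tgt_sub_src_le e i) h₃ (abs_nonneg _) zero_le_two
    _ = 6 := by norm_num

lemma Code.abs_tauOn_le {C : Code n m} {r : ℝ} (hr : 0 < r) {e : Segment n}
    (he : r / 4 ≤ rms (C.tgt e - C.src e) ^ 2) (φ : ι → Fin 4 × Fin m) {y : ι → ℝ}
    (hy : ∀ a, y a ∈ Set.Icc (-1 : ℝ) 2) : |C.tauOn φ e y| ≤ 24 / r := by
  rw [Code.tauOn, abs_div, abs_of_nonneg (sq_nonneg (rms (C.tgt e - C.src e)))]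
  have h : |avgDot ((C.tgt e - C.src e) ∘ φ) (y - C.src e ∘ φ)| ≤ 6 :=
    abs_avgDot_le_of_abs_le (by norm_num) fun a => C.abs_mul_le e (φ a) (hy a)
  calc _ ≤ 6 / (r / 4) := by gcongr
    _ = 24 / r := by field_simp; norm_num

lemma Code.abs_tauOn_sub_le {C : Code n m} {r : ℝ} (hr : 0 < r) {e : Segment n}
    (he : r / 4 ≤ rms (C.tgt e - C.src e) ^ 2) {φ : ι → Fin 4 × Fin m} {η ε : ℝ} {x : Point m}
    (hx : AvgClose φ η (C.tgt e - C.src e) (x - C.src e)) {y : ι → ℝ} (hy : rms (y - x ∘ φ) ≤ ε) :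
    |C.tauOn φ e y - C.tau e x| ≤ 4 / r * (2 * ε + η) := by
  have hrL : 0 < rms (C.tgt e - C.src e) ^ 2 := by linarith
  rw [Code.tauOn, Code.tau, ← sub_div, abs_div, abs_of_pos hrL]
  set D := C.tgt e - C.src e
  have h₁ : avgDot (D ∘ φ) (y - C.src e ∘ φ) - avgDot D (x - C.src e) =
      avgDot (D ∘ φ) (y - x ∘ φ) +
        (avgDot (D ∘ φ) ((x - C.src e) ∘ φ) - avgDot D (x - C.src e)) := by
    have : y - C.src e ∘ φ = (y - x ∘ φ) + (x - C.src e) ∘ φ := by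
      ext a
      simp
    rw [this, avgDot_add_right]
    ring
  have h₂ : |avgDot (D ∘ φ) (y - x ∘ φ)| ≤ 2 * ε := by
    refine (abs_avgDot_le _ _).trans (mul_le_mul ?_ hy (rms_nonneg _) zero_le_two)
    exact rms_le_of_abs_le zero_le_two fun a => C.abs_tgt_sub_src_le e (φ a)
  have h₃ : |avgDot (D ∘ φ) (y - C.src e ∘ φ) - avgDot D (x - C.src e)| ≤ 2 * ε + η := by
    rw [h₁]
    exact (abs_add_le _ _).trans (add_le_add h₂ hx)
  calc _ ≤ (2 * ε + η) / (r / 4) := by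
        gcongr
        exact (abs_nonneg _).trans h₃
    _ = _ := by field_simp

/-- The points `z` of local terms of a given shape are bounded. -/
lemma Shape.Tame.exists_center_bound {σ : Shape} (hσ : σ.Tame) (R : ℝ) : ∃ Z : ℝ, 0 ≤ Z ∧
    ∀ τ τ' : ℝ, |τ| ≤ R → |τ'| ≤ R → ∀ s t s' t' : ℝ, |s| ≤ R → |t| ≤ R → |s'| ≤ R →
      |t'| ≤ R → |σ.center τ τ' s t s' t'| ≤ Z := by
  obtain ⟨Λ, hΛ0, hΛ⟩ := (hσ.center (.coord (0 : Fin 6)) (.coord 1) (.coord 2) (.coord 3)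
    (.coord 4) (.coord 5)).exists_lipschitz |R|
  refine ⟨Λ * |R| + |σ.center 0 0 0 0 0 0|, by positivity,
    fun τ τ' h h' s t s' t' hs ht hs' ht' => ?_⟩
  have hR := le_abs_self R
  have := hΛ ![τ, τ', s, t, s', t'] 0 ?_ (by simp) |R| ?_ (abs_nonneg _)
  · have h₂ := abs_sub_abs_le_abs_sub (σ.center τ τ' s t s' t') (σ.center 0 0 0 0 0 0)
    simp at this
    linarith
  · intro k; fin_cases k <;> simp <;> linarith
  · intro k; fin_cases k <;> simp <;> linarith

/-- Local terms are estimated well from well sampled coordinates, even if these coordinates are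
perturbed. The perturbation enters linearly; the sampling error need not. -/
lemma Shape.Tame.exists_estimate {σ : Shape} (hσ : σ.Tame) (h : ℝ) {r : ℝ} (hr : 0 < r)
    (hr1 : r ≤ 1) : ∃ Λ : ℝ, 0 ≤ Λ ∧ ∀ (n m : ℕ) (C : Code n m) (p : Piece n), p.shape = σ →
      r / 4 ≤ rms (C.tgt p.e - C.src p.e) ^ 2 → r / 4 ≤ rms (C.tgt p.e' - C.src p.e') ^ 2 →
      ∀ (ι : Type) [Fintype ι] (φ : ι → Fin 4 × Fin m) (η ε : ℝ) (x : Point m) (y : ι → ℝ)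
        (i : Fin 4 × Fin m) (xi : ℝ),
        0 ≤ ε → 0 ≤ η → η ≤ 1 → (∀ i, x i ∈ Set.Icc (-1 : ℝ) 2) →
        (∀ a, y a ∈ Set.Icc (-1 : ℝ) 2) → xi ∈ Set.Icc (-1 : ℝ) 2 → |xi - x i| ≤ ε →
        rms (y - x ∘ φ) ≤ ε → p.WellSampled C φ η x →
        |p.valueOn C h φ i y xi - p.value C h x i| ≤ Λ * (ε + √η) := by
  have h24 : 24 ≤ 24 / r := by rw [le_div_iff₀ hr]; linarith
  obtain ⟨Z, hZ0, hZ⟩ := hσ.exists_center_bound (24 / r)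
  obtain ⟨Λc, hΛc0, hΛc⟩ := hσ.exists_center_lipschitz (24 / r)
  obtain ⟨Λv, hΛv0, hΛv⟩ := hσ.exists_value_lipschitz h (24 / r + 2 + Z)
  refine ⟨Λv * ((1 + Λc) * (8 / r) + 1), by positivity, ?_⟩
  rintro n m C p rfl he he' ι _ φ η ε x y i xi hε hη hη1 hx hy hxi hxix hyx hs
  have habs : ∀ {a : ℝ}, a ∈ Set.Icc (-1 : ℝ) 2 → |a| ≤ 2 := fun ha => by
    rw [abs_le]; constructor <;> linarith [ha.1, ha.2]
  have habs' : ∀ {a : ℝ}, a ∈ Set.Icc (0 : ℝ) 2 → |a| ≤ 2 := fun ha => by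
    rw [abs_le]; constructor <;> linarith [ha.1, ha.2]
  have hs1 := fun i => habs' (C.src_mem_Icc p.e i)
  have hs2 := fun i => habs' (C.tgt_mem_Icc p.e i)
  have hs3 := fun i => habs' (C.src_mem_Icc p.e' i)
  have hs4 := fun i => habs' (C.tgt_mem_Icc p.e' i)
  have hτy := Code.abs_tauOn_le hr he φ hy
  have hτy' := Code.abs_tauOn_le hr he' φ hy
  have hτx : |C.tau p.e x| ≤ 24 / r := Code.abs_tauOn_le hr he id hx
  have hτx' : |C.tau p.e' x| ≤ 24 / r := Code.abs_tauOn_le hr he' id hx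
  have hτ := Code.abs_tauOn_sub_le hr he hs.e hyx
  have hτ' := Code.abs_tauOn_sub_le hr he' hs.e' hyx
  set β := 4 / r * (2 * ε + η) with hβ
  have hβ0 : 0 ≤ β := by positivity
  set zy := p.center C (C.tauOn φ p.e y) (C.tauOn φ p.e' y) with hzy
  set zx := p.center C (C.tau p.e x) (C.tau p.e' x) with hzx
  have hzyB : ∀ i, |zy i| ≤ Z := fun i => hZ _ _ hτy hτy' _ _ _ _ (by linarith [hs1 i])
    (by linarith [hs2 i]) (by linarith [hs3 i]) (by linarith [hs4 i])
  have hzxB : ∀ i, |zx i| ≤ Z := fun i => hZ _ _ hτx hτx' _ _ _ _ (by linarith [hs1 i])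
    (by linarith [hs2 i]) (by linarith [hs3 i]) (by linarith [hs4 i])
  have hzz : ∀ i, |zy i - zx i| ≤ Λc * β := fun i => hΛc _ _ _ _ _ _ _ _ _ hτy hτy' hτx hτx'
    (by linarith [hs1 i]) (by linarith [hs2 i]) (by linarith [hs3 i]) (by linarith [hs4 i]) hτ hτ'
  have hdy : p.distOn C φ y = rms (y - zy ∘ φ) := rfl
  have hdx : p.distOn C id x = rms (x - zx) := rfl
  have hdyB : |p.distOn C φ y| ≤ 2 + Z := by
    rw [hdy, abs_of_nonneg (rms_nonneg _)]
    exact rms_le_of_abs_le (by positivity) fun a =>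
      (abs_sub _ _).trans (add_le_add (habs (hy a)) (hzyB _))
  have hdxB : |p.distOn C id x| ≤ 2 + Z := by
    rw [hdx, abs_of_nonneg (rms_nonneg _)]
    exact rms_le_of_abs_le (by positivity) fun a =>
      (abs_sub _ _).trans (add_le_add (habs (hx a)) (hzxB _))
  have hd : |p.distOn C φ y - p.distOn C id x| ≤ ε + Λc * β + √η := by
    rw [hdy, hdx]
    have h₁ : |rms (y - zy ∘ φ) - rms ((x - zx) ∘ φ)| ≤ ε + Λc * β := by
      refine (abs_rms_sub_rms_le _ _).trans ?_
      have : y - zy ∘ φ - (x - zx) ∘ φ = (y - x ∘ φ) + (-((zy - zx) ∘ φ)) := by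
        ext a
        simp only [Pi.sub_apply, Function.comp_apply, Pi.add_apply, Pi.neg_apply]
        ring
      rw [this]
      refine (rms_add_le _ _).trans (add_le_add hyx ?_)
      rw [rms_neg]
      exact rms_le_of_abs_le (by positivity) fun a => hzz _
    have h₂ : |rms ((x - zx) ∘ φ) - rms (x - zx)| ≤ √η :=
      (abs_sqrt_sub_sqrt_le (avgDot_self_nonneg _) (avgDot_self_nonneg _)).trans
        (Real.sqrt_le_sqrt hs.dist)
    exact (abs_sub_le _ _ _).trans (add_le_add h₁ h₂)
  have hη2 : η ≤ √η := by
    apply Real.le_sqrt_of_sq_le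
    nlinarith
  have hsq := Real.sqrt_nonneg η
  have hΛβ : 0 ≤ Λc * β := by positivity
  have hR := fun (a : ℝ) (ha : |a| ≤ 24 / r) => (by linarith : |a| ≤ 24 / r + 2 + Z)
  have hu : |C.dir p.e i| ≤ 24 / r := (C.abs_dir_le hr hr1 he i).trans (by gcongr; norm_num)
  have hu' : |C.dir p.e' i| ≤ 24 / r := (C.abs_dir_le hr hr1 he' i).trans (by gcongr; norm_num)
  have hfin := hΛv (C.tauOn φ p.e y) (C.tauOn φ p.e' y) (p.distOn C φ y) xi (C.tau p.e x)
    (C.tau p.e' x) (p.distOn C id x) (x i) (up m i) (C.src p.e i) (C.tgt p.e i) (C.dir p.e i)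
    (C.src p.e' i) (C.tgt p.e' i) (C.dir p.e' i) (β + ε + Λc * β + √η)
    (hR _ hτy) (hR _ hτy') (by linarith) (hR _ (by linarith [habs hxi])) (hR _ hτx) (hR _ hτx')
    (by linarith) (hR _ (by linarith [habs (hx i)])) (hR _ (by linarith [abs_up_le i]))
    (hR _ (by linarith [hs1 i])) (hR _ (by linarith [hs2 i])) (hR _ hu)
    (hR _ (by linarith [hs3 i])) (hR _ (by linarith [hs4 i])) (hR _ hu')
    (by linarith) (by linarith) (by linarith) (by linarith)
  refine hfin.trans ?_
  rw [mul_assoc]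
  refine mul_le_mul_of_nonneg_left ?_ hΛv0
  have h₁ : β ≤ 8 / r * (ε + √η) := by
    rw [hβ, show 8 / r * (ε + √η) = 4 / r * (2 * ε + 2 * √η) by ring]
    gcongr
    linarith
  nlinarith [mul_le_mul_of_nonneg_left h₁ (by positivity : 0 ≤ 1 + Λc)]

end Estimate

/-! ### The combinatorics of the Brouwer path -/

section Combinatorics

variable {n : ℕ}

namespace Segment

/-- The name `(κ, v)` of the Brouwer vertex at which a segment ends. The four kinds `κ` are those
of the points `(V, V, 0, 0)`, `(V, W, 0, 0)`, `(U, V, 1, 0)`, `(V, V, 1, 0)` for edges `v → w` and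
`u → v`, so that the block `0` for `κ = 0, 1`, and `1` for `κ = 2, 3`, of such a point and of the
points of the two segments that meet in it equals `V`. -/
def endOf : Segment n → Fin 4 × Vertex n
  | .first => (0, fun _ => false)
  | .edge u _ 0 => (1, u)
  | .edge _ v 1 => (2, v)
  | .edge _ v 2 => (3, v)
  | .edge _ v 3 => (0, v)

/-- The name of the Brouwer vertex at which a segment starts; there is none for the first one. -/
def startOf : Segment n → Option (Fin 4 × Vertex n)
  | .first => none
  | .edge u _ 0 => some (0, u)
  | .edge u _ 1 => some (1, u)
  | .edge _ v 2 => some (2, v)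
  | .edge _ v 3 => some (3, v)

end Segment

/-- What an algorithm is told about `v`. -/
def EoLGraph.known (G : EoLGraph n) (v : Vertex n) :
    Vertex n × Option (Vertex n) × Option (Vertex n) := (v, G.succ v, G.pred v)

/-- The segment that comes into the Brouwer vertex of kind `κ` at a vertex, computed from the
information on the vertex. -/
def inSeg : Fin 4 → Vertex n × Option (Vertex n) × Option (Vertex n) → Option (Segment n)
  | 0, (v, _, P) => if v = (fun _ => false) then some .first else P.map fun u => .edge u v 3
  | 1, (v, S, _) => S.map fun w => .edge v w 0
  | 2, (v, _, P) => P.map fun u => .edge u v 1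
  | 3, (v, _, P) => P.map fun u => .edge u v 2

/-- The segment that goes out of the Brouwer vertex of kind `κ` at a vertex. -/
def outSeg : Fin 4 → Vertex n × Option (Vertex n) × Option (Vertex n) → Option (Segment n)
  | 0, (v, S, _) => S.map fun w => .edge v w 0
  | 1, (v, S, _) => S.map fun w => .edge v w 1
  | 2, (v, _, P) => P.map fun u => .edge u v 2
  | 3, (v, _, P) => P.map fun u => .edge u v 3

variable {G : EoLGraph n}

lemma inSeg_eq_some {κ : Fin 4} {v : Vertex n} {e : Segment n} :
    inSeg κ (G.known v) = some e ↔ G.IsSegment e ∧ e.endOf = (κ, v) := by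
  have hz := G.pred_zero
  have hp := G.succ_iff_pred
  by_cases hv : v = fun _ => false
  · subst hv
    cases e with
    | first =>
      fin_cases κ <;> simp [inSeg, EoLGraph.known, EoLGraph.IsSegment, Segment.endOf]
    | edge u w k =>
      fin_cases κ <;> fin_cases k <;>
        simp [inSeg, EoLGraph.known, EoLGraph.IsSegment, Segment.endOf] <;> grind
  · cases e with
    | first =>
      fin_cases κ <;> simp [inSeg, EoLGraph.known, EoLGraph.IsSegment, Segment.endOf, hv,
        Ne.symm hv]
    | edge u w k =>
      fin_cases κ <;> fin_cases k <;>
        simp [inSeg, EoLGraph.known, EoLGraph.IsSegment, Segment.endOf, hv] <;> grind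

lemma outSeg_eq_some {κ : Fin 4} {v : Vertex n} {e : Segment n} :
    outSeg κ (G.known v) = some e ↔ G.IsSegment e ∧ e.startOf = some (κ, v) := by
  have hp := G.succ_iff_pred
  cases e with
  | first =>
    fin_cases κ <;>
      simp [outSeg, EoLGraph.known, EoLGraph.IsSegment, Segment.startOf]
  | edge u w k =>
    fin_cases κ <;> fin_cases k <;>
      simp [outSeg, EoLGraph.known, EoLGraph.IsSegment, Segment.startOf] <;> grind

/-- The segment `e'` starts where `e` ends, by name. -/
def Linked (G : EoLGraph n) (e e' : Segment n) : Prop :=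
  G.IsSegment e ∧ G.IsSegment e' ∧ e'.startOf = some e.endOf

lemma Linked.right_unique {e e₁ e₂ : Segment n} (h₁ : Linked G e e₁) (h₂ : Linked G e e₂) :
    e₁ = e₂ := by
  have h := outSeg_eq_some.2 ⟨h₁.2.1, h₁.2.2⟩
  rw [outSeg_eq_some.2 ⟨h₂.2.1, h₂.2.2⟩] at h
  exact (Option.some_injective _ h).symm

lemma eq_of_endOf_eq {e₁ e₂ : Segment n} (h₁ : G.IsSegment e₁) (h₂ : G.IsSegment e₂)
    (h : e₁.endOf = e₂.endOf) : e₁ = e₂ := by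
  have h' := inSeg_eq_some.2 ⟨h₁, rfl⟩
  rw [inSeg_eq_some.2 ⟨h₂, h.symm⟩] at h'
  exact (Option.some_injective _ h').symm

lemma Linked.left_unique {e e₁ e₂ : Segment n} (h₁ : Linked G e₁ e) (h₂ : Linked G e₂ e) :
    e₁ = e₂ :=
  eq_of_endOf_eq h₁.1 h₂.1 (Option.some_injective _ (h₁.2.2.symm.trans h₂.2.2))

namespace Segment

/-- The vertex whose codeword is block `0` of all points of the segment, if there is one. -/
def vertex₀ : Segment n → Option (Vertex n)
  | .first => some fun _ => false
  | .edge u _ 0 => some u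
  | .edge u _ 1 => some u
  | .edge _ _ 2 => none
  | .edge _ v 3 => some v

/-- The vertex whose codeword is block `1` of all points of the segment, if there is one. -/
def vertex₁ : Segment n → Option (Vertex n)
  | .first => some fun _ => false
  | .edge _ _ 0 => none
  | .edge _ v 1 => some v
  | .edge _ v 2 => some v
  | .edge _ v 3 => some v

/-- The constant value, `0` or `1`, of block `2` of all points of the segment, if there is one. -/
def bit₂ : Segment n → Option Bool
  | .first => some false
  | .edge _ _ 0 => some false
  | .edge _ _ 1 => none
  | .edge _ _ 2 => some true
  | .edge _ _ 3 => none

end Segment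

/-- Two segments whose constant blocks do not tell them apart are equal or adjacent. -/
lemma eq_or_linked_of_compatible {e e' : Segment n} (he : G.IsSegment e) (he' : G.IsSegment e')
    (h₀ : ∀ u v, e.vertex₀ = some u → e'.vertex₀ = some v → u = v)
    (h₁ : ∀ u v, e.vertex₁ = some u → e'.vertex₁ = some v → u = v)
    (h₂ : ∀ a b, e.bit₂ = some a → e'.bit₂ = some b → a = b) :
    e = e' ∨ Linked G e e' ∨ Linked G e' e := by
  have hz := G.pred_zero
  have hp := G.succ_iff_pred
  have hl := G.no_loop
  simp only [Linked, he, he', true_and]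
  cases e with
  | first =>
    cases e' with
    | first => exact .inl rfl
    | edge u v k =>
      fin_cases k <;>
        simp [Segment.endOf, Segment.startOf, Segment.vertex₀, Segment.vertex₁, Segment.bit₂,
          EoLGraph.IsSegment] at * <;> grind
  | edge u v k =>
    cases e' with
    | first =>
      fin_cases k <;>
        simp [Segment.endOf, Segment.startOf, Segment.vertex₀, Segment.vertex₁, Segment.bit₂,
          EoLGraph.IsSegment] at * <;> grind
    | edge u' v' k' =>
      fin_cases k <;> fin_cases k' <;>
        simp [Segment.endOf, Segment.startOf, Segment.vertex₀, Segment.vertex₁, Segment.bit₂,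
          EoLGraph.IsSegment] at * <;> grind

end Combinatorics

/-! ### The geometry of the Brouwer path -/

section Geometry

variable {n m : ℕ} {C : Code n m} {G : EoLGraph n} {q s : ℝ}

/-- Codewords are at distance at least `q`, and the scale `s`, which plays the role of `√h`, is
small compared to `q`. -/
structure Code.Separated (C : Code n m) (q s : ℝ) : Prop where
  m_pos : 0 < m
  s_pos : 0 < s
  s_le : 100 * s ≤ q
  q_le : q ≤ 1
  le_rms : ∀ u v, u ≠ v → q ≤ rms (C.word u - C.word v)

lemma Code.Separated.s_le_one (hC : C.Separated q s) : 100 * s ≤ 1 := hC.s_le.trans hC.q_le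

lemma Code.Separated.eq_of_rms_lt (hC : C.Separated q s) {u v : Vertex n}
    (h : rms (C.word u - C.word v) < 100 * s) : u = v := by
  by_contra hne
  linarith [hC.le_rms u v hne, hC.s_le]

lemma Code.word_zero (C : Code n m) : C.word (fun _ => false) = 0 := by
  ext j
  simp [Code.word, C.enc_zero]

lemma rms_block_le (x : Point m) (r : Fin 4) : rms (block x r) ≤ 2 * rms x := rms_fiber_le x r

lemma block_sub (x y : Point m) (r : Fin 4) : block (x - y) r = block x r - block y r := rfl

lemma block_pointAt (C : Code n m) (e : Segment n) (a : ℝ) (r : Fin 4) :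
    block (C.pointAt e a) r = a • block (C.tgt e) r + (1 - a) • block (C.src e) r := rfl

lemma convex_comb_self (a : ℝ) (y : Fin m → ℝ) : a • y + (1 - a) • y = y := by
  rw [← add_smul, add_sub_cancel, one_smul]

lemma block_pointAt_vertex₀ {e : Segment n} {v : Vertex n} (h : e.vertex₀ = some v) (a : ℝ) :
    block (C.pointAt e a) 0 = C.word v := by
  rw [block_pointAt]
  cases e with
  | first =>
    simp only [Segment.vertex₀, Option.some.injEq] at h
    subst h
    rw [C.word_zero]
    have h₁ : block (C.tgt (.first : Segment n)) 0 = 0 := rfl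
    have h₂ : block (C.src (.first : Segment n)) 0 = 0 := rfl
    rw [h₁, h₂, convex_comb_self]
  | edge u w k =>
    fin_cases k <;> simp only [Segment.vertex₀, Option.some.injEq, reduceCtorEq] at h <;>
      subst h <;> exact convex_comb_self a _

lemma block_pointAt_vertex₁ {e : Segment n} {v : Vertex n} (h : e.vertex₁ = some v) (a : ℝ) :
    block (C.pointAt e a) 1 = C.word v := by
  rw [block_pointAt]
  cases e with
  | first =>
    simp only [Segment.vertex₁, Option.some.injEq] at h
    subst h
    rw [C.word_zero]
    have h₁ : block (C.tgt (.first : Segment n)) 1 = 0 := rfl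
    have h₂ : block (C.src (.first : Segment n)) 1 = 0 := rfl
    rw [h₁, h₂, convex_comb_self]
  | edge u w k =>
    fin_cases k <;> simp only [Segment.vertex₁, Option.some.injEq, reduceCtorEq] at h <;>
      subst h <;> exact convex_comb_self a _

lemma block_pointAt_bit₂ {e : Segment n} {b : Bool} (h : e.bit₂ = some b) (a : ℝ) :
    block (C.pointAt e a) 2 = fun _ => if b then 1 else 0 := by
  rw [block_pointAt]
  cases e with
  | first =>
    simp only [Segment.bit₂, Option.some.injEq] at h
    subst h
    exact convex_comb_self a _
  | edge u w k =>
    fin_cases k <;> simp only [Segment.bit₂, Option.some.injEq, reduceCtorEq] at h <;> subst h <;>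
      exact convex_comb_self a _

lemma block_pointAt_three {e : Segment n} (h : e ≠ .first) (a : ℝ) :
    block (C.pointAt e a) 3 = 0 := by
  rw [block_pointAt]
  cases e with
  | first => exact absurd rfl h
  | edge u w k => fin_cases k <;> exact convex_comb_self a _

/-- Segments that come close to each other are equal or adjacent. -/
lemma Code.Separated.eq_or_linked (hC : C.Separated q s) {e e' : Segment n} (he : G.IsSegment e)
    (he' : G.IsSegment e') {a b : ℝ} (h : rms (C.pointAt e a - C.pointAt e' b) ≤ 4 * s) :
    e = e' ∨ Linked G e e' ∨ Linked G e' e := by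
  have hs := hC.s_pos
  have hb : ∀ r, rms (block (C.pointAt e a) r - block (C.pointAt e' b) r) ≤ 8 * s := fun r => by
    rw [← block_sub]
    exact (rms_block_le _ r).trans (by linarith)
  refine eq_or_linked_of_compatible he he' (fun u v hu hv => ?_) (fun u v hu hv => ?_)
    (fun β β' hβ hβ' => ?_)
  · have := hb 0
    rw [block_pointAt_vertex₀ hu, block_pointAt_vertex₀ hv] at this
    exact hC.eq_of_rms_lt (by linarith)
  · have := hb 1
    rw [block_pointAt_vertex₁ hu, block_pointAt_vertex₁ hv] at this
    exact hC.eq_of_rms_lt (by linarith)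
  · have := hb 2
    rw [block_pointAt_bit₂ hβ, block_pointAt_bit₂ hβ'] at this
    have hn : Nonempty (Fin m) := ⟨⟨0, hC.m_pos⟩⟩
    have hs1 := hC.s_le_one
    by_contra hne
    have h1 : rms ((fun _ : Fin m => if β then (1 : ℝ) else 0) - fun _ => if β' then 1 else 0)
        = 1 := by
      have : ((fun _ : Fin m => if β then (1 : ℝ) else 0) - fun _ => if β' then 1 else 0)
          = fun _ => (if β then (1 : ℝ) else 0) - if β' then 1 else 0 := rfl
      rw [this, rms_const]
      cases β <;> cases β' <;> simp_all
    linarith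

/-- The block along which a segment runs. -/
def Segment.axis : Segment n → Fin 4
  | .first => 3
  | .edge _ _ 0 => 1
  | .edge _ _ 1 => 2
  | .edge _ _ 2 => 0
  | .edge _ _ 3 => 2

lemma block_tgt_sub_src_of_ne {e : Segment n} {r : Fin 4} (h : r ≠ e.axis) :
    block (C.tgt e - C.src e) r = 0 := by
  rw [block_sub, sub_eq_zero]
  cases e with
  | first => fin_cases r <;> first | rfl | exact absurd rfl h
  | edge u v k => fin_cases k <;> fin_cases r <;> first | rfl | exact absurd rfl h

lemma avgDot_eq_of_block_eq_zero {x : Point m} {r : Fin 4} (h : ∀ r', r' ≠ r → block x r' = 0)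
    (y : Point m) : avgDot x y = avgDot (block x r) (block y r) / 4 := by
  rw [avgDot_fin_four, Finset.sum_eq_single r]
  · rfl
  · intro r' _ hr'
    have : (fun j => x (r', j)) = 0 := h r' hr'
    rw [this]
    simp [avgDot]
  · simp

lemma rms_sq_eq_of_block_eq_zero {x : Point m} {r : Fin 4} (h : ∀ r', r' ≠ r → block x r' = 0) :
    rms x ^ 2 = rms (block x r) ^ 2 / 4 := by
  rw [rms_sq, avgDot_eq_of_block_eq_zero h, rms_sq]

lemma Linked.axis_ne {e e' : Segment n} (h : Linked G e e') : e'.axis ≠ e.axis := by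
  have h := h.2.2
  cases e with
  | first =>
    cases e' with
    | first => simp [Segment.startOf] at h
    | edge u v k =>
      fin_cases k <;> simp [Segment.startOf, Segment.endOf, Segment.axis] at h ⊢
  | edge u v k =>
    cases e' with
    | first => simp [Segment.startOf] at h
    | edge u' v' k' =>
      fin_cases k <;> fin_cases k' <;> simp [Segment.startOf, Segment.endOf, Segment.axis] at h ⊢

/-- Consecutive segments are orthogonal. -/
lemma Linked.avgDot_eq_zero {e e' : Segment n} (h : Linked G e e') (C : Code n m) :
    avgDot (C.tgt e - C.src e) (C.tgt e' - C.src e') = 0 := by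
  rw [avgDot_eq_of_block_eq_zero fun r hr => block_tgt_sub_src_of_ne hr,
    block_tgt_sub_src_of_ne h.axis_ne.symm]
  simp [avgDot]

lemma Linked.tgt_eq_src {e e' : Segment n} (h : Linked G e e') (C : Code n m) :
    C.tgt e = C.src e' := by
  obtain ⟨he, he', h⟩ := h
  have hp := G.succ_iff_pred
  cases e with
  | first =>
    cases e' with
    | first => simp [Segment.startOf] at h
    | edge u v k =>
      fin_cases k <;> simp [Segment.startOf, Segment.endOf] at h
      subst h
      ext ⟨r, j⟩
      have := congrFun C.word_zero j
      fin_cases r <;> simp [Code.tgt, Code.src, Code.brouwerVertex, blocks, this]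
  | edge u v k =>
    cases e' with
    | first => simp [Segment.startOf] at h
    | edge u' v' k' =>
      fin_cases k <;> fin_cases k' <;> simp [Segment.startOf, Segment.endOf] at h <;>
        simp only [EoLGraph.IsSegment] at he he' <;> subst h <;>
        first
        | rfl
        | obtain rfl : v = v' := by grind
          rfl
        | obtain rfl : u = u' := by grind
          rfl

lemma Code.Separated.le_rms_tgt_sub_src (hC : C.Separated q s) {e : Segment n}
    (he : G.IsSegment e) : q / 2 ≤ rms (C.tgt e - C.src e) := by
  have hn : Nonempty (Fin m) := ⟨⟨0, hC.m_pos⟩⟩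
  have hq := hC.q_le
  have hq0 : 0 ≤ q := by linarith [hC.s_le, hC.s_pos]
  have key : q ≤ rms (block (C.tgt e - C.src e) e.axis) := by
    cases e with
    | first =>
      have : block (C.tgt (.first : Segment n) - C.src .first) (Segment.axis (.first : Segment n))
          = fun _ => (-2 : ℝ) := by
        ext j
        simp [block, Segment.axis, Code.tgt, Code.src, blocks]
      rw [this, rms_const]
      norm_num
      linarith
    | edge u v k =>
      have huv : u ≠ v := by
        rintro rfl
        exact G.no_loop u he
      fin_cases k
      · exact hC.le_rms v u huv.symm
      · have : block (C.tgt (.edge u v 1) - C.src (.edge u v 1)) 2 = fun _ => (1 : ℝ) := by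
          ext j
          simp [block, Code.tgt, Code.src, Code.brouwerVertex, blocks]
        show q ≤ rms (block (C.tgt (.edge u v 1) - C.src (.edge u v 1)) 2)
        rw [this, rms_const]
        simpa using hq
      · exact hC.le_rms v u huv.symm
      · have : block (C.tgt (.edge u v 3) - C.src (.edge u v 3)) 2 = fun _ => (-1 : ℝ) := by
          ext j
          simp [block, Code.tgt, Code.src, Code.brouwerVertex, blocks]
        show q ≤ rms (block (C.tgt (.edge u v 3) - C.src (.edge u v 3)) 2)
        rw [this, rms_const]
        simpa using hq
  apply le_of_sq_le_sq _ (rms_nonneg _)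
  rw [rms_sq_eq_of_block_eq_zero fun r hr => block_tgt_sub_src_of_ne hr, div_pow]
  have := pow_le_pow_left₀ hq0 key 2
  linarith

lemma Code.rms_tgt_sub_src_le (C : Code n m) (e : Segment n) :
    rms (C.tgt e - C.src e) ≤ 1 := by
  have h : rms (block (C.tgt e - C.src e) e.axis) ≤ 2 :=
    rms_le_of_abs_le zero_le_two fun j => C.abs_tgt_sub_src_le e (e.axis, j)
  apply le_of_sq_le_sq _ zero_le_one
  rw [rms_sq_eq_of_block_eq_zero fun r hr => block_tgt_sub_src_of_ne hr]
  have := pow_le_pow_left₀ (rms_nonneg _) h 2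
  linarith

section Tau

variable {e e' : Segment n}

lemma Code.tau_sub (C : Code n m) (e : Segment n) (x y : Point m) :
    C.tau e x - C.tau e y =
      avgDot (C.tgt e - C.src e) (x - y) / rms (C.tgt e - C.src e) ^ 2 := by
  rw [Code.tau, Code.tau, ← sub_div, ← avgDot_sub_right, sub_sub_sub_cancel_right]

lemma Code.pointAt_sub_src (C : Code n m) (e : Segment n) (a : ℝ) :
    C.pointAt e a - C.src e = a • (C.tgt e - C.src e) := by
  rw [Code.pointAt]
  module

lemma Code.pointAt_zero (C : Code n m) (e : Segment n) : C.pointAt e 0 = C.src e := by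
  simp [Code.pointAt]

lemma Code.pointAt_one (C : Code n m) (e : Segment n) : C.pointAt e 1 = C.tgt e := by
  simp [Code.pointAt]

lemma Code.Separated.rms_pos (hC : C.Separated q s) (he : G.IsSegment e) :
    0 < rms (C.tgt e - C.src e) := by
  linarith [hC.le_rms_tgt_sub_src he, hC.s_le, hC.s_pos]

lemma Code.Separated.tau_pointAt (hC : C.Separated q s) (he : G.IsSegment e) (a : ℝ) :
    C.tau e (C.pointAt e a) = a := by
  have := hC.rms_pos he
  rw [Code.tau, C.pointAt_sub_src, avgDot_smul_right, ← rms_sq, mul_div_assoc, div_self, mul_one]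
  positivity

lemma Linked.tau_pointAt_right (h : Linked G e e') (hC : C.Separated q s) (a : ℝ) :
    C.tau e (C.pointAt e' a) = 1 := by
  rw [← hC.tau_pointAt h.1 1, C.pointAt_one, h.tgt_eq_src C, ← sub_eq_zero, C.tau_sub,
    C.pointAt_sub_src, avgDot_smul_right, h.avgDot_eq_zero C, mul_zero, zero_div]

lemma Linked.tau_pointAt_left (h : Linked G e e') (hC : C.Separated q s) (a : ℝ) :
    C.tau e' (C.pointAt e a) = 0 := by
  have h1 : C.pointAt e a - C.tgt e = (a - 1) • (C.tgt e - C.src e) := by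
    rw [Code.pointAt]
    module
  rw [← hC.tau_pointAt h.2.1 0, C.pointAt_zero, ← h.tgt_eq_src C, ← sub_eq_zero, C.tau_sub,
    h1, avgDot_smul_right, avgDot_comm, h.avgDot_eq_zero C, mul_zero, zero_div]

lemma Code.tau_combination (C : Code n m) (e : Segment n) (a : ℝ) (x y : Point m) :
    C.tau e (a • x + (1 - a) • y) = a * C.tau e x + (1 - a) * C.tau e y := by
  have : a • x + (1 - a) • y - C.src e = a • (x - C.src e) + (1 - a) • (y - C.src e) := by module
  rw [Code.tau, Code.tau, Code.tau, this, avgDot_add_right, avgDot_smul_right, avgDot_smul_right]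
  ring

/-- At distance `3 s ^ 2`, relative positions change by less than `s / 8`. -/
lemma Code.Separated.abs_tau_sub_le (hC : C.Separated q s) (he : G.IsSegment e) {x y : Point m}
    (h : rms (x - y) ≤ 3 * s ^ 2) : |C.tau e x - C.tau e y| ≤ s / 8 := by
  have hL := hC.le_rms_tgt_sub_src he
  have hs := hC.s_pos
  have hsq := hC.s_le
  have hL0 := hC.rms_pos he
  rw [C.tau_sub, abs_div, abs_of_nonneg (sq_nonneg (rms _)), div_le_iff₀ (by positivity)]
  refine (abs_avgDot_le _ _).trans ?_
  have : s / 8 * rms (C.tgt e - C.src e) ≥ 3 * s ^ 2 := by nlinarith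
  nlinarith [mul_le_mul_of_nonneg_left h hL0.le]

lemma Linked.tau_right_le (hl : Linked G e e') (hC : C.Separated q s) {x : Point m} {a : ℝ}
    (h : rms (x - C.pointAt e a) ≤ 3 * s ^ 2) : |C.tau e' x| ≤ s / 8 := by
  have := hC.abs_tau_sub_le hl.2.1 h
  rwa [hl.tau_pointAt_left hC, sub_zero] at this

lemma Linked.le_tau_left (hl : Linked G e e') (hC : C.Separated q s) {x : Point m} {a : ℝ}
    (h : rms (x - C.pointAt e' a) ≤ 3 * s ^ 2) : |C.tau e x - 1| ≤ s / 8 := by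
  have := hC.abs_tau_sub_le hl.1 h
  rwa [hl.tau_pointAt_right hC] at this

/-- The geometric and the combinatorial notion of consecutive segments agree. -/
lemma Code.Separated.linked_iff (hC : C.Separated q s) :
    Linked G e e' ↔ C.Consecutive G e e' := by
  refine ⟨fun h => ⟨h.1, h.2.1, h.tgt_eq_src C⟩, fun ⟨he, he', h⟩ => ?_⟩
  have h' : rms (C.pointAt e 1 - C.pointAt e' 0) ≤ 4 * s := by
    rw [C.pointAt_one, C.pointAt_zero, h, sub_self, rms_zero]
    linarith [hC.s_pos]
  have ht := hC.tau_pointAt he 1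
  rcases hC.eq_or_linked he he' h' with rfl | hl | hl
  · have := hC.tau_pointAt he 0
    rw [C.pointAt_one, h, ← C.pointAt_zero, this] at ht
    norm_num at ht
  · exact hl
  · have := hl.tau_pointAt_left hC 0
    rw [C.pointAt_one, h, ← C.pointAt_zero, this] at ht
    norm_num at ht

lemma Code.Separated.isFinal_iff (hC : C.Separated q s) :
    C.IsFinal G e ↔ G.IsSegment e ∧ ∀ e', ¬ Linked G e e' := by
  simp only [Code.IsFinal, hC.linked_iff, Code.Consecutive]
  grind

lemma Code.Separated.isInitial_iff (hC : C.Separated q s) :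
    C.IsInitial G e ↔ G.IsSegment e ∧ e ≠ .first ∧ ∀ e', ¬ Linked G e' e := by
  simp only [Code.IsInitial, hC.linked_iff, Code.Consecutive]
  grind

end Tau

end Geometry

/-! ### Values of the local terms -/

section Values

variable {n m : ℕ} {C : Code n m} {G : EoLGraph n} {q h : ℝ}

/-- The deviation of the displacement near the line of `e` from the default one, for `δ = 1`. -/
noncomputable def Code.lineVal (C : Code n m) (h : ℝ) (e : Segment n) (x : Point m)
    (i : Fin 4 × Fin m) : ℝ :=
  profileCoord h (rms (x - C.pointAt e (C.tau e x))) (C.dir e i) (C.pointAt e (C.tau e x) i) (x i)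
    (up m i) - up m i

/-- The deviation of the displacement near a corner from the default one, for `δ = 1`. -/
noncomputable def Code.cornerVal (C : Code n m) (h : ℝ) (e e' : Segment n) (x : Point m)
    (i : Fin 4 × Fin m) : ℝ :=
  profileCoord h (rms (x - C.cornerPoint h e e' x))
    (C.psi h e e' x * C.dir e i + (1 - C.psi h e e' x) * C.dir e' i) (C.cornerPoint h e e' x i)
    (x i) (up m i) - up m i

lemma Code.lineDisp_apply (C : Code n m) (hh : 0 < h) (δ : ℝ) (e : Segment n) (x : Point m)
    (i : Fin 4 × Fin m) : C.lineDisp h δ e x i = δ * (up m i + C.lineVal h e x i) := by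
  rw [Code.lineDisp, profile_apply hh, Code.lineVal, add_sub_cancel]

lemma Code.cornerDisp_apply (C : Code n m) (hh : 0 < h) (δ : ℝ) (e e' : Segment n) (x : Point m)
    (i : Fin 4 × Fin m) : C.cornerDisp h δ e e' x i = δ * (up m i + C.cornerVal h e e' x i) := by
  rw [Code.cornerDisp, profile_apply hh, Code.cornerVal, add_sub_cancel]
  rfl

lemma Piece.center_eq (C : Code n m) (p : Piece n) (τ τ' : ℝ) :
    p.center C τ τ' = p.shape.mix τ τ' • C.pointAt p.e (p.shape.pos τ τ') +
      (1 - p.shape.mix τ τ') • C.pointAt p.e' (p.shape.pos' τ τ') := rfl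

lemma Piece.value_eq {p : Piece n} {x z : Point m} {i : Fin 4 × Fin m} {w M : ℝ}
    (hz : p.center C (C.tau p.e x) (C.tau p.e' x) = z)
    (hM : p.shape.mix (C.tau p.e x) (C.tau p.e' x) = M)
    (hw : p.shape.near (C.tau p.e x) (C.tau p.e' x) = w)
    (ht : p.shape.top (C.tau p.e x) (C.tau p.e' x) = 0) :
    p.value C h x i = w * (profileCoord h (rms (x - z)) (M * C.dir p.e i + (1 - M) * C.dir p.e' i)
      (z i) (x i) (up m i) - up m i) := by
  subst hz hM hw
  have : p.value C h x i = p.shape.near (C.tau p.e x) (C.tau p.e' x) *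
    (profileCoord h (rms (x - p.center C (C.tau p.e x) (C.tau p.e' x)))
      (p.shape.mix (C.tau p.e x) (C.tau p.e' x) * C.dir p.e i +
        (1 - p.shape.mix (C.tau p.e x) (C.tau p.e' x)) * C.dir p.e' i)
      (p.center C (C.tau p.e x) (C.tau p.e' x) i) (x i) (up m i) - up m i) +
    p.shape.top (C.tau p.e x) (C.tau p.e' x) *
      (topCoord h (rms (x - p.center C (C.tau p.e x) (C.tau p.e' x)))
      (p.center C (C.tau p.e x) (C.tau p.e' x) i) (x i) (up m i) - up m i) := rfl
  rw [this, ht, zero_mul, add_zero]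

/-- The case in which the point `z` lies on the line of the first of the two segments. -/
lemma Piece.value_eq_lineVal {p : Piece n} {x : Point m} {i : Fin 4 × Fin m} {w : ℝ}
    (hM : p.shape.mix (C.tau p.e x) (C.tau p.e' x) = 1)
    (ha : p.shape.pos (C.tau p.e x) (C.tau p.e' x) = C.tau p.e x)
    (hw : p.shape.near (C.tau p.e x) (C.tau p.e' x) = w)
    (ht : p.shape.top (C.tau p.e x) (C.tau p.e' x) = 0) :
    p.value C h x i = w * C.lineVal h p.e x i := by
  rw [Piece.value_eq (z := C.pointAt p.e (C.tau p.e x)) _ hM hw ht, Code.lineVal]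
  · rw [one_mul, sub_self, zero_mul, add_zero]
  · rw [Piece.center_eq, hM, ha, one_smul, sub_self, zero_smul, add_zero]

/-- The case in which the point `z` lies on the line of the second of the two segments. -/
lemma Piece.value_eq_lineVal' {p : Piece n} {x : Point m} {i : Fin 4 × Fin m} {w : ℝ}
    (hM : p.shape.mix (C.tau p.e x) (C.tau p.e' x) = 0)
    (ha : p.shape.pos' (C.tau p.e x) (C.tau p.e' x) = C.tau p.e' x)
    (hw : p.shape.near (C.tau p.e x) (C.tau p.e' x) = w)
    (ht : p.shape.top (C.tau p.e x) (C.tau p.e' x) = 0) :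
    p.value C h x i = w * C.lineVal h p.e' x i := by
  rw [Piece.value_eq (z := C.pointAt p.e' (C.tau p.e' x)) _ hM hw ht, Code.lineVal]
  · rw [zero_mul, sub_zero, one_mul, zero_add]
  · rw [Piece.center_eq, hM, ha, zero_smul, sub_zero, one_smul, zero_add]

lemma Code.lineVal_eq_zero (hh : 0 < h) {e : Segment n} {x : Point m}
    (hd : ¬ rms (x - C.pointAt e (C.tau e x)) ≤ 3 * h) (i : Fin 4 × Fin m) :
    C.lineVal h e x i = 0 := by
  rw [Code.lineVal, profileCoord_of_le hh (not_le.1 hd).le, sub_self]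

/-- If the relative positions `τ`, `τ'` are close to those of the point that a corner term assigns
to them, with any coefficient `M`, then the two excesses add up to about `s`. -/
lemma le_add_excess {s M τ τ' : ℝ} (hs : 0 < s) (hM₀ : 0 ≤ M) (hM₁ : M ≤ 1)
    (hτ₀ : 0 ≤ τ) (hτ'₁ : τ' ≤ 1)
    (hτ : |τ - (M * max 0 (min (1 - s) τ) + (1 - M))| ≤ s / 8)
    (hτ' : |τ' - (1 - M) * max s (min 1 τ')| ≤ s / 8) :
    s / 2 ≤ max 0 (s - τ') + max 0 (τ - (1 - s)) := by
  rw [abs_le] at hτ hτ'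
  have h₁ : (1 - M) * s - s / 8 ≤ max 0 (τ - (1 - s)) := by
    rcases le_total τ (1 - s) with h | h
    · rw [min_eq_right h, max_eq_right hτ₀] at hτ
      rw [max_eq_left (by linarith)]
      nlinarith
    · rw [max_eq_right (by linarith)]
      rcases le_total 0 (1 - s) with h' | h'
      · rw [min_eq_left h, max_eq_right h'] at hτ
        linarith
      · rw [min_eq_left h, max_eq_left h'] at hτ
        nlinarith
  have h₂ : M * s - s / 8 ≤ max 0 (s - τ') := by
    rcases le_total τ' s with h | h
    · rw [max_eq_left ((min_le_right _ _).trans h)] at hτ'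
      rw [max_eq_right (by linarith)]
      linarith
    · rw [min_eq_right hτ'₁, max_eq_right h] at hτ'
      rw [max_eq_left (by linarith)]
      nlinarith
  linarith

section Corner

variable {e e' : Segment n} {x : Point m}

lemma Code.Separated.sqrt_bounds (hC : C.Separated q √h) (hh : 0 < h) :
    0 < √h ∧ √h ≤ 1 / 100 ∧ h = √h ^ 2 :=
  ⟨hC.s_pos, by linarith [hC.s_le_one], (Real.sq_sqrt hh.le).symm⟩

lemma Linked.cornerShape_excess (hl : Linked G e e') (hC : C.Separated q √h) (hh : 0 < h) {M : ℝ}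
    (hM₀ : 0 ≤ M) (hM₁ : M ≤ 1) (hτ₀ : 0 ≤ C.tau e x) (hτ'₁ : C.tau e' x ≤ 1)
    (hd : rms (x - (M • C.pointAt e (max 0 (min (1 - √h) (C.tau e x))) +
      (1 - M) • C.pointAt e' (max √h (min 1 (C.tau e' x))))) ≤ 3 * h) :
    √h / 2 ≤ max 0 (√h - C.tau e' x) + max 0 (C.tau e x - (1 - √h)) := by
  obtain ⟨hs, hs1, hsq⟩ := hC.sqrt_bounds hh
  have hd' : rms (x - (M • C.pointAt e (max 0 (min (1 - √h) (C.tau e x))) +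
      (1 - M) • C.pointAt e' (max √h (min 1 (C.tau e' x))))) ≤ 3 * √h ^ 2 := by rwa [← hsq]
  have h₁ := hC.abs_tau_sub_le hl.1 hd'
  have h₂ := hC.abs_tau_sub_le hl.2.1 hd'
  rw [C.tau_combination, hC.tau_pointAt hl.1, hl.tau_pointAt_right hC, mul_one] at h₁
  rw [C.tau_combination, hC.tau_pointAt hl.2.1, hl.tau_pointAt_left hC, mul_zero, zero_add] at h₂
  exact le_add_excess hs hM₀ hM₁ hτ₀ hτ'₁ h₁ h₂

lemma cornerShape_value_line (hl : Linked G e e') (hC : C.Separated q √h) (hh : 0 < h)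
    (he : C.NearLine h √h (1 - √h) e x) (i : Fin 4 × Fin m) :
    Piece.value C h ⟨cornerShape √h, e, e'⟩ x i = ramp (C.tau e x) * C.lineVal h e x i := by
  obtain ⟨hs, hs1, hsq⟩ := hC.sqrt_bounds hh
  obtain ⟨h₁, h₂, h₃⟩ := he
  have h₄ := abs_le.1 (hl.tau_right_le hC (x := x) (by rwa [← hsq]))
  refine Piece.value_eq_lineVal (p := ⟨cornerShape √h, e, e'⟩) ?_ ?_ ?_ rfl
  · simp only [cornerShape]
    rw [max_eq_left (a := 0) (b := C.tau e x - _) (by linarith), add_zero,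
      max_eq_right (a := 0) (by linarith), max_eq_left (by linarith), div_self (by linarith)]
  · simp only [cornerShape]
    rw [min_eq_right h₂, max_eq_right (by linarith)]
  · simp only [cornerShape]
    rw [ramp_of_le (τ := C.tau e' x) (by linarith), sub_zero, mul_one]

lemma cornerShape_value_line' (hl : Linked G e e') (hC : C.Separated q √h) (hh : 0 < h)
    (he : C.NearLine h √h (1 - √h) e' x) (i : Fin 4 × Fin m) :
    Piece.value C h ⟨cornerShape √h, e, e'⟩ x i =
      (1 - ramp (C.tau e' x)) * C.lineVal h e' x i := by
  obtain ⟨hs, hs1, hsq⟩ := hC.sqrt_bounds hh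
  obtain ⟨h₁, h₂, h₃⟩ := he
  have h₄ := abs_le.1 (hl.le_tau_left hC (x := x) (by rwa [← hsq]))
  refine Piece.value_eq_lineVal' (p := ⟨cornerShape √h, e, e'⟩) ?_ ?_ ?_ rfl
  · simp only [cornerShape]
    rw [max_eq_left (a := 0) (b := √h - _) (by linarith), zero_div]
  · simp only [cornerShape]
    rw [min_eq_right (by linarith), max_eq_right (by linarith)]
  · simp only [cornerShape]
    rw [ramp_of_ge (τ := C.tau e x) (by linarith), one_mul]

lemma Code.psi_mem (h₁ : 0 ≤ C.deltaIn h e x) (h₂ : 0 ≤ C.deltaOut h e' x) :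
    0 ≤ C.psi h e e' x ∧ C.psi h e e' x ≤ 1 :=
  ⟨div_nonneg h₂ (add_nonneg h₂ h₁), div_le_one_of_le₀ (by linarith) (add_nonneg h₂ h₁)⟩

lemma cornerShape_value_corner (hl : Linked G e e') (hC : C.Separated q √h) (hh : 0 < h)
    (he : C.NearCorner h e e' x) (i : Fin 4 × Fin m) :
    Piece.value C h ⟨cornerShape √h, e, e'⟩ x i = C.cornerVal h e e' x i := by
  obtain ⟨hs, hs1, hsq⟩ := hC.sqrt_bounds hh
  obtain ⟨h₁, h₂, h₃⟩ := he
  obtain ⟨hψ₀, hψ₁⟩ := Code.psi_mem h₁ h₂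
  have h₁' : 1 - √h ≤ C.tau e x := sub_nonneg.1 h₁
  have h₂' : C.tau e' x ≤ √h := sub_nonneg.1 h₂
  have ha : max 0 (min (1 - √h) (C.tau e x)) = 1 - √h := by
    rw [min_eq_left h₁', max_eq_right (by linarith)]
  have hb : max √h (min 1 (C.tau e' x)) = √h := by
    rw [max_eq_left ((min_le_right _ _).trans h₂')]
  have hex := hl.cornerShape_excess hC hh (x := x) hψ₀ hψ₁ (by linarith) (by linarith)
    (by rw [ha, hb]; exact h₃)
  have hm : (cornerShape √h).mix (C.tau e x) (C.tau e' x) = C.psi h e e' x := by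
    simp only [cornerShape]
    rw [max_eq_left hex, max_eq_right (by linarith), max_eq_right (by linarith)]
    rfl
  rw [Piece.value_eq (p := ⟨cornerShape √h, e, e'⟩) (z := C.cornerPoint h e e' x) (w := 1) _ hm
    _ rfl, one_mul]
  · rfl
  · simp only [Piece.center_eq, hm]
    simp only [cornerShape, ha, hb]
    rfl
  · simp only [cornerShape]
    rw [ramp_of_ge (by linarith), ramp_of_le (by linarith)]
    norm_num

lemma lt_of_ramp_ne_zero {τ : ℝ} (h : ramp τ ≠ 0) : 3 / 4 < τ := by
  by_contra h'
  exact h (ramp_of_le (not_lt.1 h'))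

lemma lt_of_one_sub_ramp_ne_zero {τ : ℝ} (h : 1 - ramp τ ≠ 0) : τ < 7 / 8 := by
  by_contra h'
  exact h (by rw [ramp_of_ge (not_lt.1 h'), sub_self])

lemma near_of_cornerShape_value_ne_zero (hl : Linked G e e') (hC : C.Separated q √h) (hh : 0 < h)
    {i : Fin 4 × Fin m} (hv : Piece.value C h ⟨cornerShape √h, e, e'⟩ x i ≠ 0) :
    C.NearLine h √h (1 - √h) e x ∨ C.NearLine h √h (1 - √h) e' x ∨ C.NearCorner h e e' x := by
  obtain ⟨hs, hs1, hsq⟩ := hC.sqrt_bounds hh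
  rw [Piece.value_eq rfl rfl rfl rfl] at hv
  have hτ := lt_of_ramp_ne_zero (left_ne_zero_of_mul (left_ne_zero_of_mul hv))
  have hτ' := lt_of_one_sub_ramp_ne_zero (right_ne_zero_of_mul (left_ne_zero_of_mul hv))
  have hv' := right_ne_zero_of_mul hv
  simp only at hτ hτ' hv'
  have hd : rms (x - Piece.center C ⟨cornerShape √h, e, e'⟩ (C.tau e x) (C.tau e' x)) ≤ 3 * h := by
    by_contra hd
    rw [profileCoord_of_le hh (not_le.1 hd).le, sub_self] at hv'
    exact hv' rfl
  rw [Piece.center_eq] at hd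
  simp only at hd
  set M := (cornerShape √h).mix (C.tau e x) (C.tau e' x) with hM
  have hMdef : M = max 0 (√h - C.tau e' x) /
      max (max 0 (√h - C.tau e' x) + max 0 (C.tau e x - (1 - √h))) (√h / 2) := rfl
  have hA : 0 ≤ max 0 (√h - C.tau e' x) := le_max_left _ _
  have hB : 0 ≤ max 0 (C.tau e x - (1 - √h)) := le_max_left _ _
  have hM₀ : 0 ≤ M := div_nonneg hA (le_max_of_le_left (add_nonneg hA hB))
  have hM₁ : M ≤ 1 := div_le_one_of_le₀ (le_max_of_le_left (by linarith))
    (le_max_of_le_left (add_nonneg hA hB))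
  have hex := hl.cornerShape_excess hC hh (x := x) hM₀ hM₁ (by linarith) (by linarith) hd
  rw [max_eq_left hex] at hMdef
  simp only [cornerShape] at hd
  rcases le_or_gt (C.tau e x) (1 - √h) with h₁ | h₁
  · left
    rw [max_eq_left (a := 0) (b := C.tau e x - _) (by linarith)] at hMdef hex
    rw [add_zero] at hMdef hex
    rw [div_self (by linarith)] at hMdef
    rw [hMdef, min_eq_right h₁, max_eq_right (by linarith), one_smul, sub_self, zero_smul,
      add_zero] at hd
    exact ⟨by linarith, h₁, hd⟩
  rcases le_or_gt √h (C.tau e' x) with h₂ | h₂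
  · right; left
    rw [max_eq_left (a := 0) (b := √h - _) (by linarith), zero_div] at hMdef
    rw [hMdef, min_eq_right (a := 1) (by linarith), max_eq_right h₂, zero_smul, sub_zero, one_smul,
      zero_add] at hd
    exact ⟨h₂, by linarith, hd⟩
  · right; right
    refine ⟨sub_nonneg.2 h₁.le, sub_nonneg.2 h₂.le, ?_⟩
    have hψ : M = C.psi h e e' x := by
      rw [hMdef, max_eq_right (by linarith), max_eq_right (by linarith)]
      rfl
    rw [hψ, min_eq_left h₁.le, max_eq_right (by linarith),
      max_eq_left ((min_le_right _ _).trans h₂.le)] at hd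
    exact hd

end Corner

section Ends

variable {e : Segment n} {x : Point m}

lemma finalShape_value_line (hC : C.Separated q √h) (hh : 0 < h)
    (he : C.NearLine h √h (1 - √h) e x) (i : Fin 4 × Fin m) :
    Piece.value C h ⟨finalShape √h, e, e⟩ x i = ramp (C.tau e x) * C.lineVal h e x i := by
  obtain ⟨hs, hs1, hsq⟩ := hC.sqrt_bounds hh
  obtain ⟨h₁, h₂, h₃⟩ := he
  refine Piece.value_eq_lineVal (p := ⟨finalShape √h, e, e⟩) rfl ?_ ?_ rfl
  · exact unitClamp_of_mem (by linarith) (by linarith)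
  · simp only [finalShape]
    rw [unitClamp_of_one_le (t := (1 - C.tau e x) / √h) (by rw [le_div_iff₀ hs]; linarith), mul_one]

lemma finalShape_value_end (hC : C.Separated q √h) (hh : 0 < h)
    (he : C.NearLine h (1 - √h) 1 e x) (i : Fin 4 × Fin m) :
    Piece.value C h ⟨finalShape √h, e, e⟩ x i = (1 - C.tau e x) / √h * C.lineVal h e x i := by
  obtain ⟨hs, hs1, hsq⟩ := hC.sqrt_bounds hh
  obtain ⟨h₁, h₂, h₃⟩ := he
  refine Piece.value_eq_lineVal (p := ⟨finalShape √h, e, e⟩) rfl ?_ ?_ rfl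
  · exact unitClamp_of_mem (by linarith) (by linarith)
  · simp only [finalShape]
    rw [unitClamp_of_mem (t := (1 - C.tau e x) / √h) (div_nonneg (by linarith) hs.le)
      (by rw [div_le_one hs]; linarith), ramp_of_ge (by linarith), one_mul]

lemma near_of_finalShape_value_ne_zero (hC : C.Separated q √h) (hh : 0 < h)
    {i : Fin 4 × Fin m} (hv : Piece.value C h ⟨finalShape √h, e, e⟩ x i ≠ 0) :
    C.NearLine h √h (1 - √h) e x ∨ C.NearLine h (1 - √h) 1 e x := by
  obtain ⟨hs, hs1, hsq⟩ := hC.sqrt_bounds hh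
  have hn : ramp (C.tau e x) * unitClamp ((1 - C.tau e x) / √h) ≠ 0 := by
    rw [Piece.value_eq rfl rfl rfl rfl] at hv
    exact left_ne_zero_of_mul hv
  have hτ := lt_of_ramp_ne_zero (left_ne_zero_of_mul hn)
  have hτ1 : C.tau e x < 1 := by
    by_contra h'
    exact right_ne_zero_of_mul hn
      (unitClamp_of_nonpos (div_nonpos_of_nonpos_of_nonneg (by linarith) hs.le))
  rw [Piece.value_eq_lineVal (p := ⟨finalShape √h, e, e⟩) rfl
    (unitClamp_of_mem (by linarith) hτ1.le) rfl rfl] at hv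
  have hd : rms (x - C.pointAt e (C.tau e x)) ≤ 3 * h := by
    by_contra hd
    exact right_ne_zero_of_mul hv (Code.lineVal_eq_zero hh hd i)
  rcases le_total (C.tau e x) (1 - √h) with h' | h'
  · exact .inl ⟨by linarith, h', hd⟩
  · exact .inr ⟨h', hτ1.le, hd⟩

lemma initialShape_value_line (hC : C.Separated q √h) (hh : 0 < h)
    (he : C.NearLine h √h (1 - √h) e x) (i : Fin 4 × Fin m) :
    Piece.value C h ⟨initialShape √h, e, e⟩ x i = (1 - ramp (C.tau e x)) * C.lineVal h e x i := by
  obtain ⟨hs, hs1, hsq⟩ := hC.sqrt_bounds hh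
  obtain ⟨h₁, h₂, h₃⟩ := he
  refine Piece.value_eq_lineVal' (p := ⟨initialShape √h, e, e⟩) rfl ?_ ?_ rfl
  · exact unitClamp_of_mem (by linarith) (by linarith)
  · simp only [initialShape]
    rw [unitClamp_of_one_le (t := C.tau e x / √h) (by rw [le_div_iff₀ hs]; linarith), mul_one]

lemma initialShape_value_start (hC : C.Separated q √h) (hh : 0 < h)
    (he : C.NearLine h 0 √h e x) (i : Fin 4 × Fin m) :
    Piece.value C h ⟨initialShape √h, e, e⟩ x i = C.tau e x / √h * C.lineVal h e x i := by
  obtain ⟨hs, hs1, hsq⟩ := hC.sqrt_bounds hh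
  obtain ⟨h₁, h₂, h₃⟩ := he
  refine Piece.value_eq_lineVal' (p := ⟨initialShape √h, e, e⟩) rfl ?_ ?_ rfl
  · exact unitClamp_of_mem (by linarith) (by linarith)
  · simp only [initialShape]
    rw [unitClamp_of_mem (t := C.tau e x / √h) (div_nonneg (by linarith) hs.le)
      (by rw [div_le_one hs]; linarith), ramp_of_le (by linarith), sub_zero, one_mul]

lemma near_of_initialShape_value_ne_zero (hC : C.Separated q √h) (hh : 0 < h)
    {i : Fin 4 × Fin m} (hv : Piece.value C h ⟨initialShape √h, e, e⟩ x i ≠ 0) :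
    C.NearLine h √h (1 - √h) e x ∨ C.NearLine h 0 √h e x := by
  obtain ⟨hs, hs1, hsq⟩ := hC.sqrt_bounds hh
  have hn : (1 - ramp (C.tau e x)) * unitClamp (C.tau e x / √h) ≠ 0 := by
    rw [Piece.value_eq rfl rfl rfl rfl] at hv
    exact left_ne_zero_of_mul hv
  have hτ := lt_of_one_sub_ramp_ne_zero (left_ne_zero_of_mul hn)
  have hτ0 : 0 < C.tau e x := by
    by_contra h'
    exact right_ne_zero_of_mul hn
      (unitClamp_of_nonpos (div_nonpos_of_nonpos_of_nonneg (by linarith) hs.le))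
  rw [Piece.value_eq_lineVal' (p := ⟨initialShape √h, e, e⟩) rfl
    (unitClamp_of_mem hτ0.le (by linarith)) rfl rfl] at hv
  have hd : rms (x - C.pointAt e (C.tau e x)) ≤ 3 * h := by
    by_contra hd
    exact right_ne_zero_of_mul hv (Code.lineVal_eq_zero hh hd i)
  rcases le_total √h (C.tau e x) with h' | h'
  · exact .inl ⟨h', by linarith, hd⟩
  · exact .inr ⟨hτ0.le, h', hd⟩

end Ends

end Values

/-! ### The displacement as the sum of the local terms -/

section Identity

variable {n m : ℕ} {C : Code n m} {G : EoLGraph n} {q h : ℝ} {x : Point m}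

/-- The local term at the Brouwer vertex of kind `κ`, computed from the information on a vertex. -/
noncomputable def junctionPiece (s : ℝ) (κ : Fin 4)
    (t : Vertex n × Option (Vertex n) × Option (Vertex n)) : Option (Piece n) :=
  match inSeg κ t, outSeg κ t with
  | some e, some e' => some ⟨cornerShape s, e, e'⟩
  | some e, none => some ⟨finalShape s, e, e⟩
  | none, some e => some ⟨initialShape s, e, e⟩
  | none, none => none

/-- Which of the two vertices known to the algorithm the Brouwer vertices of kind `κ` belong to. -/
def slot : Fin 4 → Fin 2 := ![0, 0, 1, 1]

/-- All local terms of which an algorithm with the given information knows; `none` stands for the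
term of the upper half of the cube. -/
noncomputable def pieces (s : ℝ) (info : Fin 2 → VertexInfo n) : Option (Fin 4) → Option (Piece n)
  | none => some ⟨topShape, .first, .first⟩
  | some κ => (info (slot κ)).bind (junctionPiece s κ)

/-- The parts of the neighbourhood of the path that contribute to the term of the Brouwer vertex
with a given name. -/
inductive Region (C : Code n m) (G : EoLGraph n) (h : ℝ) (x : Point m) :
    Fin 4 × Vertex n → Prop
  | lineIn (e : Segment n) : G.IsSegment e → C.NearLine h √h (1 - √h) e x →
      Region C G h x e.endOf
  | lineOut (e : Segment n) (k : Fin 4 × Vertex n) : G.IsSegment e → e.startOf = some k →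
      C.NearLine h √h (1 - √h) e x → Region C G h x k
  | corner (e e' : Segment n) : Linked G e e' → C.NearCorner h e e' x → Region C G h x e.endOf
  | final (e : Segment n) : C.IsFinal G e → C.NearLine h (1 - √h) 1 e x → Region C G h x e.endOf
  | initial (e : Segment n) (k : Fin 4 × Vertex n) : C.IsInitial G e → e.startOf = some k →
      C.NearLine h 0 √h e x → Region C G h x k

/-- The term of a Brouwer vertex, computed from correct information. -/
noncomputable def junctionValue (C : Code n m) (G : EoLGraph n) (h : ℝ) (x : Point m)
    (i : Fin 4 × Fin m) (k : Fin 4 × Vertex n) : ℝ :=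
  (junctionPiece √h k.1 (G.known k.2)).elim 0 fun p => p.value C h x i

lemma junctionPiece_of_linked {e e' : Segment n} (hl : Linked G e e') (s : ℝ) :
    junctionPiece s e.endOf.1 (G.known e.endOf.2) = some ⟨cornerShape s, e, e'⟩ := by
  have h₁ : inSeg e.endOf.1 (G.known e.endOf.2) = some e := inSeg_eq_some.2 ⟨hl.1, rfl⟩
  have h₂ : outSeg e.endOf.1 (G.known e.endOf.2) = some e' := outSeg_eq_some.2 ⟨hl.2.1, hl.2.2⟩
  rw [junctionPiece, h₁, h₂]

lemma junctionPiece_of_final {e : Segment n} (he : G.IsSegment e) (hl : ∀ e', ¬ Linked G e e')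
    (s : ℝ) : junctionPiece s e.endOf.1 (G.known e.endOf.2) = some ⟨finalShape s, e, e⟩ := by
  have h₁ : inSeg e.endOf.1 (G.known e.endOf.2) = some e := inSeg_eq_some.2 ⟨he, rfl⟩
  have h₂ : outSeg e.endOf.1 (G.known e.endOf.2) = none := by
    rw [Option.eq_none_iff_forall_ne_some]
    intro e' he'
    obtain ⟨h₃, h₄⟩ := outSeg_eq_some.1 he'
    exact hl e' ⟨he, h₃, h₄⟩
  rw [junctionPiece, h₁, h₂]

lemma junctionPiece_of_initial {e : Segment n} (he : G.IsSegment e) (hl : ∀ e', ¬ Linked G e' e)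
    {k : Fin 4 × Vertex n} (hk : e.startOf = some k) (s : ℝ) :
    junctionPiece s k.1 (G.known k.2) = some ⟨initialShape s, e, e⟩ := by
  have h₁ : outSeg k.1 (G.known k.2) = some e := outSeg_eq_some.2 ⟨he, hk⟩
  have h₂ : inSeg k.1 (G.known k.2) = none := by
    rw [Option.eq_none_iff_forall_ne_some]
    intro e' he'
    obtain ⟨h₃, h₄⟩ := inSeg_eq_some.1 he'
    exact hl e' ⟨h₃, he, by rw [hk, h₄]⟩
  rw [junctionPiece, h₁, h₂]

lemma junctionValue_lineIn (hC : C.Separated q √h) (hh : 0 < h) {e : Segment n}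
    (he : G.IsSegment e) (hx : C.NearLine h √h (1 - √h) e x) (i : Fin 4 × Fin m) :
    junctionValue C G h x i e.endOf = ramp (C.tau e x) * C.lineVal h e x i := by
  by_cases hl : ∃ e', Linked G e e'
  · obtain ⟨e', hl⟩ := hl
    rw [junctionValue, junctionPiece_of_linked hl]
    exact cornerShape_value_line hl hC hh hx i
  · push Not at hl
    rw [junctionValue, junctionPiece_of_final he hl]
    exact finalShape_value_line hC hh hx i

lemma junctionValue_lineOut (hC : C.Separated q √h) (hh : 0 < h) {e : Segment n}
    (he : G.IsSegment e) {k : Fin 4 × Vertex n} (hk : e.startOf = some k)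
    (hx : C.NearLine h √h (1 - √h) e x) (i : Fin 4 × Fin m) :
    junctionValue C G h x i k = (1 - ramp (C.tau e x)) * C.lineVal h e x i := by
  by_cases hl : ∃ e', Linked G e' e
  · obtain ⟨e', hl⟩ := hl
    obtain rfl : e'.endOf = k := Option.some_injective _ (hl.2.2.symm.trans hk)
    rw [junctionValue, junctionPiece_of_linked hl]
    exact cornerShape_value_line' hl hC hh hx i
  · push Not at hl
    rw [junctionValue, junctionPiece_of_initial he hl hk]
    exact initialShape_value_line hC hh hx i

lemma junctionValue_corner (hC : C.Separated q √h) (hh : 0 < h) {e e' : Segment n}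
    (hl : Linked G e e') (hx : C.NearCorner h e e' x) (i : Fin 4 × Fin m) :
    junctionValue C G h x i e.endOf = C.cornerVal h e e' x i := by
  rw [junctionValue, junctionPiece_of_linked hl]
  exact cornerShape_value_corner hl hC hh hx i

lemma junctionValue_final (hC : C.Separated q √h) (hh : 0 < h) {e : Segment n}
    (he : C.IsFinal G e) (hx : C.NearLine h (1 - √h) 1 e x) (i : Fin 4 × Fin m) :
    junctionValue C G h x i e.endOf = (1 - C.tau e x) / √h * C.lineVal h e x i := by
  rw [hC.isFinal_iff] at he
  rw [junctionValue, junctionPiece_of_final he.1 he.2]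
  exact finalShape_value_end hC hh hx i

lemma junctionValue_initial (hC : C.Separated q √h) (hh : 0 < h) {e : Segment n}
    (he : C.IsInitial G e) {k : Fin 4 × Vertex n} (hk : e.startOf = some k)
    (hx : C.NearLine h 0 √h e x) (i : Fin 4 × Fin m) :
    junctionValue C G h x i k = C.tau e x / √h * C.lineVal h e x i := by
  rw [hC.isInitial_iff] at he
  rw [junctionValue, junctionPiece_of_initial he.1 he.2.2 hk]
  exact initialShape_value_start hC hh hx i

/-- The weights and hat functions vanish outside the regions: together with the excesses
(`le_add_excess`), a distance of at most `3 h` from `z` decides which region `x` is in. -/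
lemma region_of_junctionValue_ne_zero (hC : C.Separated q √h) (hh : 0 < h) {i : Fin 4 × Fin m}
    {k : Fin 4 × Vertex n} (hv : junctionValue C G h x i k ≠ 0) : Region C G h x k := by
  by_cases h₁ : ∃ e, G.IsSegment e ∧ e.endOf = k
  · obtain ⟨e, he, rfl⟩ := h₁
    by_cases hl : ∃ e', Linked G e e'
    · obtain ⟨e', hl⟩ := hl
      rw [junctionValue, junctionPiece_of_linked hl] at hv
      rcases near_of_cornerShape_value_ne_zero hl hC hh hv with hx | hx | hx
      · exact .lineIn e he hx
      · exact .lineOut e' _ hl.2.1 hl.2.2 hx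
      · exact .corner e e' hl hx
    · push Not at hl
      rw [junctionValue, junctionPiece_of_final he hl] at hv
      rcases near_of_finalShape_value_ne_zero hC hh hv with hx | hx
      · exact .lineIn e he hx
      · exact .final e (hC.isFinal_iff.2 ⟨he, hl⟩) hx
  · have hin : inSeg k.1 (G.known k.2) = none := by
      rw [Option.eq_none_iff_forall_ne_some]
      exact fun e' he' => h₁ ⟨e', inSeg_eq_some.1 he'⟩
    by_cases h₂ : ∃ e, G.IsSegment e ∧ e.startOf = some k
    · obtain ⟨e, he, hk⟩ := h₂
      have hl : ∀ e', ¬ Linked G e' e := fun e' hl =>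
        h₁ ⟨e', hl.1, Option.some_injective _ (hl.2.2.symm.trans hk)⟩
      have hf : e ≠ .first := by
        rintro rfl
        simp [Segment.startOf] at hk
      rw [junctionValue, junctionPiece_of_initial he hl hk] at hv
      rcases near_of_initialShape_value_ne_zero hC hh hv with hx | hx
      · exact .lineOut e k he hk hx
      · exact .initial e k (hC.isInitial_iff.2 ⟨he, hf, hl⟩) hk hx
    · have hout : outSeg k.1 (G.known k.2) = none := by
        rw [Option.eq_none_iff_forall_ne_some]
        exact fun e' he' => h₂ ⟨e', outSeg_eq_some.1 he'⟩
      rw [junctionValue, junctionPiece, hin, hout] at hv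
      exact absurd rfl hv

/-! ### Disjointness of the regions -/

section Disjoint

variable {e e' p p' : Segment n}

/-- `x` is within `2 s` of the segment. -/
def CloseTo (C : Code n m) (s : ℝ) (e : Segment n) (x : Point m) : Prop :=
  ∃ a, rms (x - C.pointAt e a) ≤ 2 * s

lemma Code.Separated.eq_or_linked_of_closeTo (hC : C.Separated q √h) (he : G.IsSegment e)
    (he' : G.IsSegment e') (hx : CloseTo C √h e x) (hx' : CloseTo C √h e' x) :
    e = e' ∨ Linked G e e' ∨ Linked G e' e := by
  obtain ⟨a, ha⟩ := hx
  obtain ⟨b, hb⟩ := hx'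
  refine hC.eq_or_linked (a := a) (b := b) he he' ?_
  refine (rms_sub_le _ x _).trans ?_
  rw [rms_sub_comm] at ha
  linarith

lemma Code.NearLine.closeTo {a b : ℝ} (hx : C.NearLine h a b e x) (hC : C.Separated q √h)
    (hh : 0 < h) : CloseTo C √h e x := by
  obtain ⟨hs, hs1, hsq⟩ := hC.sqrt_bounds hh
  exact ⟨_, hx.2.2.trans (by nlinarith)⟩

lemma Code.NearCorner.closeTo_left (hx : C.NearCorner h e e' x) (hl : Linked G e e')
    (hC : C.Separated q √h) (hh : 0 < h) : CloseTo C √h e x := by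
  obtain ⟨hs, hs1, hsq⟩ := hC.sqrt_bounds hh
  obtain ⟨hψ₀, hψ₁⟩ := Code.psi_mem hx.1 hx.2.1
  refine ⟨1 - C.psi h e e' x * √h, ?_⟩
  have hz : C.cornerPoint h e e' x - C.pointAt e (1 - C.psi h e e' x * √h) =
      ((1 - C.psi h e e' x) * √h) • (C.tgt e' - C.src e') := by
    simp only [Code.cornerPoint, Code.pointAt, hl.tgt_eq_src C]
    module
  have h₁ := C.rms_tgt_sub_src_le e'
  have h₂ : |(1 - C.psi h e e' x) * √h| ≤ √h := by
    rw [abs_of_nonneg (mul_nonneg (by linarith) hs.le)]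
    nlinarith
  have h₃ : rms (C.cornerPoint h e e' x - C.pointAt e (1 - C.psi h e e' x * √h)) ≤ √h := by
    rw [hz, rms_smul]
    nlinarith [abs_nonneg ((1 - C.psi h e e' x) * √h), rms_nonneg (C.tgt e' - C.src e')]
  exact (rms_sub_le _ _ _).trans ((add_le_add hx.2.2 h₃).trans (by nlinarith))

lemma Code.NearCorner.closeTo_right (hx : C.NearCorner h e e' x) (hl : Linked G e e')
    (hC : C.Separated q √h) (hh : 0 < h) : CloseTo C √h e' x := by
  obtain ⟨hs, hs1, hsq⟩ := hC.sqrt_bounds hh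
  obtain ⟨hψ₀, hψ₁⟩ := Code.psi_mem hx.1 hx.2.1
  refine ⟨(1 - C.psi h e e' x) * √h, ?_⟩
  have hz : C.cornerPoint h e e' x - C.pointAt e' ((1 - C.psi h e e' x) * √h) =
      (-(C.psi h e e' x * √h)) • (C.tgt e - C.src e) := by
    simp only [Code.cornerPoint, Code.pointAt, ← hl.tgt_eq_src C]
    module
  have h₁ := C.rms_tgt_sub_src_le e
  have h₂ : |-(C.psi h e e' x * √h)| ≤ √h := by
    rw [abs_neg, abs_of_nonneg (mul_nonneg (by linarith) hs.le)]
    nlinarith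
  have h₃ : rms (C.cornerPoint h e e' x - C.pointAt e' ((1 - C.psi h e e' x) * √h)) ≤ √h := by
    rw [hz, rms_smul]
    nlinarith [abs_nonneg (-(C.psi h e e' x * √h)), rms_nonneg (C.tgt e - C.src e)]
  exact (rms_sub_le _ _ _).trans ((add_le_add hx.2.2 h₃).trans (by nlinarith))

/-- Near a segment, at distance at most `3 h`, the relative position with respect to the next one is
almost `0`. -/
lemma Linked.tau_right_lt (hl : Linked G e e') {a b : ℝ} (hx : C.NearLine h a b e x)
    (hC : C.Separated q √h) (hh : 0 < h) : C.tau e' x < √h := by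
  obtain ⟨hs, hs1, hsq⟩ := hC.sqrt_bounds hh
  have := abs_le.1 (hl.tau_right_le hC (x := x) (by rw [← hsq]; exact hx.2.2))
  linarith

/-- Near a segment, at distance at most `3 h`, the relative position with respect to the previous
one is almost `1`. -/
lemma Linked.lt_tau_left (hl : Linked G e' e) {a b : ℝ} (hx : C.NearLine h a b e x)
    (hC : C.Separated q √h) (hh : 0 < h) : 1 - √h < C.tau e' x := by
  obtain ⟨hs, hs1, hsq⟩ := hC.sqrt_bounds hh
  have := abs_le.1 (hl.le_tau_left hC (x := x) (by rw [← hsq]; exact hx.2.2))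
  linarith

variable (hC : C.Separated q √h) (hh : 0 < h)

include hC hh

lemma eq_of_nearLine_of_nearLine (he : G.IsSegment e) (he' : G.IsSegment e')
    (hx : C.NearLine h √h (1 - √h) e x) (hx' : C.NearLine h √h (1 - √h) e' x) : e = e' := by
  rcases hC.eq_or_linked_of_closeTo he he' (hx.closeTo hC hh) (hx'.closeTo hC hh) with h₁ | hl | hl
  · exact h₁
  · linarith [hl.tau_right_lt hx hC hh, hx'.1]
  · linarith [hl.tau_right_lt hx' hC hh, hx.1]

lemma eq_or_eq_of_nearLine_of_nearCorner (he : G.IsSegment e) (hp : Linked G p p')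
    (hx : C.NearLine h √h (1 - √h) e x) (hx' : C.NearCorner h p p' x) : e = p ∨ e = p' := by
  have hs := (hC.sqrt_bounds hh).2.1
  rcases hC.eq_or_linked_of_closeTo he hp.1 (hx.closeTo hC hh) (hx'.closeTo_left hp hC hh) with
    h₁ | hl | hl
  · exact .inl h₁
  · have := hx'.1
    rw [Code.deltaIn] at this
    linarith [hl.tau_right_lt hx hC hh]
  · exact .inr (hl.right_unique hp)

lemma eq_of_nearLine_of_final (he : G.IsSegment e) (hp : C.IsFinal G p)
    (hx : C.NearLine h √h (1 - √h) e x) (hx' : C.NearLine h (1 - √h) 1 p x) : e = p := by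
  have hs := (hC.sqrt_bounds hh).2.1
  rw [hC.isFinal_iff] at hp
  rcases hC.eq_or_linked_of_closeTo he hp.1 (hx.closeTo hC hh) (hx'.closeTo hC hh) with h₁ | hl | hl
  · exact h₁
  · linarith [hl.tau_right_lt hx hC hh, hx'.1]
  · exact absurd hl (hp.2 e)

lemma eq_of_nearLine_of_initial (he : G.IsSegment e) (hp : C.IsInitial G p)
    (hx : C.NearLine h √h (1 - √h) e x) (hx' : C.NearLine h 0 √h p x) : e = p := by
  have hs := (hC.sqrt_bounds hh).2.1
  rw [hC.isInitial_iff] at hp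
  rcases hC.eq_or_linked_of_closeTo he hp.1 (hx.closeTo hC hh) (hx'.closeTo hC hh) with h₁ | hl | hl
  · exact h₁
  · exact absurd hl (hp.2.2 e)
  · linarith [hl.lt_tau_left hx hC hh, hx'.2.1]

lemma eq_of_nearCorner_of_nearCorner (hl : Linked G e e') (hp : Linked G p p')
    (hx : C.NearCorner h e e' x) (hx' : C.NearCorner h p p' x) : e = p := by
  have hs := (hC.sqrt_bounds hh).2.1
  have h₁ := hx.1
  have h₂ := hx.2.1
  have h₃ := hx'.1
  have h₄ := hx'.2.1
  rw [Code.deltaIn] at h₁ h₃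
  rw [Code.deltaOut] at h₂ h₄
  rcases hC.eq_or_linked_of_closeTo hl.1 hp.1 (hx.closeTo_left hl hC hh)
    (hx'.closeTo_left hp hC hh) with h₁ | hl' | hl'
  · exact h₁
  · obtain rfl := hl.right_unique hl'
    linarith
  · obtain rfl := hp.right_unique hl'
    linarith

lemma not_nearCorner_of_final (hl : Linked G e e') (hp : C.IsFinal G p)
    (hx : C.NearCorner h e e' x) (hx' : C.NearLine h (1 - √h) 1 p x) : False := by
  have hs := (hC.sqrt_bounds hh).2.1
  rw [hC.isFinal_iff] at hp
  have h₂ := hx.2.1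
  rw [Code.deltaOut] at h₂
  rcases hC.eq_or_linked_of_closeTo hl.1 hp.1 (hx.closeTo_left hl hC hh)
    (hx'.closeTo hC hh) with rfl | hl' | hl'
  · exact hp.2 e' hl
  · obtain rfl := hl.right_unique hl'
    linarith [hx'.1]
  · exact hp.2 e hl'

lemma not_nearCorner_of_initial (hl : Linked G e e') (hp : C.IsInitial G p)
    (hx : C.NearCorner h e e' x) (hx' : C.NearLine h 0 √h p x) : False := by
  have hs := (hC.sqrt_bounds hh).2.1
  rw [hC.isInitial_iff] at hp
  have h₁ := hx.1
  rw [Code.deltaIn] at h₁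
  rcases hC.eq_or_linked_of_closeTo hl.2.1 hp.1 (hx.closeTo_right hl hC hh)
    (hx'.closeTo hC hh) with rfl | hl' | hl'
  · exact hp.2.2 e hl
  · exact hp.2.2 e' hl'
  · obtain rfl := hl.left_unique hl'
    linarith [hx'.2.1]

lemma eq_of_final_of_final (he : C.IsFinal G e) (hp : C.IsFinal G p)
    (hx : C.NearLine h (1 - √h) 1 e x) (hx' : C.NearLine h (1 - √h) 1 p x) : e = p := by
  rw [hC.isFinal_iff] at he hp
  rcases hC.eq_or_linked_of_closeTo he.1 hp.1 (hx.closeTo hC hh) (hx'.closeTo hC hh) with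
    h₁ | hl | hl
  · exact h₁
  · exact absurd hl (he.2 p)
  · exact absurd hl (hp.2 e)

lemma eq_of_initial_of_initial (he : C.IsInitial G e) (hp : C.IsInitial G p)
    (hx : C.NearLine h 0 √h e x) (hx' : C.NearLine h 0 √h p x) : e = p := by
  rw [hC.isInitial_iff] at he hp
  rcases hC.eq_or_linked_of_closeTo he.1 hp.1 (hx.closeTo hC hh) (hx'.closeTo hC hh) with
    h₁ | hl | hl
  · exact h₁
  · exact absurd hl (hp.2.2 e)
  · exact absurd hl (he.2.2 p)

lemma not_final_of_initial (he : C.IsFinal G e) (hp : C.IsInitial G p)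
    (hx : C.NearLine h (1 - √h) 1 e x) (hx' : C.NearLine h 0 √h p x) : False := by
  have hs := (hC.sqrt_bounds hh).2.1
  rw [hC.isFinal_iff] at he
  rw [hC.isInitial_iff] at hp
  rcases hC.eq_or_linked_of_closeTo he.1 hp.1 (hx.closeTo hC hh) (hx'.closeTo hC hh) with
    rfl | hl | hl
  · linarith [hx.1, hx'.2.1]
  · exact he.2 p hl
  · linarith [hl.tau_right_lt hx' hC hh, hx.1]

end Disjoint

end Identity

/-! ### Information suffices to find the terms that do not vanish -/

section Keys

variable {n m : ℕ} {C : Code n m} {G : EoLGraph n} {q h : ℝ} {x : Point m}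

/-- The block of a point that a slot refers to. -/
def slotBlock (r : Fin 2) : Fin 4 := r.castLE (by norm_num)

lemma block_pointAt_endOf (C : Code n m) (e : Segment n) (a : ℝ) :
    block (C.pointAt e a) (slotBlock (slot e.endOf.1)) = C.word e.endOf.2 := by
  cases e with
  | first => exact block_pointAt_vertex₀ rfl a
  | edge u v k =>
    fin_cases k
    exacts [block_pointAt_vertex₀ rfl a, block_pointAt_vertex₁ rfl a, block_pointAt_vertex₁ rfl a,
      block_pointAt_vertex₀ rfl a]

lemma block_pointAt_startOf (C : Code n m) {e : Segment n} {k : Fin 4 × Vertex n}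
    (hk : e.startOf = some k) (a : ℝ) :
    block (C.pointAt e a) (slotBlock (slot k.1)) = C.word k.2 := by
  cases e with
  | first => simp [Segment.startOf] at hk
  | edge u v κ =>
    fin_cases κ <;> simp only [Segment.startOf, Option.some.injEq] at hk <;> subst hk
    exacts [block_pointAt_vertex₀ rfl a, block_pointAt_vertex₀ rfl a, block_pointAt_vertex₁ rfl a,
      block_pointAt_vertex₁ rfl a]

/-- A block that is very close to the codeword of a vertex has to come with the information on this
vertex. -/
lemma Code.Separated.info_eq (hC : C.Separated q √h) (hh : 0 < h) {y : Fin m → ℝ}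
    {info : VertexInfo n} (ha : C.Admissible G h y info) {v : Vertex n}
    (hv : rms (y - C.word v) ≤ 6 * h) : info = some (G.known v) := by
  obtain ⟨hs, hs1, hsq⟩ := hC.sqrt_bounds hh
  have h6 : 6 * h < 8 * √h := by nlinarith
  rcases ha with ⟨-, hfar⟩ | ⟨w, hw, -, hnear⟩
  · linarith [hfar v]
  · have : v = w := by
      apply hC.eq_of_rms_lt
      have := rms_sub_le (C.word v) y (C.word w)
      rw [rms_sub_comm (C.word v) y] at this
      linarith [hnear v]
    rw [hw, this]
    rfl

lemma Region.info_eq (hC : C.Separated q √h) (hh : 0 < h) {info : Fin 2 → VertexInfo n}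
    (ha : ∀ r, C.Admissible G h (block x (slotBlock r)) (info r)) {k : Fin 4 × Vertex n}
    (hk : Region C G h x k) : info (slot k.1) = some (G.known k.2) := by
  have key : ∀ z : Point m, block z (slotBlock (slot k.1)) = C.word k.2 → rms (x - z) ≤ 3 * h →
      info (slot k.1) = some (G.known k.2) := by
    intro z hz hd
    refine hC.info_eq hh (ha _) ?_
    rw [← hz, ← block_sub]
    exact (rms_block_le _ _).trans (by linarith)
  cases hk with
  | lineIn e he hx => exact key _ (block_pointAt_endOf C e _) hx.2.2
  | lineOut e k he hk hx => exact key _ (block_pointAt_startOf C hk _) hx.2.2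
  | corner e e' hl hx =>
    refine key (C.cornerPoint h e e' x) ?_ hx.2.2
    have : block (C.cornerPoint h e e' x) (slotBlock (slot e.endOf.1)) =
      C.psi h e e' x • block (C.pointAt e (1 - √h)) (slotBlock (slot e.endOf.1)) +
      (1 - C.psi h e e' x) • block (C.pointAt e' √h) (slotBlock (slot e.endOf.1)) := rfl
    rw [this, block_pointAt_endOf, block_pointAt_startOf C hl.2.2, convex_comb_self]
  | final e he hx => exact key _ (block_pointAt_endOf C e _) hx.2.2
  | initial e k he hk hx => exact key _ (block_pointAt_startOf C hk _) hx.2.2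

/-- The value of the term of kind `κ` that an algorithm with the given information knows of. -/
noncomputable def knownValue (C : Code n m) (h : ℝ) (info : Fin 2 → VertexInfo n) (x : Point m)
    (i : Fin 4 × Fin m) (κ : Fin 4) : ℝ :=
  (pieces √h info (some κ)).elim 0 fun p => p.value C h x i

lemma Region.knownValue_eq (hC : C.Separated q √h) (hh : 0 < h) {info : Fin 2 → VertexInfo n}
    (ha : ∀ r, C.Admissible G h (block x (slotBlock r)) (info r)) {k : Fin 4 × Vertex n}
    (hk : Region C G h x k) (i : Fin 4 × Fin m) :
    knownValue C h info x i k.1 = junctionValue C G h x i k := by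
  rw [knownValue, pieces, hk.info_eq hC hh ha, Option.bind_some, junctionValue]

lemma exists_region_of_knownValue_ne_zero (hC : C.Separated q √h) (hh : 0 < h)
    {info : Fin 2 → VertexInfo n}
    (ha : ∀ r, C.Admissible G h (block x (slotBlock r)) (info r)) {i : Fin 4 × Fin m} {κ : Fin 4}
    (hv : knownValue C h info x i κ ≠ 0) : ∃ k, k.1 = κ ∧ Region C G h x k ∧
      knownValue C h info x i κ = junctionValue C G h x i k := by
  rcases ha (slot κ) with ⟨hn, -⟩ | ⟨v, hv', -⟩
  · rw [knownValue, pieces, hn] at hv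
    exact absurd rfl hv
  · have : knownValue C h info x i κ = junctionValue C G h x i (κ, v) := by
      rw [knownValue, pieces, hv', Option.bind_some, junctionValue]
      rfl
    rw [this] at hv
    exact ⟨(κ, v), rfl, region_of_junctionValue_ne_zero hC hh hv, this⟩

/-- If only one Brouwer vertex has a region that contains `x`, then the terms of the others
vanish. -/
lemma sum_knownValue_eq (hC : C.Separated q √h) (hh : 0 < h) {info : Fin 2 → VertexInfo n}
    (ha : ∀ r, C.Admissible G h (block x (slotBlock r)) (info r)) {k : Fin 4 × Vertex n}
    (hk : Region C G h x k) (hu : ∀ k', Region C G h x k' → k' = k) (i : Fin 4 × Fin m) :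
    ∑ κ, knownValue C h info x i κ = junctionValue C G h x i k := by
  rw [Finset.sum_eq_single k.1 _ (by simp), hk.knownValue_eq hC hh ha]
  intro κ _ hκ
  by_contra hv
  obtain ⟨k', rfl, hk', -⟩ := exists_region_of_knownValue_ne_zero hC hh ha hv
  exact hκ (congrArg Prod.fst (hu k' hk'))

/-! ### The height -/

lemma height_eq (hm : 0 < m) (C : Code n m) (x : Point m) :
    height x = 2 * (1 - C.tau .first x) := by
  have hm' : (m : ℝ) ≠ 0 := by positivity
  have hn : Nonempty (Fin m) := ⟨⟨0, hm⟩⟩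
  have h₁ : ∀ r, r ≠ (3 : Fin 4) → block (C.tgt (.first : Segment n) - C.src .first) r = 0 :=
    fun r hr => block_tgt_sub_src_of_ne hr
  have h₂ : block (C.tgt (.first : Segment n) - C.src .first) 3 = fun _ => (-2 : ℝ) := by
    ext j
    simp [block, Code.tgt, Code.src, blocks]
  have h₃ : block (x - C.src (.first : Segment n)) 3 = fun j => x (3, j) - 2 := by
    ext j
    simp [block, Code.src, blocks]
  have h₄ : avgDot (fun _ : Fin m => (-2 : ℝ)) (fun j => x (3, j) - 2) = -2 * height x + 4 := by
    simp only [avgDot, height, ← Finset.mul_sum, Finset.sum_sub_distrib, Finset.sum_const,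
      Finset.card_univ, Fintype.card_fin, nsmul_eq_mul]
    field_simp
    ring
  rw [Code.tau, avgDot_eq_of_block_eq_zero h₁, rms_sq_eq_of_block_eq_zero h₁, h₂, h₃, h₄, rms_const]
  norm_num
  ring

lemma abs_height_le (hm : 0 < m) {z : Point m} (hz : block z 3 = 0) :
    |height x| ≤ 2 * rms (x - z) := by
  have hn : Nonempty (Fin m) := ⟨⟨0, hm⟩⟩
  have h₁ : height x = avgDot (fun _ : Fin m => (1 : ℝ)) (block (x - z) 3) := by
    rw [block_sub, hz, sub_zero, avgDot, height]
    simp [block]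
  rw [h₁]
  refine (abs_avgDot_le _ _).trans ?_
  rw [rms_const, abs_one, one_mul]
  exact rms_block_le _ _

lemma height_lt_of_closeTo (hC : C.Separated q √h) (hh : 0 < h) {e : Segment n} (he : e ≠ .first)
    (hx : CloseTo C √h e x) : height x < 1 / 2 := by
  obtain ⟨hs, hs1, hsq⟩ := hC.sqrt_bounds hh
  obtain ⟨a, ha⟩ := hx
  have := (le_abs_self _).trans
    (abs_height_le hC.m_pos (x := x) (block_pointAt_three (C := C) he a))
  linarith

lemma pointAt_first (hm : 0 < m) (C : Code n m) (x : Point m) :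
    C.pointAt (.first : Segment n) (C.tau .first x) = blocks 0 0 0 (fun _ => height x) := by
  rw [height_eq hm C x]
  ext ⟨r, j⟩
  fin_cases r <;> simp [Code.pointAt, Code.tgt, Code.src, blocks]
  ring

/-! ### The term of the upper half -/

/-- The value of the term of the upper half of the cube. -/
noncomputable def topValue (C : Code n m) (h : ℝ) (x : Point m) (i : Fin 4 × Fin m) : ℝ :=
  Piece.value C h ⟨topShape, .first, .first⟩ x i

lemma topValue_eq (C : Code n m) (h : ℝ) (x : Point m) (i : Fin 4 × Fin m) :
    topValue C h x i = (1 - ramp (C.tau .first x)) *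
      (unitClamp (4 / 3 * C.tau .first x) * C.lineVal h .first x i +
        (1 - unitClamp (4 / 3 * C.tau .first x)) *
          (topCoord h (rms (x - C.pointAt .first (C.tau .first x)))
            (C.pointAt .first (C.tau .first x) i) (x i) (up m i) - up m i)) := by
  have hz : Piece.center C ⟨topShape, .first, .first⟩ (C.tau .first x) (C.tau .first x) =
      C.pointAt .first (C.tau .first x) := by
    rw [Piece.center_eq]
    simp only [topShape]
    rw [one_smul, sub_self, zero_smul, add_zero]
  have hv : topValue C h x i = (1 - ramp (C.tau .first x)) * unitClamp (4 / 3 * C.tau .first x) *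
      (profileCoord h (rms (x - Piece.center C ⟨topShape, .first, .first⟩ (C.tau .first x)
        (C.tau .first x))) (1 * C.dir .first i + (1 - 1) * C.dir .first i)
        (Piece.center C ⟨topShape, .first, .first⟩ (C.tau .first x) (C.tau .first x) i) (x i)
        (up m i) - up m i) +
      (1 - ramp (C.tau .first x)) * (1 - unitClamp (4 / 3 * C.tau .first x)) *
      (topCoord h (rms (x - Piece.center C ⟨topShape, .first, .first⟩ (C.tau .first x)
        (C.tau .first x)))
        (Piece.center C ⟨topShape, .first, .first⟩ (C.tau .first x) (C.tau .first x) i) (x i)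
        (up m i) - up m i) := rfl
  rw [hv, hz, one_mul, sub_self, zero_mul, add_zero, Code.lineVal]
  ring

lemma topValue_of_height_lt (hm : 0 < m) (hx : height x < 1 / 2) (i : Fin 4 × Fin m) :
    topValue C h x i = (1 - ramp (C.tau .first x)) * C.lineVal h .first x i := by
  rw [height_eq hm C x] at hx
  rw [topValue_eq, unitClamp_of_one_le (by linarith), one_mul, sub_self, zero_mul, add_zero]

lemma nearLine_of_topValue_ne_zero (hC : C.Separated q √h) (hh : 0 < h) (hx : height x < 1 / 2)
    {i : Fin 4 × Fin m} (hv : topValue C h x i ≠ 0) : C.NearLine h √h (1 - √h) .first x := by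
  obtain ⟨hs, hs1, hsq⟩ := hC.sqrt_bounds hh
  rw [topValue_of_height_lt hC.m_pos hx] at hv
  have h₁ := lt_of_one_sub_ramp_ne_zero (left_ne_zero_of_mul hv)
  have h₂ : rms (x - C.pointAt .first (C.tau .first x)) ≤ 3 * h := by
    by_contra hd
    exact right_ne_zero_of_mul hv (Code.lineVal_eq_zero hh hd i)
  rw [height_eq hC.m_pos C x] at hx
  exact ⟨by linarith, by linarith, h₂⟩

lemma outsideDisp_apply (hm : 0 < m) (hh : 0 < h) (C : Code n m) (δ : ℝ) (hx : 1 / 2 ≤ height x)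
    (hx2 : height x ≤ 2) (i : Fin 4 × Fin m) :
    outsideDisp h δ x i = δ * (up m i + topValue C h x i) := by
  have hτ := height_eq hm C x
  have h₁ : (2 - height x) / (3 / 2) = unitClamp (4 / 3 * C.tau .first x) := by
    rw [unitClamp_of_mem (by linarith) (by linarith)]
    linarith
  rw [topValue_eq, ramp_of_le (by linarith), outsideDisp, h₁, ← pointAt_first hm C x, Code.lineVal]
  simp only [Pi.add_apply, Pi.smul_apply, smul_eq_mul]
  rw [profile_apply hh, topDisp_apply hh]
  have : C.dir (.first : Segment n) = -up m := rfl
  rw [this]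
  ring

/-! ### The identity -/

section Sum

variable (hC : C.Separated q √h) (hh : 0 < h) {info : Fin 2 → VertexInfo n}
  (ha : ∀ r, C.Admissible G h (block x (slotBlock r)) (info r)) (i : Fin 4 × Fin m)

include hC hh ha

/-- Near the middle part of a segment the two terms of its end points add up to the whole
contribution of the segment; for the first one, the term of the upper half takes the place of that
of the source. -/
lemma topValue_add_sum_of_nearLine (hx : height x < 1 / 2) {e : Segment n} (he : G.IsSegment e)
    (hn : C.NearLine h √h (1 - √h) e x) :
    topValue C h x i + ∑ κ, knownValue C h info x i κ = C.lineVal h e x i := by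
  obtain ⟨hs, hs1, hsq⟩ := hC.sqrt_bounds hh
  have huniq : ∀ k, Region C G h x k → k = e.endOf ∨ e.startOf = some k := by
    intro k hk
    cases hk with
    | lineIn e' he' hx' => exact .inl (by rw [eq_of_nearLine_of_nearLine hC hh he he' hn hx'])
    | lineOut e' k he' hk hx' =>
      exact .inr (by rw [eq_of_nearLine_of_nearLine hC hh he he' hn hx', hk])
    | corner p p' hl hx' =>
      rcases eq_or_eq_of_nearLine_of_nearCorner hC hh he hl hn hx' with rfl | rfl
      · exact .inl rfl
      · exact .inr hl.2.2
    | final p hp hx' => exact .inl (by rw [eq_of_nearLine_of_final hC hh he hp hn hx'])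
    | initial p k hp hk hx' =>
      exact .inr (by rw [eq_of_nearLine_of_initial hC hh he hp hn hx', hk])
  have hend : knownValue C h info x i e.endOf.1 = ramp (C.tau e x) * C.lineVal h e x i := by
    rw [(Region.lineIn e he hn).knownValue_eq hC hh ha, junctionValue_lineIn hC hh he hn]
  rcases hst : e.startOf with _ | k
  · have hf : e = .first := by
      cases e with
      | first => rfl
      | edge u v κ => fin_cases κ <;> simp [Segment.startOf] at hst
    subst hf
    rw [Finset.sum_eq_single (Segment.endOf (.first : Segment n)).1 _ (by simp), hend,
      topValue_of_height_lt hC.m_pos hx]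
    · ring
    · intro κ _ hκ
      by_contra hv
      obtain ⟨k', rfl, hk', -⟩ := exists_region_of_knownValue_ne_zero hC hh ha hv
      rcases huniq k' hk' with rfl | h'
      · exact hκ rfl
      · simp [Segment.startOf] at h'
  · have htop : topValue C h x i = 0 := by
      by_contra hv
      have := eq_of_nearLine_of_nearLine hC hh he (by trivial) hn
        (nearLine_of_topValue_ne_zero hC hh hx hv)
      rw [this] at hst
      simp [Segment.startOf] at hst
    have hstart : knownValue C h info x i k.1 = (1 - ramp (C.tau e x)) * C.lineVal h e x i := by
      rw [(Region.lineOut e k he hst hn).knownValue_eq hC hh ha,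
        junctionValue_lineOut hC hh he hst hn]
    have hne : e.endOf.1 ≠ k.1 := by
      cases e with
      | first => simp [Segment.startOf] at hst
      | edge u v κ =>
        fin_cases κ <;> simp only [Segment.startOf, Option.some.injEq] at hst <;> subst hst <;>
          simp [Segment.endOf]
    rw [htop, zero_add, Finset.sum_eq_add e.endOf.1 k.1 hne _ (by simp) (by simp), hend, hstart]
    · ring
    · intro κ _ hκ
      by_contra hv
      obtain ⟨k', rfl, hk', -⟩ := exists_region_of_knownValue_ne_zero hC hh ha hv
      rcases huniq k' hk' with rfl | h'
      · exact hκ.1 rfl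
      · rw [hst] at h'
        exact hκ.2 (by rw [Option.some_injective _ h'])

/-- In each case of the definition, disjointness leaves the regions of one Brouwer vertex, the
middle part of one segment, or no region at all. -/
lemma insideDisp_apply (δ : ℝ) (hx : height x < 1 / 2) : C.insideDisp G h δ x i =
    δ * (up m i + (topValue C h x i + ∑ κ, knownValue C h info x i κ)) := by
  have htop : (¬ ∃ e, G.IsSegment e ∧ C.NearLine h √h (1 - √h) e x) → topValue C h x i = 0 := by
    intro h₁
    by_contra hv
    exact h₁ ⟨.first, trivial, nearLine_of_topValue_ne_zero hC hh hx hv⟩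
  rw [Code.insideDisp]
  split_ifs with h₁ h₂ h₃ h₄
  · obtain ⟨he, hn⟩ := h₁.choose_spec
    rw [C.lineDisp_apply hh, topValue_add_sum_of_nearLine hC hh ha i hx he hn]
  · have htop := htop h₁
    obtain ⟨hl, hn⟩ := h₂.choose_spec
    rw [← hC.linked_iff] at hl
    rw [C.cornerDisp_apply hh, htop, zero_add,
      sum_knownValue_eq hC hh ha (.corner _ _ hl hn) ?_ i, junctionValue_corner hC hh hl hn]
    intro k hk
    cases hk with
    | lineIn e he hx' => exact absurd ⟨e, he, hx'⟩ h₁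
    | lineOut e k he hk hx' => exact absurd ⟨e, he, hx'⟩ h₁
    | corner p p' hl' hx' => rw [eq_of_nearCorner_of_nearCorner hC hh hl hl' hn hx']
    | final p hp hx' => exact (not_nearCorner_of_final hC hh hl hp hn hx').elim
    | initial p k hp hk hx' => exact (not_nearCorner_of_initial hC hh hl hp hn hx').elim
  · have htop := htop h₁
    obtain ⟨hf, hn⟩ := h₃.choose_spec
    rw [htop, zero_add, sum_knownValue_eq hC hh ha (.final _ hf hn) ?_ i,
      junctionValue_final hC hh hf hn]
    · simp only [Pi.add_apply, Pi.smul_apply, smul_eq_mul, C.lineDisp_apply hh]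
      ring
    intro k hk
    cases hk with
    | lineIn e he hx' => exact absurd ⟨e, he, hx'⟩ h₁
    | lineOut e k he hk hx' => exact absurd ⟨e, he, hx'⟩ h₁
    | corner p p' hl' hx' => exact absurd ⟨(p, p'), hC.linked_iff.1 hl', hx'⟩ h₂
    | final p hp hx' => rw [eq_of_final_of_final hC hh hf hp hn hx']
    | initial p k hp hk hx' => exact (not_final_of_initial hC hh hf hp hn hx').elim
  · have htop := htop h₁
    obtain ⟨hf, hn⟩ := h₄.choose_spec
    obtain ⟨k₀, hk₀⟩ : ∃ k, h₄.choose.startOf = some k := by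
      generalize h₄.choose = e at hf
      cases e with
      | first => exact absurd rfl hf.2.1
      | edge u v κ => fin_cases κ <;> exact ⟨_, rfl⟩
    rw [htop, zero_add, sum_knownValue_eq hC hh ha (.initial _ k₀ hf hk₀ hn) ?_ i,
      junctionValue_initial hC hh hf hk₀ hn]
    · simp only [Pi.add_apply, Pi.smul_apply, smul_eq_mul, C.lineDisp_apply hh]
      ring
    intro k hk
    cases hk with
    | lineIn e he hx' => exact absurd ⟨e, he, hx'⟩ h₁
    | lineOut e k he hk hx' => exact absurd ⟨e, he, hx'⟩ h₁
    | corner p p' hl' hx' => exact absurd ⟨(p, p'), hC.linked_iff.1 hl', hx'⟩ h₂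
    | final p hp hx' => exact absurd ⟨p, hp, hx'⟩ h₃
    | initial p k hp hk hx' =>
      rw [eq_of_initial_of_initial hC hh hf hp hn hx', hk] at hk₀
      exact Option.some_injective _ hk₀
  · have htop := htop h₁
    have hsum : ∑ κ, knownValue C h info x i κ = 0 := by
      refine Finset.sum_eq_zero fun κ _ => ?_
      by_contra hv
      obtain ⟨k, rfl, hk, -⟩ := exists_region_of_knownValue_ne_zero hC hh ha hv
      cases hk with
      | lineIn e he hx' => exact h₁ ⟨e, he, hx'⟩
      | lineOut e k he hk hx' => exact h₁ ⟨e, he, hx'⟩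
      | corner p p' hl' hx' => exact h₂ ⟨(p, p'), hC.linked_iff.1 hl', hx'⟩
      | final p hp hx' => exact h₃ ⟨p, hp, hx'⟩
      | initial p k hp hk hx' => exact h₄ ⟨p, hp, hx'⟩
    rw [htop, hsum, add_zero, add_zero]
    rfl

lemma sum_knownValue_of_le_height (hx : 1 / 2 ≤ height x) :
    ∑ κ, knownValue C h info x i κ = 0 := by
  obtain ⟨hs, hs1, hsq⟩ := hC.sqrt_bounds hh
  have hτ := height_eq hC.m_pos C x
  refine Finset.sum_eq_zero fun κ _ => ?_
  by_contra hv
  obtain ⟨k, rfl, hk, hkv⟩ := exists_region_of_knownValue_ne_zero hC hh ha hv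
  cases hk with
  | lineIn e he hx' =>
    by_cases hf : e = .first
    · subst hf
      apply hv
      rw [hkv, junctionValue_lineIn hC hh he hx', ramp_of_le (by linarith), zero_mul]
    · linarith [height_lt_of_closeTo hC hh hf (hx'.closeTo hC hh)]
  | lineOut e k he hk hx' =>
    have hf : e ≠ .first := by
      rintro rfl
      simp [Segment.startOf] at hk
    linarith [height_lt_of_closeTo hC hh hf (hx'.closeTo hC hh)]
  | corner p p' hl' hx' =>
    have hf : p' ≠ .first := by
      rintro rfl
      have := hl'.2.2
      simp [Segment.startOf] at this
    linarith [height_lt_of_closeTo hC hh hf (hx'.closeTo_right hl' hC hh)]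
  | final p hp hx' =>
    by_cases hf : p = .first
    · subst hf
      linarith [hx'.1]
    · linarith [height_lt_of_closeTo hC hh hf (hx'.closeTo hC hh)]
  | initial p k hp hk hx' =>
    linarith [height_lt_of_closeTo hC hh hp.2.1 (hx'.closeTo hC hh)]

/-- The displacement is the default one plus the sum of the local terms that an algorithm with
admissible information knows of. -/
lemma disp_apply (δ : ℝ) (hx2 : height x ≤ 2) : C.disp G h δ x i =
    δ * (up m i + ∑ k, (pieces √h info k).elim 0 fun p => p.value C h x i) := by
  have hsum : ∑ k, ((pieces √h info k).elim 0 fun p => p.value C h x i) =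
      topValue C h x i + ∑ κ, knownValue C h info x i κ := by
    rw [Fintype.sum_option]
    rfl
  rw [hsum, Code.disp]
  split_ifs with hx
  · exact insideDisp_apply hC hh ha i δ hx
  · rw [not_lt] at hx
    rw [sum_knownValue_of_le_height hC hh ha i hx, add_zero,
      outsideDisp_apply hC.m_pos hh C δ hx hx2]

end Sum

end Keys

/-! ### The algorithm -/

section Algorithm

variable {n m : ℕ}

/-- The four shapes of local terms. -/
noncomputable def shapes (s : ℝ) : Fin 4 → Shape :=
  ![cornerShape s, finalShape s, initialShape s, topShape]

lemma shapes_tame {s : ℝ} (hs : 0 < s) (j : Fin 4) : (shapes s j).Tame := by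
  fin_cases j
  exacts [cornerShape_tame hs, finalShape_tame s, initialShape_tame s, topShape_tame]

lemma exists_shapes_eq {s : ℝ} {info : Fin 2 → VertexInfo n} {k : Option (Fin 4)} {p : Piece n}
    (hp : pieces s info k = some p) : ∃ j, p.shape = shapes s j := by
  cases k with
  | none =>
    obtain rfl := Option.some_injective _ hp
    exact ⟨3, rfl⟩
  | some κ =>
    obtain ⟨t, -, ht⟩ := Option.bind_eq_some_iff.1 hp
    rw [junctionPiece] at ht
    split at ht
    · obtain rfl := Option.some_injective _ ht
      exact ⟨0, rfl⟩
    · obtain rfl := Option.some_injective _ ht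
      exact ⟨1, rfl⟩
    · obtain rfl := Option.some_injective _ ht
      exact ⟨2, rfl⟩
    · cases ht

/-- Terms computed from correct information refer to segments that are present. -/
lemma isSegment_of_pieces_eq {G : EoLGraph n} {s : ℝ} {info : Fin 2 → VertexInfo n}
    (hinfo : ∀ r, info r = none ∨ ∃ v, info r = some (G.known v)) {k : Option (Fin 4)}
    {p : Piece n} (hp : pieces s info k = some p) : G.IsSegment p.e ∧ G.IsSegment p.e' := by
  cases k with
  | none =>
    obtain rfl := Option.some_injective _ hp
    exact ⟨trivial, trivial⟩
  | some κ =>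
    obtain ⟨t, ht', ht⟩ := Option.bind_eq_some_iff.1 hp
    rcases hinfo (slot κ) with h | ⟨v, h⟩
    · rw [h] at ht'
      cases ht'
    · rw [h] at ht'
      obtain rfl := Option.some_injective _ ht'
      rw [junctionPiece] at ht
      split at ht
      · rename_i e e' h₁ h₂
        obtain rfl := Option.some_injective _ ht
        exact ⟨(inSeg_eq_some.1 h₁).1, (outSeg_eq_some.1 h₂).1⟩
      · rename_i e h₁ h₂
        obtain rfl := Option.some_injective _ ht
        exact ⟨(inSeg_eq_some.1 h₁).1, (inSeg_eq_some.1 h₁).1⟩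
      · rename_i e h₁ h₂
        obtain rfl := Option.some_injective _ ht
        exact ⟨(outSeg_eq_some.1 h₂).1, (outSeg_eq_some.1 h₂).1⟩
      · cases ht

/-- The coordinates in `[4] × T`. -/
def sampleMap (T : Finset (Fin m)) : Fin 4 × T → Fin 4 × Fin m := fun a => (a.1, a.2.1)

/-- What the algorithm computes: the displacement formula, with all averages replaced by those over
the sampled coordinates. -/
noncomputable def localOutput (C : Code n m) (h δ : ℝ) (i : Fin 4 × Fin m) (T : Finset (Fin m))
    (info : Fin 2 → VertexInfo n) (y : Option (Fin 4 × T) → ℝ) : ℝ :=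
  max (-1) (min 2 (max (-1) (min 2 (y none)) + δ * (up m i + ∑ k, (pieces √h info k).elim 0 fun p =>
    p.valueOn C h (sampleMap T) i (fun a => y (some a)) (max (-1) (min 2 (y none))))))

lemma isProgrammable_localOutput (C : Code n m) {h : ℝ} (hh : 0 < h) (δ : ℝ) (i : Fin 4 × Fin m)
    (T : Finset (Fin m)) (info : Fin 2 → VertexInfo n) :
    IsProgrammable (localOutput C h δ i T info) := by
  have hx : IsProgrammable fun y : Option (Fin 4 × T) → ℝ => max (-1) (min 2 (y none)) :=
    (IsProgrammable.const (-1)).max ((IsProgrammable.const 2).min (.input none))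
  refine (IsProgrammable.const (-1)).max ((IsProgrammable.const 2).min (hx.add
    ((IsProgrammable.const δ).mul ((IsProgrammable.const _).add (.sum _ fun k => ?_)))))
  rcases hp : pieces √h info k with _ | p
  · exact .const 0
  · obtain ⟨j, hj⟩ := exists_shapes_eq hp
    refine Piece.isProgrammable_valueOn C ?_ i (fun a => .input (some a)) hx
    rw [hj]
    exact shapes_tame (Real.sqrt_pos.2 hh) j

/-! ### Correctness of the algorithm -/

lemma rms_word_sub_sq (C : Code n m) (u v : Vertex n) :
    rms (C.word u - C.word v) ^ 2 = hammingDist (C.enc u) (C.enc v) / m := by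
  rw [rms_sq, avgDot, Fintype.card_fin, hammingDist, Finset.card_filter]
  push_cast
  congr 1
  refine Finset.sum_congr rfl fun j _ => ?_
  simp only [Pi.sub_apply, Code.word]
  cases C.enc u j <;> cases C.enc v j <;> simp

lemma Code.HasRelDist.separated {C : Code n m} {ρ h : ℝ} (hC : C.HasRelDist ρ)
    (hm : 0 < m) (hh : 0 < h) (hh' : h ≤ min ρ 1 / 10000) :
    C.Separated √(min ρ 1) √h where
  m_pos := hm
  s_pos := Real.sqrt_pos.2 hh
  s_le := by
    apply Real.le_sqrt_of_sq_le
    rw [mul_pow, Real.sq_sqrt hh.le]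
    linarith
  q_le := Real.sqrt_le_one.2 (min_le_right _ _)
  le_rms u v huv := by
    apply Real.sqrt_le_iff.2 ⟨rms_nonneg _, _⟩
    rw [rms_word_sub_sq, le_div_iff₀ (by exact_mod_cast hm)]
    refine le_trans ?_ (hC u v huv)
    gcongr
    exact min_le_left _ _

lemma height_le_two (hm : 0 < m) {x : Point m} (hx : ∀ i, x i ∈ Set.Icc (-1 : ℝ) 2) :
    height x ≤ 2 := by
  rw [height, div_le_iff₀ (by exact_mod_cast hm)]
  calc ∑ j, x (3, j) ≤ ∑ _j : Fin m, (2 : ℝ) := Finset.sum_le_sum fun j _ => (hx _).2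
    _ = 2 * m := by simp [mul_comm]

lemma abs_truncate_sub_le (a b : ℝ) : |max (-1) (min 2 a) - max (-1) (min 2 b)| ≤ |a - b| :=
  (abs_max_sub_max_le_max _ _ _ _).trans <| by
    simpa using abs_min_sub_min_le_max 2 a 2 b

/-- The best information on the vertices whose codewords are near the blocks of `x`. -/
noncomputable def fullInfo (C : Code n m) (G : EoLGraph n) (h : ℝ) (x : Point m) (r : Fin 2) :
    VertexInfo n :=
  open Classical in
  if H : ∃ v, rms (block x (slotBlock r) - C.word v) ≤ 25 * √h then some (G.known H.choose)
  else none

lemma fullInfo_eq_none_or (C : Code n m) (G : EoLGraph n) (h : ℝ) (x : Point m) (r : Fin 2) :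
    fullInfo C G h x r = none ∨ ∃ v, fullInfo C G h x r = some (G.known v) := by
  rw [fullInfo]
  split_ifs with H
  · exact .inr ⟨_, rfl⟩
  · exact .inl rfl

lemma Code.Admissible.eq_none_or {C : Code n m} {G : EoLGraph n} {q h : ℝ}
    (hC : C.Separated q √h) {x : Point m} {r : Fin 2} {info : VertexInfo n}
    (ha : C.Admissible G h (block x (slotBlock r)) info) :
    info = none ∨ info = fullInfo C G h x r := by
  rcases ha with ⟨h₁, -⟩ | ⟨v, h₁, h₂, -⟩
  · exact .inl h₁
  · right
    have H : ∃ v, rms (block x (slotBlock r) - C.word v) ≤ 25 * √h := ⟨v, h₂⟩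
    have hv : v = H.choose := by
      apply hC.eq_of_rms_lt
      have h₃ := rms_sub_le (C.word v) (block x (slotBlock r)) (C.word H.choose)
      rw [rms_sub_comm (C.word v) (block x _)] at h₃
      linarith [H.choose_spec, hC.s_pos]
    rw [fullInfo, dif_pos H, ← hv, h₁]
    rfl

/-- The terms known from admissible information are among those known from the best one. -/
lemma pieces_eq_none_or {C : Code n m} {G : EoLGraph n} {q h : ℝ}
    (hC : C.Separated q √h) {x : Point m} {info : Fin 2 → VertexInfo n}
    (ha : ∀ r, C.Admissible G h (block x (slotBlock r)) (info r)) (k : Option (Fin 4)) :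
    pieces √h info k = none ∨ pieces √h info k = pieces √h (fullInfo C G h x) k := by
  cases k with
  | none => exact .inr rfl
  | some κ =>
    rcases (ha (slot κ)).eq_none_or hC with h₁ | h₁
    · exact .inl (by rw [pieces, h₁, Option.bind_none])
    · exact .inr (by rw [pieces, pieces, h₁])

/-- The pairs of functions whose products have to be averaged for a local term. -/
noncomputable def Piece.testPair (C : Code n m) (p : Piece n) (x : Point m) :
    Fin 3 → Point m × Point m :=
  ![(C.tgt p.e - C.src p.e, x - C.src p.e), (C.tgt p.e' - C.src p.e', x - C.src p.e'),
    (x - p.center C (C.tau p.e x) (C.tau p.e' x), x - p.center C (C.tau p.e x) (C.tau p.e' x))]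

/-- The average of `g * g'` over one column of the `4 × m` matrix of coordinates. -/
noncomputable def colAvg (g g' : Point m) (j : Fin m) : ℝ := (∑ r, g (r, j) * g' (r, j)) / 4

lemma avgDot_eq_colAvg (g g' : Point m) : avgDot g g' = (∑ j, colAvg g g' j) / m := by
  simp only [avgDot, colAvg, Fintype.sum_prod_type_right, ← Finset.sum_div, Fintype.card_prod,
    Fintype.card_fin]
  push_cast
  rw [div_div]

lemma avgDot_sampleMap (T : Finset (Fin m)) (g g' : Point m) :
    avgDot (g ∘ sampleMap T) (g' ∘ sampleMap T) = (∑ j ∈ T, colAvg g g' j) / T.card := by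
  rw [← Finset.sum_coe_sort T (colAvg g g')]
  simp only [avgDot, colAvg, Fintype.sum_prod_type_right, ← Finset.sum_div, Fintype.card_prod,
    Fintype.card_fin, Fintype.card_coe, sampleMap, Function.comp_apply]
  push_cast
  rw [div_div]

lemma abs_colAvg_le {g g' : Point m} {B : ℝ} (h : ∀ i, |g i * g' i| ≤ B) (j : Fin m) :
    |colAvg g g' j| ≤ B := by
  rw [colAvg, abs_div, abs_of_pos (by norm_num : (0 : ℝ) < 4), div_le_iff₀ (by norm_num)]
  calc |∑ r, g (r, j) * g' (r, j)| ≤ ∑ r, |g (r, j) * g' (r, j)| := Finset.abs_sum_le_sum_abs _ _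
    _ ≤ ∑ _r : Fin 4, B := Finset.sum_le_sum fun r _ => h _
    _ = B * 4 := by simp [mul_comm]

lemma Code.Separated.le_rms_sq {C : Code n m} {G : EoLGraph n} {r s : ℝ} (hr : 0 ≤ r)
    (hC : C.Separated √r s) {e : Segment n} (he : G.IsSegment e) :
    r / 4 ≤ rms (C.tgt e - C.src e) ^ 2 := by
  have := pow_le_pow_left₀ (by positivity) (hC.le_rms_tgt_sub_src he) 2
  rw [div_pow, Real.sq_sqrt hr] at this
  linarith

/-- The functions to be averaged are bounded. -/
lemma exists_testPair_bound {r s : ℝ} (hr : 0 < r) (hr1 : r ≤ 1) (hs : 0 < s) :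
    ∃ B : ℝ, 1 ≤ B ∧ ∀ (n m : ℕ) (C : Code n m) (G : EoLGraph n), C.Separated √r s →
      ∀ p : Piece n, G.IsSegment p.e → G.IsSegment p.e' → (∃ j, p.shape = shapes s j) →
      ∀ x : Point m, (∀ i, x i ∈ Set.Icc (-1 : ℝ) 2) → ∀ t i,
        |(p.testPair C x t).1 i * (p.testPair C x t).2 i| ≤ B := by
  choose Z hZ0 hZ using fun j => (shapes_tame hs j).exists_center_bound (24 / r)
  have hsum : 0 ≤ ∑ j, (2 + Z j) ^ 2 := Finset.sum_nonneg fun j _ => sq_nonneg (2 + Z j)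
  refine ⟨6 + ∑ j, (2 + Z j) ^ 2, by linarith, ?_⟩
  rintro n m C G hC p he he' ⟨j, hj⟩ x hx t i
  have h24 : 2 ≤ 24 / r := by rw [le_div_iff₀ hr]; linarith
  have habs' : ∀ {a : ℝ}, a ∈ Set.Icc (0 : ℝ) 2 → |a| ≤ 24 / r := fun ha => by
    rw [abs_le]; constructor <;> linarith [ha.1, ha.2]
  fin_cases t
  · exact (C.abs_mul_le p.e i (hx i)).trans (by linarith)
  · exact (C.abs_mul_le p.e' i (hx i)).trans (by linarith)
  · have hz : |p.center C (C.tau p.e x) (C.tau p.e' x) i| ≤ Z j := by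
      have := hZ j _ _ (Code.abs_tauOn_le hr (hC.le_rms_sq hr.le he) id hx)
        (Code.abs_tauOn_le hr (hC.le_rms_sq hr.le he') id hx) _ _ _ _ (habs' (C.src_mem_Icc p.e i))
        (habs' (C.tgt_mem_Icc p.e i)) (habs' (C.src_mem_Icc p.e' i)) (habs' (C.tgt_mem_Icc p.e' i))
      rwa [← hj] at this
    have hd : |(x - p.center C (C.tau p.e x) (C.tau p.e' x)) i| ≤ 2 + Z j := by
      refine (abs_sub _ _).trans (add_le_add ?_ hz)
      rw [abs_le]
      constructor <;> linarith [(hx i).1, (hx i).2]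
    have := Finset.single_le_sum (fun j _ => sq_nonneg (2 + Z j)) (Finset.mem_univ j)
    calc _ = |(x - p.center C (C.tau p.e x) (C.tau p.e' x)) i| *
          |(x - p.center C (C.tau p.e x) (C.tau p.e' x)) i| := abs_mul _ _
      _ ≤ (2 + Z j) * (2 + Z j) := mul_le_mul hd hd (abs_nonneg _) (by linarith [hZ0 j])
      _ = (2 + Z j) ^ 2 := (pow_two _).symm
      _ ≤ _ := by linarith

/-- With high probability all local terms of `x` are well sampled. -/
lemma exists_wellSampled {r s γ η : ℝ} (hr : 0 < r) (hr1 : r ≤ 1) (hs : 0 < s) (hγ : 0 < γ)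
    (hη : 0 < η) : ∃ M : ℕ, 0 < M ∧ ∀ (n m : ℕ) (C : Code n m), C.Separated √r s →
      ∀ (c k ℓ : ℕ) (θ : ℝ) (col : Fin m → Fin c) (μ : PMF (Finset (Fin c))),
      1 ≤ ℓ → M ≤ k → M * ℓ ≤ c → θ ≤ 1 / M →
      (∀ a a' : Fin c, (Finset.univ.filter (fun j => col j = a)).card =
        (Finset.univ.filter (fun j => col j = a')).card) →
      IsKWiseIndep μ k ℓ θ →
      ∀ (G : EoLGraph n) (x : Point m), (∀ i, x i ∈ Set.Icc (-1 : ℝ) 2) →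
      ∀ info : Fin 2 → VertexInfo n, (∀ r, info r = none ∨ ∃ v, info r = some (G.known v)) →
      ENNReal.ofReal (1 - γ) ≤ μ.toOuterMeasure {S | ∀ k p, pieces s info k = some p →
        p.WellSampled C (sampleMap (columnUnion col S)) η x} := by
  obtain ⟨B, hB1, hB⟩ := exists_testPair_bound hr hr1 hs
  obtain ⟨M, hM0, hM⟩ := exists_sample_average_close 15 hB1 hγ hη
  refine ⟨M, hM0, fun n m C hC c k ℓ θ col μ hℓ hk hMc hθ hcol hμ G x hx info hinfo => ?_⟩
  have hcard : Fintype.card (Option (Fin 4) × Fin 3) ≤ 15 := by simp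
  refine (hM m c k ℓ θ col μ hC.m_pos hℓ hk hMc hθ hcol hμ (Option (Fin 4) × Fin 3) hcard
    (fun a => (pieces s info a.1).elim 0 fun p =>
      colAvg (p.testPair C x a.2).1 (p.testPair C x a.2).2) ?_).trans (μ.toOuterMeasure.mono ?_)
  · rintro ⟨a, t⟩ j
    rcases hp : pieces s info a with _ | p
    · simpa [hp] using zero_le_one.trans hB1
    · obtain ⟨he, he'⟩ := isSegment_of_pieces_eq hinfo hp
      simp only [Option.elim_some]
      exact abs_colAvg_le (hB n m C G hC p he he' (exists_shapes_eq hp) x hx t) j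
  · intro S hS a p hp
    have key : ∀ t, AvgClose (sampleMap (columnUnion col S)) η (p.testPair C x t).1
        (p.testPair C x t).2 := by
      intro t
      have := hS (a, t)
      simp only [hp, Option.elim_some] at this
      rwa [AvgClose, avgDot_sampleMap, avgDot_eq_colAvg]
    exact ⟨key 0, key 1, key 2⟩

/-- Given that all local terms are well sampled, the algorithm is correct. -/
lemma exists_localOutput_close {r h : ℝ} (hr : 0 < r) (hr1 : r ≤ 1) (hh : 0 < h) :
    ∃ Λ : ℝ, 0 ≤ Λ ∧ ∀ (n m : ℕ) (C : Code n m), C.Separated √r √h → ∀ (G : EoLGraph n)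
      (x : Point m), (∀ i, x i ∈ Set.Icc (-1 : ℝ) 2) → ∀ (T : Finset (Fin m)) (η : ℝ), 0 ≤ η →
      η ≤ 1 → (∀ k p, pieces √h (fullInfo C G h x) k = some p →
        p.WellSampled C (sampleMap T) η x) →
      ∀ (i : Fin 4 × Fin m) (info : Fin 2 → VertexInfo n),
      (∀ r, C.Admissible G h (block x (slotBlock r)) (info r)) → ∀ (δ ε : ℝ), 0 ≤ δ →
      ∀ y : Option (Fin 4 × T) → ℝ, |y none - x i| ≤ ε →
      (∀ a, y (some a) ∈ Set.Icc (-1 : ℝ) 2) →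
      rms ((fun a => y (some a)) - x ∘ sampleMap T) ≤ ε →
      |localOutput C h δ i T info y - C.brouwer G h δ x i| ≤ ε + δ * (Λ * (ε + √η)) := by
  have hs := Real.sqrt_pos.2 hh
  choose Λ hΛ0 hΛ using fun j => (shapes_tame hs j).exists_estimate h hr hr1
  have hΛs : ∀ j, Λ j ≤ ∑ j, Λ j := fun j =>
    Finset.single_le_sum (fun j _ => hΛ0 j) (Finset.mem_univ j)
  have hΛs0 : 0 ≤ ∑ j, Λ j := Finset.sum_nonneg fun j _ => hΛ0 j
  refine ⟨5 * ∑ j, Λ j, by positivity, ?_⟩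
  intro n m C hC G x hx T η hη hη1 hws i info ha δ ε hδ y hyn hys hyx
  have hε : 0 ≤ ε := (abs_nonneg _).trans hyn
  -- Truncating the estimate of `x i` does not increase its error and makes it bounded.
  set ξ := max (-1) (min 2 (y none)) with hξ
  have hξm : ξ ∈ Set.Icc (-1 : ℝ) 2 := ⟨le_max_left _ _, max_le (by norm_num) (min_le_left _ _)⟩
  have hξx : |ξ - x i| ≤ ε := by
    have h₁ : x i = max (-1) (min 2 (x i)) := by
      rw [min_eq_right (hx i).2, max_eq_right (hx i).1]
    rw [h₁]
    exact (abs_truncate_sub_le _ _).trans hyn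
  rw [localOutput, Code.brouwer, disp_apply hC hh ha i δ (height_le_two hC.m_pos hx)]
  refine (abs_truncate_sub_le _ _).trans ?_
  rw [← hξ, add_sub_add_comm, ← mul_sub, add_sub_add_left_eq_sub, ← Finset.sum_sub_distrib]
  refine (abs_add_le _ _).trans (add_le_add hξx ?_)
  rw [abs_mul, abs_of_nonneg hδ]
  refine mul_le_mul_of_nonneg_left ?_ hδ
  refine (Finset.abs_sum_le_sum_abs _ _).trans ?_
  have hterm : ∀ k, |((pieces √h info k).elim 0 fun p =>
      p.valueOn C h (sampleMap T) i (fun a => y (some a)) ξ) -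
      (pieces √h info k).elim 0 fun p => p.value C h x i| ≤ (∑ j, Λ j) * (ε + √η) := by
    intro k
    rcases pieces_eq_none_or hC ha k with h₁ | h₁
    · rw [h₁]
      simp only [Option.elim_none, sub_self, abs_zero]
      positivity
    · rw [h₁]
      rcases hp : pieces √h (fullInfo C G h x) k with _ | p
      · simp only [Option.elim_none, sub_self, abs_zero]
        positivity
      · obtain ⟨he, he'⟩ := isSegment_of_pieces_eq (fullInfo_eq_none_or C G h x) hp
        obtain ⟨j, hj⟩ := exists_shapes_eq hp
        simp only [Option.elim_some]
        refine (hΛ j n m C p hj (hC.le_rms_sq hr.le he) (hC.le_rms_sq hr.le he') _ _ η ε x _ i ξ hε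
          hη hη1 hx hys hξm hξx hyx (hws k p hp)).trans ?_
        gcongr
        exact hΛs j
  calc _ ≤ ∑ _k : Option (Fin 4), (∑ j, Λ j) * (ε + √η) := Finset.sum_le_sum fun k _ => hterm k
    _ = _ := by
      rw [Finset.sum_const, Finset.card_univ, Fintype.card_option, Fintype.card_fin, nsmul_eq_mul]
      push_cast
      ring

end Algorithm

theorem mainTheorem5 :
    ∃ K : ℝ, 0 < K ∧
    ∀ ρ : ℝ, 0 < ρ →
    ∃ h₀ : ℝ, 0 < h₀ ∧ ∀ h : ℝ, 0 < h → h ≤ h₀ →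
    ∃ δ₀ : ℝ, 0 < δ₀ ∧ ∀ δ : ℝ, 0 < δ → δ ≤ δ₀ →
    ∃ A : (n m : ℕ) → Code n m → LocalAlgorithm n m,
    ∀ γ : ℝ, 0 < γ →
    ∃ M : ℕ, 0 < M ∧
    ∀ (n m : ℕ) (C : Code n m), C.HasRelDist ρ →
    ∀ (c k ℓ : ℕ) (θ : ℝ) (col : Fin m → Fin c) (μ : PMF (Finset (Fin c))),
      1 ≤ ℓ → M ≤ k → M * ℓ ≤ c → θ ≤ 1 / M →
      (∀ a a' : Fin c, (Finset.univ.filter (fun j => col j = a)).card =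
        (Finset.univ.filter (fun j => col j = a')).card) →
      IsKWiseIndep μ k ℓ θ →
    ∀ (G : EoLGraph n) (x : Point m), (∀ i, x i ∈ Set.Icc (-1 : ℝ) 2) →
      ENNReal.ofReal (1 - γ) ≤ μ.toOuterMeasure {S |
        ∀ (i : Fin 4 × Fin m) (info : Fin 2 → VertexInfo n),
          C.Admissible G h (block x 0) (info 0) → C.Admissible G h (block x 1) (info 1) →
        ∀ (ε xi : ℝ) (xT : Fin 4 × columnUnion col S → ℝ),
          |xi - x i| ≤ ε →
          (∀ p, xT p ∈ Set.Icc (-1 : ℝ) 2) →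
          (∀ r : Fin 4, rms (fun j : columnUnion col S => xT (r, j) - x (r, j.1)) ≤ ε) →
          |(A n m C).out i (columnUnion col S) info xi xT - C.brouwer G h δ x i|
            ≤ K * ε + γ} := by
  refine ⟨2, two_pos, fun ρ hρ => ?_⟩
  have hr : 0 < min ρ 1 := lt_min hρ one_pos
  have hr1 : min ρ 1 ≤ 1 := min_le_right _ _
  -- The bound means that `100 * √h ≤ √(min ρ 1)`.
  refine ⟨min ρ 1 / 10000, by positivity, fun h hh hh' => ?_⟩
  obtain ⟨Λ, hΛ0, hΛ⟩ := exists_localOutput_close hr hr1 hh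
  -- Then `δ * Λ ≤ 1`, so that the error of the displacement is at most `ε` plus the sampling error.
  refine ⟨1 / (Λ + 1), by positivity, fun δ hδ hδ' => ?_⟩
  choose A hA using fun (n m : ℕ) (C : Code n m) (i : Fin 4 × Fin m) (T : Finset (Fin m))
    (info : Fin 2 → VertexInfo n) => isProgrammable_localOutput C hh δ i T info
  refine ⟨A, fun γ hγ => ?_⟩
  -- The sampling error enters the output through `√η`, hence the square.
  obtain ⟨M, hM0, hM⟩ := exists_wellSampled hr hr1 (Real.sqrt_pos.2 hh) hγ
    (lt_min one_pos (pow_pos hγ 2) : 0 < min 1 (γ ^ 2))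
  refine ⟨M, hM0, fun n m C hC c k ℓ θ col μ hℓ hk hMc hθ hcol hμ G x hx => ?_⟩
  rcases Nat.eq_zero_or_pos m with rfl | hm
  · refine le_trans ?_ (le_of_eq ((μ.toOuterMeasure_apply_eq_one_iff _).2 ?_).symm)
    · exact ENNReal.ofReal_le_one.2 (by linarith)
    · exact fun S _ i => i.2.elim0
  have hC' := hC.separated hm hh hh'
  refine (hM n m C hC' c k ℓ θ col μ hℓ hk hMc hθ hcol hμ G x hx (fullInfo C G h x)
    (fullInfo_eq_none_or C G h x)).trans (μ.toOuterMeasure.mono ?_)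
  intro S hS i info ha₀ ha₁ ε xi xT hxi hxT hxTr
  have hε : 0 ≤ ε := (abs_nonneg _).trans hxi
  have ha : ∀ r, C.Admissible G h (block x (slotBlock r)) (info r) := fun r => by
    fin_cases r
    exacts [ha₀, ha₁]
  have hmain := hΛ n m C hC' G x hx (columnUnion col S) (min 1 (γ ^ 2)) (by positivity)
    (min_le_left _ _) hS i info ha δ ε hδ.le (fun o => o.elim xi xT) hxi hxT
    (rms_fin_four_le hε hxTr)
  rw [LocalAlgorithm.out, hA]
  refine hmain.trans ?_
  have hδΛ : δ * Λ ≤ 1 := by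
    rw [le_div_iff₀ (by positivity)] at hδ'
    nlinarith
  have hsq : √(min 1 (γ ^ 2)) ≤ γ := by
    apply Real.sqrt_le_iff.2 ⟨hγ.le, min_le_right _ _⟩
  have h₂ : δ * Λ * (ε + √(min 1 (γ ^ 2))) ≤ 1 * (ε + γ) := by gcongr
  linarith
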